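/- **Conventions.** Let $k$ be a field of characteristic $0$, and give $k[[h]]$ the $h$-adic topology. Completed tensor products $\widetilde\otimes$ of linearly topologised $k[[h]]$-modules are projective limits of the $M/U\otimes N/V$ over open submodules $U,V$; for $h$-adic topologies this is the $h$-adic completion $\widehat\otimes$ of the algebraic tensor product, and $k[[h]]^{E_1}\,\widetilde\otimes\,k[[h]]^{E_2}=k[[h]]^{E_1\times E_2}$. A *topological Hopf algebra* $H$ has continuous structure maps, its coproduct taking values in the completed tensor square, and satisfies the Hopf algebra axioms in the completed sense. For a Lie bialgebra $\mathfrak g$ of finite dimension over $k$, $U(\mathfrak g)$ is the co-Poisson Hopf algebra whose Poisson cobracket extends the cobracket of $\mathfrak g$; $\mathfrak g^*$ is the dual Lie bialgebra; and $F[[\mathfrak g]]:=U(\mathfrak g)^*$ is the linear dual of $U(\mathfrak g)$ with the weak topology and the transposed structure of topological Poisson Hopf algebra. A *QUEA* (quantisation $U_h(\mathfrak g)$ of $U(\mathfrak g)$) is a topological Hopf algebra $H$ over $k[[h]]$ which is topologically free (isomorphic to $V[[h]]$ for a $k$-vector space $V$, with the $h$-adic topology), together with an identification of $H/hH$ with $U(\mathfrak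 g)$ as co-Poisson Hopf algebras, the cobracket of $H/hH$ being induced by $h^{-1}(\Delta-\Delta^{\mathrm{op}})$. A *QFSHA* (quantisation of $F[[\mathfrak g]]$) is a topological Hopf algebra $K$ over $k[[h]]$ isomorphic as a topological module to some $k[[h]]^E$ with the product topology, such that $K/hK\cong F[[\mathfrak g]]$ as topological Poisson Hopf algebras, the Poisson bracket of $K/hK$ being induced by $h^{-1}(xy-yx)$. For a topological Hopf algebra $H$ over $k[[h]]$ put $\Delta^0=\epsilon$, $\Delta^1=\mathrm{id}$, $\Delta^n=(\Delta\otimes\mathrm{id}^{\otimes(n-2)})\circ\Delta^{n-1}$ for $n\ge2$, $\delta_n=(\mathrm{id}-\epsilon)^{\otimes n}\circ\Delta^n$, and $$H'=\{a\in H : \delta_n(a)\in h^nH^{\otimes n}\ \text{for all } n\ge0\},$$ with $H^{\otimes n}$ the completed tensor power. **Proposition 3.6.** Let $U_h(\mathfrak g)$ be a QUEA, where $\mathfrak g$ is a finite dimensional Lie bialgebra over $k$. (1) $U_h(\mathfrak g)'$ is a $k[[h]]$-subalgebra of $U_h(\mathfrak g)$. With the topology induced from the $h$-adic topology of $U_h(\mathfrak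 g)$ it has a structure of topological Hopf algebra for which the inclusion into $U_h(\mathfrak g)$ is a morphism of topological Hopf algebras, and with it $U_h(\mathfrak g)'$ is a QFSHA, a quantisation of $F[[\mathfrak g^*]]$: as topological Poisson Hopf algebras, $$U_h(\mathfrak g)'/h\,U_h(\mathfrak g)'\cong F[[\mathfrak g^*]].$$ (2) For every ordered basis $(b_1,\dots,b_d)$ of $\mathfrak g$ there are $x_1,\dots,x_d\in U_h(\mathfrak g)$ with $x_i \bmod h = b_i$ and $\epsilon(x_i)=0$ for all $i$, such that, writing $x^e=x_1^{e_1}\cdots x_d^{e_d}$ and $|e|=e_1+\dots+e_d$ for $e\in\mathbb N^d$, every series $\sum_{e} a_e h^{|e|}x^e$ with coefficients $a_e\in k[[h]]$ converges $h$-adically in $U_h(\mathfrak g)$, and $$U_h(\mathfrak g)'=\Big\{\sum_{e\in\mathbb N^d} a_e\,h^{|e|}x^e : a_e\in k[[h]]\Big\};$$ moreover $U_h(\mathfrak g)'$ is the closure in $U_h(\mathfrak g)$ of the $k[[h]]$-subalgebra generated by $hx_1,\dots,hx_d$. -/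

import Mathlib

open scoped TensorProduct PowerSeries Topology
open Filter

universe u

noncomputable section

/-! ## Lie bialgebras and their duals -/

section LieBialgebras

/-- The bilinear map on `Module.Dual k g` obtained by transposing `δ : g → g ⊗ g`:
`⟨dualBracket δ α β, x⟩ = ⟨α ⊗ β, δ x⟩`. -/
def dualBracket {k g : Type*} [Field k] [AddCommGroup g] [Module k g]
    (δ : g →ₗ[k] g ⊗[k] g) :
    Module.Dual k g →ₗ[k] Module.Dual k g →ₗ[k] Module.Dual k g :=
  (TensorProduct.mk k (Module.Dual k g) (Module.Dual k g)).compr₂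
    (δ.dualMap ∘ₗ TensorProduct.dualDistrib k g g)

theorem dualBracket_apply {k g : Type*} [Field k] [AddCommGroup g] [Module k g]
    (δ : g →ₗ[k] g ⊗[k] g) (α β : Module.Dual k g) (x : g) :
    dualBracket δ α β x = TensorProduct.dualDistrib k g g (α ⊗ₜ β) (δ x) := rfl

/-- A Lie bialgebra: a Lie algebra `g` with a linear map `δ : g → g ⊗ g` whose transpose is a Lie
bracket on the dual space of `g`, and which is a 1-cocycle of `g` with values in `g ⊗ g`. -/
class LieBialgebra (k g : Type*) [Field k] [LieRing g] [LieAlgebra k g] where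
  cobracket : g →ₗ[k] g ⊗[k] g
  dual_self : ∀ α : Module.Dual k g, dualBracket cobracket α α = 0
  dual_jacobi : ∀ α β γ : Module.Dual k g,
    dualBracket cobracket α (dualBracket cobracket β γ) =
      dualBracket cobracket (dualBracket cobracket α β) γ +
        dualBracket cobracket β (dualBracket cobracket α γ)
  cocycle : ∀ x y : g, cobracket ⁅x, y⁆ = ⁅x, cobracket y⁆ - ⁅y, cobracket x⁆

/-- The dual space of a Lie bialgebra, carrying the dual Lie bialgebra structure below. -/
def LieDual (k g : Type*) [Field k] [LieRing g] [LieAlgebra k g] [LieBialgebra k g] : Type _ :=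
  Module.Dual k g

variable (k g : Type*) [Field k] [LieRing g] [LieAlgebra k g] [LieBialgebra k g]

instance : AddCommGroup (LieDual k g) := inferInstanceAs (AddCommGroup (Module.Dual k g))

instance : Module k (LieDual k g) := inferInstanceAs (Module k (Module.Dual k g))

instance [FiniteDimensional k g] : FiniteDimensional k (LieDual k g) :=
  inferInstanceAs (FiniteDimensional k (Module.Dual k g))

instance : LieRing (LieDual k g) where
  bracket α β := dualBracket (LieBialgebra.cobracket (k := k) (g := g)) α β
  add_lie α β γ := LinearMap.map_add₂ (dualBracket LieBialgebra.cobracket) α β γ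
  lie_add α β γ := map_add (dualBracket LieBialgebra.cobracket α) β γ
  lie_self α := LieBialgebra.dual_self α
  leibniz_lie α β γ := LieBialgebra.dual_jacobi α β γ

instance : LieAlgebra k (LieDual k g) where
  lie_smul c α β := map_smul (dualBracket LieBialgebra.cobracket α) c β

variable {k g}

variable (k g) in
/-- The evaluation pairing between the dual of `g` and `g`. -/
def LieDual.eval : LieDual k g →ₗ[k] g →ₗ[k] k := LinearMap.id (M := Module.Dual k g)

theorem LieDual.ext_eval {α β : LieDual k g}
    (hab : ∀ x, LieDual.eval k g α x = LieDual.eval k g β x) : α = β :=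
  LinearMap.ext (f := (show Module.Dual k g from α)) hab

theorem LieDual.eval_lie (α β : LieDual k g) (x : g) :
    LieDual.eval k g ⁅α, β⁆ x = TensorProduct.lid k k (TensorProduct.map (LieDual.eval k g α)
      (LieDual.eval k g β) (LieBialgebra.cobracket x)) := by
  change TensorProduct.dualDistrib k g g (LieDual.eval k g α ⊗ₜ LieDual.eval k g β)
    (LieBialgebra.cobracket x) = _
  generalize (LieBialgebra.cobracket x : g ⊗[k] g) = t
  induction t with
  | zero => simp
  | tmul a b => simp [TensorProduct.dualDistrib_apply]
  | add s t hs ht => simp only [map_add, hs, ht]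

variable (k g) in
/-- The bracket of a Lie algebra as a linear map `g ⊗ g → g`. -/
def bracketMap : g ⊗[k] g →ₗ[k] g :=
  TensorProduct.lift (LieModule.toEnd k g g : g →ₗ[k] Module.End k g)

variable (k g) in
/-- The cobracket of the dual: the transpose `g* → (g ⊗ g)* = g* ⊗ g*` of the bracket of `g`. -/
def dualCobracket [FiniteDimensional k g] : LieDual k g →ₗ[k] LieDual k g ⊗[k] LieDual k g :=
  (TensorProduct.dualDistribEquiv k g g).symm.toLinearMap ∘ₗ (bracketMap k g).dualMap

variable (k g) in
/-- The canonical pairing of `g* ⊗ g*` with `g ⊗ g`. -/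
def dualPairing : LieDual k g ⊗[k] LieDual k g →ₗ[k] Module.Dual k (g ⊗[k] g) :=
  TensorProduct.dualDistrib k g g

theorem dualPairing_tmul (α β : LieDual k g) (x y : g) :
    dualPairing k g (α ⊗ₜ β) (x ⊗ₜ y) = LieDual.eval k g α x * LieDual.eval k g β y :=
  TensorProduct.dualDistrib_apply _ _ _ _

theorem dualPairing_tmul_lid (α β : LieDual k g) (t : g ⊗[k] g) :
    dualPairing k g (α ⊗ₜ β) t = TensorProduct.lid k k
      (TensorProduct.map (LieDual.eval k g α) (LieDual.eval k g β) t) := by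
  induction t with
  | zero => simp
  | tmul a b => simp [dualPairing_tmul]
  | add s t hs ht => simp only [map_add, hs, ht]

theorem dualPairing_injective [FiniteDimensional k g] :
    Function.Injective (dualPairing k g) :=
  (TensorProduct.dualDistribEquiv k g g).injective

theorem dualPairing_ext [FiniteDimensional k g] {s t : LieDual k g ⊗[k] LieDual k g}
    (hst : ∀ x y, dualPairing k g s (x ⊗ₜ y) = dualPairing k g t (x ⊗ₜ y)) : s = t :=
  dualPairing_injective (TensorProduct.ext' hst)

theorem dualPairing_dualCobracket [FiniteDimensional k g] (α : LieDual k g) (x y : g) :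
    dualPairing k g (dualCobracket k g α) (x ⊗ₜ y) = LieDual.eval k g α ⁅x, y⁆ := by
  have e : dualPairing k g (dualCobracket k g α) = (bracketMap k g).dualMap α :=
    (TensorProduct.dualDistribEquiv k g g).apply_symm_apply _
  rw [e]
  rfl

theorem dualDistrib_eval (x y : g) (t : LieDual k g ⊗[k] LieDual k g) :
    TensorProduct.dualDistrib k (LieDual k g) (LieDual k g)
      ((LieDual.eval k g).flip x ⊗ₜ (LieDual.eval k g).flip y) t =
      dualPairing k g t (x ⊗ₜ y) := by
  induction t with
  | zero => simp
  | tmul a b => simp [dualPairing_tmul, TensorProduct.dualDistrib_apply]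
  | add s t hs ht => simp only [map_add, hs, ht, LinearMap.add_apply]

theorem dualBracket_dualCobracket [FiniteDimensional k g] (x y : g) :
    dualBracket (dualCobracket k g) ((LieDual.eval k g).flip x) ((LieDual.eval k g).flip y) =
      (LieDual.eval k g).flip ⁅x, y⁆ := by
  ext α
  rw [dualBracket_apply, dualDistrib_eval, dualPairing_dualCobracket]
  rfl

theorem LieDual.eval_flip_surjective [FiniteDimensional k g] :
    Function.Surjective (LieDual.eval k g).flip :=
  (Module.evalEquiv k g).surjective

theorem dualPairing_lie [FiniteDimensional k g] (α : LieDual k g)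
    (t : LieDual k g ⊗[k] LieDual k g) (x y : g) :
    dualPairing k g ⁅α, t⁆ (x ⊗ₜ y) =
      dualPairing k g t (TensorProduct.lid k g (TensorProduct.map (LieDual.eval k g α)
        LinearMap.id (LieBialgebra.cobracket x)) ⊗ₜ y) +
      dualPairing k g t (x ⊗ₜ TensorProduct.lid k g (TensorProduct.map (LieDual.eval k g α)
        LinearMap.id (LieBialgebra.cobracket y))) := by
  have key : ∀ (β : LieDual k g) (z : g), LieDual.eval k g ⁅α, β⁆ z = LieDual.eval k g β
      (TensorProduct.lid k g (TensorProduct.map (LieDual.eval k g α) LinearMap.id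
        (LieBialgebra.cobracket z))) := by
    intro β z
    rw [LieDual.eval_lie]
    generalize (LieBialgebra.cobracket z : g ⊗[k] g) = t
    induction t with
    | zero => simp
    | tmul a b => simp
    | add s t hs ht => simp only [map_add, hs, ht]
  induction t with
  | zero => simp
  | tmul β γ =>
    rw [TensorProduct.LieModule.lie_tmul_right, map_add, LinearMap.add_apply]
    simp only [dualPairing_tmul, key]
  | add s t hs ht =>
    simp only [lie_add, map_add, LinearMap.add_apply, hs, ht]
    ring

/-- The dual of a finite dimensional Lie bialgebra: its bracket is the transpose of the cobracket
of `g`, its cobracket is the transpose of the bracket of `g`. -/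
instance [FiniteDimensional k g] : LieBialgebra k (LieDual k g) where
  cobracket := dualCobracket k g
  dual_self ξ := by
    obtain ⟨x, rfl⟩ := LieDual.eval_flip_surjective ξ
    rw [dualBracket_dualCobracket, lie_self, map_zero]
  dual_jacobi ξ η ζ := by
    obtain ⟨x, rfl⟩ := LieDual.eval_flip_surjective ξ
    obtain ⟨y, rfl⟩ := LieDual.eval_flip_surjective η
    obtain ⟨z, rfl⟩ := LieDual.eval_flip_surjective ζ
    simp only [dualBracket_dualCobracket]
    rw [leibniz_lie, map_add]
  cocycle α β := by
    have flip : ∀ (γ : LieDual k g) (t : g ⊗[k] g) (δ : LieDual k g),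
        LieDual.eval k g δ (TensorProduct.lid k g
          (TensorProduct.map (LieDual.eval k g γ) LinearMap.id t)) =
          dualPairing k g (γ ⊗ₜ δ) t := by
      intro γ t δ
      rw [dualPairing_tmul_lid]
      induction t with
      | zero => simp
      | tmul a b => simp
      | add s t hs ht => simp only [map_add, hs, ht]
    have skew : ∀ (γ δ : LieDual k g) (x : g),
        dualPairing k g (γ ⊗ₜ δ) (LieBialgebra.cobracket x) =
          - dualPairing k g (δ ⊗ₜ γ) (LieBialgebra.cobracket x) := by
      intro γ δ x
      have h1 : LieDual.eval k g ⁅γ, δ⁆ x = - LieDual.eval k g ⁅δ, γ⁆ x := by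
        rw [← lie_skew δ γ, map_neg, LinearMap.neg_apply, neg_neg]
      simpa only [LieDual.eval_lie, ← dualPairing_tmul_lid] using h1
    have act : ∀ (x y : g), dualPairing k g (α ⊗ₜ β) ⁅x, LieBialgebra.cobracket y⁆ =
        LieDual.eval k g β ⁅x, TensorProduct.lid k g (TensorProduct.map
          (LieDual.eval k g α) LinearMap.id (LieBialgebra.cobracket y))⁆ -
        LieDual.eval k g α ⁅x, TensorProduct.lid k g (TensorProduct.map
          (LieDual.eval k g β) LinearMap.id (LieBialgebra.cobracket y))⁆ := by
      intro x y
      have h2 : TensorProduct.lid k g (TensorProduct.map (LieDual.eval k g β) LinearMap.id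
          (LieBialgebra.cobracket y)) = - TensorProduct.rid k g (TensorProduct.map
          LinearMap.id (LieDual.eval k g β) (LieBialgebra.cobracket y)) := by
        rw [← sub_eq_zero]
        suffices hz : ∀ δ : LieDual k g, LieDual.eval k g δ _ = 0 from
          (Module.forall_dual_apply_eq_zero_iff k _).1 hz
        intro δ
        have h3 := skew β δ y
        have h4 : ∀ t : g ⊗[k] g, dualPairing k g (δ ⊗ₜ β) t =
            LieDual.eval k g δ (TensorProduct.rid k g (TensorProduct.map
              LinearMap.id (LieDual.eval k g β) t)) := by
          intro t
          induction t with
          | zero => simp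
          | tmul a b => simp [dualPairing_tmul, mul_comm]
          | add s t hs ht => simp only [map_add, hs, ht]
        rw [← flip, h4] at h3
        rw [sub_neg_eq_add, map_add]
        exact add_eq_zero_iff_eq_neg.2 h3
      rw [h2]
      generalize (LieBialgebra.cobracket y : g ⊗[k] g) = t
      induction t with
      | zero => simp
      | tmul a b =>
        rw [TensorProduct.LieModule.lie_tmul_right, map_add, dualPairing_tmul, dualPairing_tmul]
        simp
        ring
      | add s t hs ht =>
        simp only [lie_add, map_add, hs, ht, neg_add]
        ring
    refine dualPairing_ext fun x y => ?_
    rw [dualPairing_dualCobracket, map_sub, LinearMap.sub_apply, dualPairing_lie,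
      dualPairing_lie]
    simp only [dualPairing_dualCobracket]
    rw [LieDual.eval_lie, ← dualPairing_tmul_lid, LieBialgebra.cocycle, map_sub, act, act]
    rw [← lie_skew y, ← lie_skew y]
    simp only [map_neg]
    ring

end LieBialgebras

/-! ## The co-Poisson Hopf algebra `U(g)` and the Poisson Hopf algebra `F[[g]] = U(g)*` -/

section EnvelopingAlgebras

attribute [local instance] LieRing.ofAssociativeRing

variable (k g : Type*) [Field k] [LieRing g] [LieAlgebra k g]

local notation "U" => UniversalEnvelopingAlgebra k g

/-- The coproduct of `U(g)`: the algebra morphism with `Δ x = x ⊗ 1 + 1 ⊗ x` for `x ∈ g`. -/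
def envComul : U →ₐ[k] U ⊗[k] U :=
  UniversalEnvelopingAlgebra.lift k
    { toFun := fun x => UniversalEnvelopingAlgebra.ι k x ⊗ₜ 1 +
        1 ⊗ₜ UniversalEnvelopingAlgebra.ι k x
      map_add' := fun x y => by
        simp only [map_add, TensorProduct.add_tmul, TensorProduct.tmul_add]; abel
      map_smul' := fun c x => by
        simp only [map_smul, TensorProduct.smul_tmul', TensorProduct.tmul_smul, smul_add,
          RingHom.id_apply]
      map_lie' := fun {x y} => by
        simp only [LieHom.map_lie, LieRing.of_associative_ring_bracket, mul_add, add_mul,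
          Algebra.TensorProduct.tmul_mul_tmul, one_mul, mul_one, TensorProduct.sub_tmul,
          TensorProduct.tmul_sub]
        abel }

theorem envComul_ι (x : g) : envComul k g (UniversalEnvelopingAlgebra.ι k x) =
    UniversalEnvelopingAlgebra.ι k x ⊗ₜ 1 + 1 ⊗ₜ UniversalEnvelopingAlgebra.ι k x :=
  UniversalEnvelopingAlgebra.lift_ι_apply k _ x

/-- The counit of `U(g)`: the algebra morphism vanishing on `g`. -/
def envCounit : U →ₐ[k] k := UniversalEnvelopingAlgebra.lift k 0

/-- The antipode of `U(g)`: the algebra antimorphism with `S x = - x` for `x ∈ g`. -/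
def envAntipode : U →ₗ[k] U :=
  (MulOpposite.opLinearEquiv k).symm.toLinearMap ∘ₗ
    (UniversalEnvelopingAlgebra.lift k
      { toFun := fun x => MulOpposite.op (- UniversalEnvelopingAlgebra.ι k x)
        map_add' := fun x y => by simp only [map_add, neg_add, MulOpposite.op_add]
        map_smul' := fun c x => by
          simp only [map_smul, RingHom.id_apply, ← smul_neg, MulOpposite.op_smul]
        map_lie' := fun {x y} => by
          simp only [LieHom.map_lie, LieRing.of_associative_ring_bracket, ← MulOpposite.op_mul,
            ← MulOpposite.op_sub, neg_mul_neg, neg_sub] } : U →ₐ[k] Uᵐᵒᵖ).toLinearMap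

/-- The inclusion `g ⊗ g → U(g) ⊗ U(g)`. -/
def envTensorι : g ⊗[k] g →ₗ[k] U ⊗[k] U :=
  TensorProduct.map ((UniversalEnvelopingAlgebra.ι k : g →ₗ⁅k⁆ U) : g →ₗ[k] U)
    ((UniversalEnvelopingAlgebra.ι k : g →ₗ⁅k⁆ U) : g →ₗ[k] U)

theorem envTensorι_lie (x : g) (t : g ⊗[k] g) : envTensorι k g ⁅x, t⁆ =
    envComul k g (UniversalEnvelopingAlgebra.ι k x) * envTensorι k g t -
      envTensorι k g t * envComul k g (UniversalEnvelopingAlgebra.ι k x) := by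
  rw [envComul_ι]
  induction t with
  | zero => simp
  | tmul a b =>
    simp only [envTensorι, TensorProduct.LieModule.lie_tmul_right, map_add,
      TensorProduct.map_tmul, LieHom.coe_toLinearMap, LieHom.map_lie,
      LieRing.of_associative_ring_bracket, add_mul, mul_add,
      Algebra.TensorProduct.tmul_mul_tmul, one_mul, mul_one, TensorProduct.sub_tmul,
      TensorProduct.tmul_sub]
    abel
  | add s t hs ht =>
    simp only [lie_add, map_add, mul_add, add_mul, hs, ht]
    abel

variable [LieBialgebra k g]

/-- The algebra morphism `Δ + ε δ : U(g) → (U(g) ⊗ U(g))[ε]`, `ε² = 0`, whose `ε`-part is the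
unique extension of the cobracket of `g` with `δ(u v) = δ(u) Δ(v) + Δ(u) δ(v)`. -/
def envDual : U →ₐ[k] DualNumber (U ⊗[k] U) :=
  UniversalEnvelopingAlgebra.lift k
    { toFun := fun x => (TrivSqZeroExt.inl (envComul k g (UniversalEnvelopingAlgebra.ι k x)) +
        TrivSqZeroExt.inr (envTensorι k g (LieBialgebra.cobracket x)) : DualNumber (U ⊗[k] U))
      map_add' := fun x y => by
        simp only [map_add, TrivSqZeroExt.inl_add, TrivSqZeroExt.inr_add]; abel
      map_smul' := fun c x => by
        simp only [map_smul, RingHom.id_apply, TrivSqZeroExt.inl_smul, TrivSqZeroExt.inr_smul,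
          smul_add]
      map_lie' := fun {x y} => by
        ext
        · simp [LieRing.of_associative_ring_bracket]
        · simp only [LieRing.of_associative_ring_bracket, LieHom.map_lie, map_sub, map_mul,
            TrivSqZeroExt.snd_add, TrivSqZeroExt.snd_inl, TrivSqZeroExt.snd_inr, zero_add,
            TrivSqZeroExt.snd_sub, DualNumber.snd_mul, TrivSqZeroExt.fst_add,
            TrivSqZeroExt.fst_inl, TrivSqZeroExt.fst_inr, add_zero, LieBialgebra.cocycle,
            envTensorι_lie]
          abel }

/-- The Poisson cobracket of `U(g)`, extending the cobracket of `g`. -/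
def envCobracket : U →ₗ[k] U ⊗[k] U where
  toFun u := (envDual k g u).snd
  map_add' u v := by simp only [map_add, TrivSqZeroExt.snd_add]
  map_smul' c u := by simp only [map_smul, TrivSqZeroExt.snd_smul, RingHom.id_apply]

theorem envCobracket_ι (x : g) : envCobracket k g (UniversalEnvelopingAlgebra.ι k x) =
    envTensorι k g (LieBialgebra.cobracket x) := by
  change (envDual k g (UniversalEnvelopingAlgebra.ι k x)).snd = _
  rw [envDual, UniversalEnvelopingAlgebra.lift_ι_apply]
  simp

theorem envDual_fst (u : U) : (envDual k g u).fst = envComul k g u := by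
  have : (TrivSqZeroExt.fstHom k (U ⊗[k] U) (U ⊗[k] U)).comp (envDual k g) = envComul k g := by
    ext x
    simp [envDual]
  exact DFunLike.congr_fun this u

theorem envCobracket_mul (u v : U) : envCobracket k g (u * v) =
    envCobracket k g u * envComul k g v + envComul k g u * envCobracket k g v := by
  change (envDual k g (u * v)).snd = _
  rw [map_mul, DualNumber.snd_mul, envDual_fst, envDual_fst, add_comm]
  rfl

end EnvelopingAlgebras

section FormalGroups

variable (k g : Type*) [Field k] [LieRing g] [LieAlgebra k g]

/-- `F[[g]]`, the linear dual of `U(g)`. -/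
abbrev FormalSeries : Type _ := Module.Dual k (UniversalEnvelopingAlgebra k g)

variable {k g}

/-- The pairing of `F[[g]] ⊗ F[[g]]` with `U(g) ⊗ U(g)`. It identifies the completed tensor square
of `F[[g]]` with the linear dual of `U(g) ⊗ U(g)`. -/
def FormalSeries.pair : FormalSeries k g ⊗[k] FormalSeries k g →ₗ[k]
    Module.Dual k (UniversalEnvelopingAlgebra k g ⊗[k] UniversalEnvelopingAlgebra k g) :=
  TensorProduct.dualDistrib k _ _

/-- The product of `F[[g]]`, transpose of the coproduct of `U(g)`. -/
def FormalSeries.mul (a b : FormalSeries k g) : FormalSeries k g :=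
  FormalSeries.pair (a ⊗ₜ b) ∘ₗ (envComul k g).toLinearMap

/-- The unit of `F[[g]]`, which is the counit of `U(g)`. -/
def FormalSeries.one : FormalSeries k g := (envCounit k g).toLinearMap

/-- The counit of `F[[g]]`: evaluation at `1 ∈ U(g)`. -/
def FormalSeries.counit (a : FormalSeries k g) : k := a 1

/-- The coproduct of `F[[g]]`, transpose of the product of `U(g)`; its values are in the completed
tensor square of `F[[g]]`, i.e. in the linear dual of `U(g) ⊗ U(g)`. -/
def FormalSeries.comul (a : FormalSeries k g) :
    Module.Dual k (UniversalEnvelopingAlgebra k g ⊗[k] UniversalEnvelopingAlgebra k g) :=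
  a ∘ₗ LinearMap.mul' k (UniversalEnvelopingAlgebra k g)

/-- The antipode of `F[[g]]`, transpose of the antipode of `U(g)`. -/
def FormalSeries.antipode (a : FormalSeries k g) : FormalSeries k g := a ∘ₗ envAntipode k g

/-- The Poisson bracket of `F[[g]]`, transpose of the Poisson cobracket of `U(g)`. -/
def FormalSeries.poisson [LieBialgebra k g] (a b : FormalSeries k g) : FormalSeries k g :=
  FormalSeries.pair (a ⊗ₜ b) ∘ₗ envCobracket k g

variable (k g) in
/-- The weak topology of `F[[g]]`: pointwise convergence on `U(g)`, with `k` discrete. -/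
abbrev FormalSeries.weakTopology : TopologicalSpace (FormalSeries k g) :=
  TopologicalSpace.induced (fun a u => a u)
    (@Pi.topologicalSpace (UniversalEnvelopingAlgebra k g) (fun _ => k) (fun _ => ⊥))

end FormalGroups

/-! ## Topological Hopf algebras over a linearly topologised ring -/

section TopologicalHopfAlgebras

/-- The open submodules of a topological module. -/
abbrev OpenSub (R M : Type*) [CommRing R] [AddCommGroup M] [Module R M] [TopologicalSpace M] :
    Type _ :=
  {U : Submodule R M // IsOpen (U : Set M)}

/-- The completed tensor square of a linearly topologised module `M`: the projective limit of
`M/U ⊗ M/U` over the open submodules `U` of `M`. For the `h`-adic topology it is the `h`-adic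
completion of `M ⊗ M`; for `M = k[[h]]^E` with the product topology it is `k[[h]]^(E × E)`. -/
def CTensor (R M : Type*) [CommRing R] [AddCommGroup M] [Module R M] [TopologicalSpace M] :
    Submodule R ((U : OpenSub R M) → (M ⧸ U.1) ⊗[R] (M ⧸ U.1)) where
  carrier := {z | ∀ (U V : OpenSub R M) (hUV : U.1 ≤ V.1),
    TensorProduct.map (Submodule.factor hUV) (Submodule.factor hUV) (z U) = z V}
  add_mem' hz hw U V hUV := by
    simp only [Pi.add_apply, map_add, hz U V hUV, hw U V hUV]
  zero_mem' U V hUV := by simp only [Pi.zero_apply, map_zero]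
  smul_mem' c z hz U V hUV := by simp only [Pi.smul_apply, map_smul, hz U V hUV]

/-- The completed `n`-th tensor power of `M`: the projective limit of `(M/U)^{⊗ n}`. -/
def CPow (R M : Type*) [CommRing R] [AddCommGroup M] [Module R M] [TopologicalSpace M] (n : ℕ) :
    Submodule R ((U : OpenSub R M) → ⨂[R]^n (M ⧸ U.1)) where
  carrier := {z | ∀ (U V : OpenSub R M) (hUV : U.1 ≤ V.1),
    PiTensorProduct.map (fun _ => Submodule.factor hUV) (z U) = z V}
  add_mem' hz hw U V hUV := by
    simp only [Pi.add_apply, map_add, hz U V hUV, hw U V hUV]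
  zero_mem' U V hUV := by simp only [Pi.zero_apply, map_zero]
  smul_mem' c z hz U V hUV := by simp only [Pi.smul_apply, map_smul, hz U V hUV]

section Maps

variable {R M : Type*} [CommRing R] [AddCommGroup M] [Module R M] [TopologicalSpace M]

/-- The component at `U` of an element of the completed tensor square. -/
def CTensor.proj (U : OpenSub R M) : CTensor R M →ₗ[R] (M ⧸ U.1) ⊗[R] (M ⧸ U.1) :=
  LinearMap.proj U ∘ₗ (CTensor R M).subtype

/-- The reduction `M ⊗ M → M/U ⊗ M/U`. -/
def tensorMk (U : OpenSub R M) : M ⊗[R] M →ₗ[R] (M ⧸ U.1) ⊗[R] (M ⧸ U.1) :=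
  TensorProduct.map U.1.mkQ U.1.mkQ

/-- The filter of algebraic tensors `t ∈ M ⊗ M` tending to an element `z` of the completed tensor
square. If `f` is a continuous linear map on `M ⊗ M`, then its continuous extension takes at `z`
the limit of `f` along this filter. -/
def CTensor.approx (z : CTensor R M) : Filter (M ⊗[R] M) :=
  ⨅ U : OpenSub R M, 𝓟 {t | tensorMk U t = CTensor.proj U z}

/-- The extension by continuity of `f ⊗ g : M ⊗ M → A ⊗ B` to the completed tensor square, for
linear maps `f : M → A`, `g : M → B` which are continuous for the discrete topologies of `A`
and `B`. -/
def CTensor.extend {A B : Type*} [AddCommGroup A] [Module R A] [AddCommGroup B] [Module R B]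
    (f : M →ₗ[R] A) (hf : IsOpen (LinearMap.ker f : Set M))
    (g : M →ₗ[R] B) (hg : IsOpen (LinearMap.ker g : Set M)) : CTensor R M →ₗ[R] A ⊗[R] B :=
  TensorProduct.map
      (Submodule.liftQ (LinearMap.ker f ⊓ LinearMap.ker g) f inf_le_left)
      (Submodule.liftQ (LinearMap.ker f ⊓ LinearMap.ker g) g inf_le_right) ∘ₗ
    CTensor.proj ⟨LinearMap.ker f ⊓ LinearMap.ker g, hf.inter hg⟩

theorem isOpen_ker_mkQ (U : OpenSub R M) : IsOpen (LinearMap.ker U.1.mkQ : Set M) := by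
  rw [Submodule.ker_mkQ]
  exact U.2

/-- The map `A ⊗ A^{⊗ n} → A^{⊗ (n + 1)}`, `a ⊗ (b₁ ⊗ ⋯ ⊗ bₙ) ↦ a ⊗ b₁ ⊗ ⋯ ⊗ bₙ`. -/
def consTensor (R A : Type*) [CommRing R] [AddCommGroup A] [Module R A] (n : ℕ) :
    A ⊗[R] (⨂[R]^n A) →ₗ[R] ⨂[R]^(n + 1) A :=
  TensorProduct.lift ((PiTensorProduct.lift (R := R) (s := fun _ : Fin n => A)
    (E := ⨂[R]^(n + 1) A)).toLinearMap ∘ₗ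
      (PiTensorProduct.tprod R (s := fun _ : Fin (n + 1) => A)).curryLeft)

theorem consTensor_tmul (R A : Type*) [CommRing R] [AddCommGroup A] [Module R A] (n : ℕ) (a : A)
    (b : Fin n → A) : consTensor R A n (a ⊗ₜ PiTensorProduct.tprod R b) =
      PiTensorProduct.tprod R (Fin.cons a b : Fin (n + 1) → A) := by
  simp [consTensor]

end Maps

/-- A topological Hopf algebra: the coproduct takes values in the completed tensor square, all
structure maps are continuous, and the axioms hold after extension by continuity. -/
structure TopHopf (R H : Type*) [CommRing R] [TopologicalSpace R] [Ring H] [Algebra R H]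
    [TopologicalSpace H] where
  comul : H →ₗ[R] CTensor R H
  counit : H →ₐ[R] R
  antipode : H →ₗ[R] H
  /-- The product is continuous on the completed tensor square. -/
  continuous_mul : ∀ U : OpenSub R H, ∃ V : OpenSub R H, ∀ v ∈ V.1, ∀ x : H,
    v * x ∈ U.1 ∧ x * v ∈ U.1
  isOpen_ker_comul : ∀ U : OpenSub R H,
    IsOpen (LinearMap.ker (CTensor.proj U ∘ₗ comul) : Set H)
  continuous_counit : Continuous counit
  continuous_antipode : Continuous antipode
  comul_one : ∀ U : OpenSub R H, CTensor.proj U (comul 1) = tensorMk U 1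
  /-- `Δ(x y) = Δ(x) Δ(y)`. -/
  comul_mul : ∀ (x y : H) (U : OpenSub R H),
    ∀ᶠ q in CTensor.approx (comul x) ×ˢ CTensor.approx (comul y),
      tensorMk U (q.1 * q.2) = CTensor.proj U (comul (x * y))
  /-- `(Δ ⊗ id) Δ = (id ⊗ Δ) Δ`. -/
  coassoc : ∀ (x : H) (U : OpenSub R H),
    TensorProduct.assoc R (H ⧸ U.1) (H ⧸ U.1) (H ⧸ U.1)
      (CTensor.extend (CTensor.proj U ∘ₗ comul) (isOpen_ker_comul U) U.1.mkQ (isOpen_ker_mkQ U)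
        (comul x)) =
      CTensor.extend U.1.mkQ (isOpen_ker_mkQ U) (CTensor.proj U ∘ₗ comul) (isOpen_ker_comul U)
        (comul x)
  /-- `(ε ⊗ id) Δ = id`. -/
  counit_comul : ∀ x : H, Tendsto (fun t : H ⊗[R] H =>
    TensorProduct.lid R H (TensorProduct.map counit.toLinearMap LinearMap.id t))
    (CTensor.approx (comul x)) (𝓝 x)
  /-- `(id ⊗ ε) Δ = id`. -/
  comul_counit : ∀ x : H, Tendsto (fun t : H ⊗[R] H =>
    TensorProduct.rid R H (TensorProduct.map LinearMap.id counit.toLinearMap t))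
    (CTensor.approx (comul x)) (𝓝 x)
  /-- `m (S ⊗ id) Δ = ε 1`. -/
  antipode_comul : ∀ x : H, Tendsto (fun t : H ⊗[R] H =>
    LinearMap.mul' R H (TensorProduct.map antipode LinearMap.id t))
    (CTensor.approx (comul x)) (𝓝 (algebraMap R H (counit x)))
  /-- `m (id ⊗ S) Δ = ε 1`. -/
  comul_antipode : ∀ x : H, Tendsto (fun t : H ⊗[R] H =>
    LinearMap.mul' R H (TensorProduct.map LinearMap.id antipode t))
    (CTensor.approx (comul x)) (𝓝 (algebraMap R H (counit x)))

namespace TopHopf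

variable {R H : Type*} [CommRing R] [TopologicalSpace R] [Ring H] [Algebra R H]
  [TopologicalSpace H]

/-- Morphisms of topological Hopf algebras. -/
structure IsHom {A : Type*} [Ring A] [Algebra R A] [TopologicalSpace A]
    (S : TopHopf R A) (T : TopHopf R H) (f : A →ₐ[R] H) : Prop where
  continuous : Continuous f
  comul : ∀ (a : A) (U : OpenSub R H), ∀ᶠ t in CTensor.approx (S.comul a),
    tensorMk U (TensorProduct.map f.toLinearMap f.toLinearMap t) = CTensor.proj U (T.comul (f a))
  counit : ∀ a, T.counit (f a) = S.counit a
  antipode : ∀ a, f (S.antipode a) = T.antipode (f a)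

variable [IsTopologicalAddGroup H] [ContinuousSMul R H]

/-- The composite `φ^{⊗ (n + 1)} ∘ Δ^{n + 1} : H → B^{⊗ (n + 1)}` for a linear map `φ : H → B`
which is continuous for the discrete topology of `B`, where `Δ^1 = id` and
`Δ^{n + 2} = (id ⊗ Δ^{n + 1}) ∘ Δ`. -/
def powComul (T : TopHopf R H) {B : Type*} [AddCommGroup B] [Module R B] (φ : H →ₗ[R] B)
    (hφ : IsOpen (LinearMap.ker φ : Set H)) :
    (n : ℕ) → {f : H →ₗ[R] ⨂[R]^(n + 1) B // IsOpen (LinearMap.ker f : Set H)}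
  | 0 => ⟨(PiTensorProduct.subsingletonEquiv (R := R) (s := fun _ : Fin 1 => B)
      0).symm.toLinearMap ∘ₗ φ, by rwa [LinearEquiv.ker_comp]⟩
  | n + 1 => ⟨consTensor R B (n + 1) ∘ₗ
      CTensor.extend φ hφ (T.powComul φ hφ n).1 (T.powComul φ hφ n).2 ∘ₗ T.comul,
      Submodule.isOpen_mono
        (fun x hx => by
          have hx' := LinearMap.mem_ker.1 hx
          rw [LinearMap.mem_ker]
          simp only [CTensor.extend, LinearMap.comp_apply] at hx' ⊢
          rw [hx', map_zero, map_zero])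
        (T.isOpen_ker_comul ⟨LinearMap.ker φ ⊓ LinearMap.ker (T.powComul φ hφ n).1,
          hφ.inter (T.powComul φ hφ n).2⟩)⟩

/-- The projection `id - ε` of `H` onto the augmentation ideal. -/
def augProj (T : TopHopf R H) : H →ₗ[R] H :=
  LinearMap.id - Algebra.linearMap R H ∘ₗ T.counit.toLinearMap

theorem isOpen_ker_augProj (T : TopHopf R H) (U : OpenSub R H) :
    IsOpen (LinearMap.ker (U.1.mkQ ∘ₗ T.augProj) : Set H) := by
  have hc : Continuous T.augProj := by
    have : Continuous fun x : H => x - T.counit x • (1 : H) :=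
      continuous_id.sub (T.continuous_counit.smul continuous_const)
    convert this using 2 with x
    simp [augProj, Algebra.algebraMap_eq_smul_one]
  rw [LinearMap.ker_comp, Submodule.ker_mkQ]
  exact U.2.preimage hc

/-- The map `δ_{n + 1} = (id - ε)^{⊗ (n + 1)} ∘ Δ^{n + 1}` from `H` to its completed `(n + 1)`-st
tensor power, given by its components in `(H/U)^{⊗ (n + 1)}`. -/
def delta (T : TopHopf R H) (n : ℕ) : H →ₗ[R] ((U : OpenSub R H) → ⨂[R]^(n + 1) (H ⧸ U.1)) :=
  LinearMap.pi fun U =>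
    (T.powComul (U.1.mkQ ∘ₗ T.augProj) (T.isOpen_ker_augProj U) n).1

/-- Drinfeld's `H' = {a | δ_n(a) ∈ h^n H^{⊗ n} for all n}`. The condition for `n = 0`, namely
`ε(a) ∈ R`, is void. -/
def prime (T : TopHopf R H) (h : R) : Submodule R H :=
  ⨅ n : ℕ, ((CPow R H (n + 1)).map (LinearMap.lsmul R _ (h ^ (n + 1)))).comap (T.delta n)

end TopHopf

end TopologicalHopfAlgebras

/-! ## Quantised universal enveloping algebras and quantised formal series Hopf algebras -/

section Quantisation

/-- The ring `k[[h]]`, with `h = PowerSeries.X`, carries the `h`-adic topology. -/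
instance hAdicTopology (k : Type*) [Field k] : TopologicalSpace k⟦X⟧ :=
  (Ideal.span {(PowerSeries.X : k⟦X⟧)}).adicTopology

/-- Topologically free `k[[h]]`-modules: torsionless, separated, complete, with the `h`-adic
topology. These are the modules isomorphic to some `V[[h]]`. -/
structure IsTopFree (k M : Type*) [Field k] [AddCommGroup M] [Module k⟦X⟧ M]
    [t : TopologicalSpace M] : Prop where
  topology_eq : t = (Ideal.span {(PowerSeries.X : k⟦X⟧)}).adicModuleTopology M
  torsionless : ∀ x : M, (PowerSeries.X : k⟦X⟧) • x = 0 → x = 0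
  complete : IsAdicComplete (Ideal.span {(PowerSeries.X : k⟦X⟧)}) M

/-- Topological `k[[h]]`-modules isomorphic to some `k[[h]]^E` with the product topology. -/
def IsTopProduct (k : Type*) (N : Type u) [Field k] [AddCommGroup N]
    [Module k⟦X⟧ N] [TopologicalSpace N] : Prop :=
  ∃ E : Type u, Nonempty (N ≃L[k⟦X⟧] (E → k⟦X⟧))

/-- `H` is a quantised universal enveloping algebra, i.e. a Hopf algebra among the topologically
free `k[[h]]`-modules, and `p` exhibits `H/hH` as the co-Poisson Hopf algebra `U(g)`. The Poisson
cobracket of `H/hH` is induced by `h⁻¹ (Δ - Δᵒᵖ)`. -/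
structure IsQUEA {k g H : Type*} [Field k] [LieRing g] [LieAlgebra k g] [LieBialgebra k g]
    [Ring H] [Algebra k⟦X⟧ H] [TopologicalSpace H] (T : TopHopf k⟦X⟧ H)
    (p : H →ₛₗ[PowerSeries.constantCoeff (R := k)] UniversalEnvelopingAlgebra k g) : Prop where
  topFree : IsTopFree k H
  surjective : Function.Surjective p
  ker : ∀ x : H, p x = 0 ↔ ∃ y : H, x = (PowerSeries.X : k⟦X⟧) • y
  map_one : p 1 = 1
  map_mul : ∀ x y : H, p (x * y) = p x * p y
  comul : ∀ x : H, ∀ᶠ t in CTensor.approx (T.comul x),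
    TensorProduct.map p p t = envComul k g (p x)
  counit : ∀ x : H, PowerSeries.constantCoeff (T.counit x) = envCounit k g (p x)
  antipode : ∀ x : H, p (T.antipode x) = envAntipode k g (p x)
  cobracket : ∀ x : H, ∃ w : CTensor k⟦X⟧ H,
    (∀ U, (PowerSeries.X : k⟦X⟧) • CTensor.proj U w =
      CTensor.proj U (T.comul x) - TensorProduct.comm _ _ _ (CTensor.proj U (T.comul x))) ∧
    ∀ᶠ t in CTensor.approx w, TensorProduct.map p p t = envCobracket k g (p x)

/-- `K` is a quantised formal series Hopf algebra, i.e. a Hopf algebra among the `k[[h]]^E`, and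
`φ` exhibits `K/hK` as the topological Poisson Hopf algebra `F[[g]]`. The Poisson bracket of
`K/hK` is induced by `h⁻¹ (x y - y x)`. -/
structure IsQFSHA {k g K : Type*} [Field k] [LieRing g] [LieAlgebra k g] [LieBialgebra k g]
    [Ring K] [Algebra k⟦X⟧ K] [TopologicalSpace K] (T : TopHopf k⟦X⟧ K)
    (φ : K →ₛₗ[PowerSeries.constantCoeff (R := k)] FormalSeries k g) : Prop where
  topProduct : IsTopProduct k K
  ker : ∀ x : K, φ x = 0 ↔ ∃ y : K, x = (PowerSeries.X : k⟦X⟧) • y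
  /-- `φ` is surjective and `F[[g]]` has the quotient topology. -/
  isOpenQuotientMap : @IsOpenQuotientMap K (FormalSeries k g) _ (FormalSeries.weakTopology k g) φ
  map_one : φ 1 = FormalSeries.one
  map_mul : ∀ x y : K, φ (x * y) = FormalSeries.mul (φ x) (φ y)
  /-- `(φ ⊗ φ) Δ(x) = Δ(φ x)` in the completed tensor square `(U(g) ⊗ U(g))*` of `F[[g]]`. -/
  comul : ∀ (x : K) (u : UniversalEnvelopingAlgebra k g ⊗[k] UniversalEnvelopingAlgebra k g),
    ∀ᶠ t in CTensor.approx (T.comul x),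
      FormalSeries.pair (TensorProduct.map φ φ t) u = FormalSeries.comul (φ x) u
  counit : ∀ x : K, PowerSeries.constantCoeff (T.counit x) = FormalSeries.counit (φ x)
  antipode : ∀ x : K, φ (T.antipode x) = FormalSeries.antipode (φ x)
  poisson : ∀ x y : K, ∃ z : K, (PowerSeries.X : k⟦X⟧) • z = x * y - y * x ∧
    φ z = FormalSeries.poisson (φ x) (φ y)

end Quantisation

end

noncomputable section

/-! ## The Poincaré–Birkhoff–Witt action on the symmetric algebra -/

namespace PBW

variable {k L : Type*} [Field k] [LieRing L] [LieAlgebra k L] {d : ℕ}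
  (b : Module.Basis (Fin d) k L)

/-! The idea is to describe `H = U_h(g)` by coordinate functions and to recognise `H'` by
divisibility of the coordinates. Let `b` be a basis of `g`. By Poincaré–Birkhoff–Witt there are
functionals `τ i` on `U(g)` with `τ i 1 = 0` that restrict on `g` to the coordinates of `b`. Lift
them to functionals `t i` on `H` with `t i 1 = 0`. For a word `w` let `t_w` be the convolution
product of its letters and `D_w = (id ⊗ t_w) Δ`. In characteristic zero the ordered products of the
`τ i` are triangular against the ordered monomials of `U(g)`, with diagonal entries products of
factorials. Lifting from `h = 0` by completeness, the ordered `t^e` identify `H` with the families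
in `k[[h]]` tending to `0` (`IsQUEA.exists_coords`). For the dual topological basis `y_e` one has `Δ
x = ∑ D^e x ⊗ y_e`.

Then `H'` is the set `divided` of those `a` with `h^|e|` dividing `t^e(a)` for all `e` (`prime_eq`).
The crux is `dvd_wordCoord`: divisibility for ordered words gives it for all words. Indeed `t i` and
`t j` commute up to `h c` with `c 1 = 0`, so an exchange of two letters puts in their place `h`
times a series of nonempty words. Hence `D_w` maps `divided` into `h^|w|` times itself. This gives
stability under product and antipode, and a coproduct `∑ h^{-|e|} D^e a ⊗ h^|e| y_e`. The divided
coordinates `h^{-|e|} t^e` identify the algebra with a product of copies of `k[[h]]`. On it `id - ε`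
is divisible by `h`, so `δ_n` is divisible by `h^n`; conversely `t_w` is obtained by evaluating
`t_{w₁} ⊗ ⋯ ⊗ t_{wₙ}` on `δ_n`.

Modulo `h` the operators `h⁻¹ D_i` are derivations satisfying the bracket relations of `g*`
(`lieRel`); this is where `h⁻¹(Δ - Δᵒᵖ)` enters. Thus `U(g*)` acts on functionals, and `phi` sends
`a` to the functional on `U(g*)` that lets `u` act on the counit and evaluates at `a`. Compatibility
of `phi` with product and bracket follows by recursion on the last letter of a word; the second
order term of `h⁻¹ D_i (x y)` yields the Poisson bracket.

For the series description take `x_i = y_e` with `e` the `i`-th unit vector. If `h^n a'` lies in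
`H'`, the reduction of `a'` has filtration degree at most `n`, so it is a combination of ordered
monomials with `|e| ≤ n`. Their multiples `h^n x^e` lie in `H'`, and subtracting them and iterating
gives the expansion (`exists_hasSum_mono`). -/

/-- The value at the monomial `M` of the action of the basis element `b i` on the space spanned by
the monomials. -/
def actMonomial (M : Multiset (Fin d)) (i : Fin d) : Multiset (Fin d) →₀ k :=
  match hM : M.sort with
  | [] => Finsupp.single {i} 1
  | j :: l =>
    if i ≤ j then Finsupp.single (i ::ₘ M) 1
    -- Forced by `b i (b j l) = b j (b i l) + [b i, b j] l`, where `b j l = M` because `j` is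
    -- minimal; the leading monomial `i ::ₘ l` of `b i l` contributes `i ::ₘ M`. The degree test
    -- only ensures termination: by `actMonomial_sub_mem` it holds on the whole support.
    else Finsupp.single (i ::ₘ M) 1 +
      ((actMonomial (↑l) i - Finsupp.single (i ::ₘ ↑l) 1).sum fun M' r =>
        if M'.card < M.card then r • actMonomial M' j else 0) +
      ∑ c, b.repr ⁅b i, b j⁆ c • actMonomial (↑l) c
termination_by M.card
decreasing_by
  all_goals first
    | assumption
    | (have h := congrArg List.length hM
       simp only [Multiset.length_sort, List.length_cons] at h
       simp only [Multiset.coe_card]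
       omega)

theorem actMonomial_of_le (M : Multiset (Fin d)) (i : Fin d) (h : ∀ j ∈ M, i ≤ j) :
    actMonomial b M i = Finsupp.single (i ::ₘ M) 1 := by
  rw [actMonomial]
  split
  · rename_i hM
    have : M = 0 := by rw [← Multiset.sort_eq M (· ≤ ·), hM]; rfl
    rw [this]; rfl
  · rename_i j l hM
    have hj : j ∈ M := by rw [← Multiset.mem_sort (· ≤ ·), hM]; simp
    rw [if_pos (h j hj)]

theorem actMonomial_of_lt (T : Multiset (Fin d)) (i j : Fin d) (h : ∀ a ∈ T, j ≤ a) (hij : j < i) :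
    actMonomial b (j ::ₘ T) i = Finsupp.single (i ::ₘ j ::ₘ T) 1 +
      ((actMonomial b T i - Finsupp.single (i ::ₘ T) 1).sum fun M' r =>
        if M'.card < T.card + 1 then r • actMonomial b M' j else 0) +
      ∑ c, b.repr ⁅b i, b j⁆ c • actMonomial b T c := by
  have hs : (j ::ₘ T).sort = j :: T.sort := Multiset.sort_cons _ _ _ h
  rw [actMonomial]
  split
  · rename_i hM
    rw [hs] at hM
    exact absurd hM (List.cons_ne_nil _ _)
  · rename_i j' l hM
    rw [hs] at hM
    obtain ⟨rfl, rfl⟩ := List.cons.inj hM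
    rw [if_neg (not_le.2 hij), Multiset.sort_eq, Multiset.card_cons]

variable (k d) in
/-- The span of the monomials of degree less than `n`. -/
def degLT (n : ℕ) : Submodule k (Multiset (Fin d) →₀ k) :=
  Finsupp.supported k k {M | M.card < n}

theorem degLT_mono {m n : ℕ} (h : m ≤ n) : degLT k d m ≤ degLT k d n :=
  Finsupp.supported_mono fun _ hM => lt_of_lt_of_le hM h

theorem single_mem_degLT {n : ℕ} {M : Multiset (Fin d)} (h : M.card < n) :
    Finsupp.single M (1 : k) ∈ degLT k d n :=
  Finsupp.single_mem_supported k _ h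

theorem exists_min (M : Multiset (Fin d)) :
    M = 0 ∨ ∃ j T, M = j ::ₘ T ∧ ∀ a ∈ T, j ≤ a := by
  rcases hM : M.sort with _ | ⟨j, l⟩
  · left; rw [← Multiset.sort_eq M (· ≤ ·), hM]; rfl
  · right
    refine ⟨j, ↑l, by rw [← Multiset.sort_eq M (· ≤ ·), hM]; rfl, ?_⟩
    have := Multiset.pairwise_sort M (· ≤ ·)
    rw [hM, List.pairwise_cons] at this
    simpa using this.1

/-- To leading order the action is multiplication of monomials; this is what makes the degree test
in `actMonomial` harmless. The number `n` only bounds the degree for the induction. -/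
theorem actMonomial_sub_mem (n : ℕ) : ∀ (M : Multiset (Fin d)) (i : Fin d), M.card < n →
    actMonomial b M i - Finsupp.single (i ::ₘ M) 1 ∈ degLT k d (M.card + 1) := by
  induction n with
  | zero => intro M i h; exact absurd h (Nat.not_lt_zero _)
  | succ n ih =>
    intro M i h
    have key : ∀ (M' : Multiset (Fin d)) (i : Fin d), M'.card < M.card →
        actMonomial b M' i ∈ degLT k d (M.card + 1) := by
      intro M' i h'
      have h1 := ih M' i (by omega)
      have h2 : Finsupp.single (i ::ₘ M') (1 : k) ∈ degLT k d (M.card + 1) :=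
        single_mem_degLT (by rw [Multiset.card_cons]; omega)
      have := add_mem (degLT_mono (by omega) h1) h2
      rwa [sub_add_cancel] at this
    by_cases hi : ∀ j ∈ M, i ≤ j
    · rw [actMonomial_of_le b M i hi, sub_self]; exact zero_mem _
    · rcases exists_min M with rfl | ⟨j, T, rfl, hj⟩
      · simp at hi
      · have hij : j < i := by
          by_contra hc
          exact hi fun a ha => by
            rcases Multiset.mem_cons.1 ha with rfl | ha
            · exact not_lt.1 hc
            · exact (not_lt.1 hc).trans (hj a ha)
        rw [actMonomial_of_lt b T i j hj hij, add_assoc, add_sub_cancel_left]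
        rw [Multiset.card_cons] at key h ⊢
        refine add_mem (Submodule.sum_mem _ fun M' _ => ?_) (Submodule.sum_mem _ fun c _ =>
          Submodule.smul_mem _ _ (key T c (by omega)))
        dsimp only
        split
        · rename_i h'
          exact Submodule.smul_mem _ _ (key M' j h')
        · exact zero_mem _

/-- The action of the basis element `b i`. -/
def act (i : Fin d) : Module.End k (Multiset (Fin d) →₀ k) :=
  Finsupp.linearCombination k fun M => actMonomial b M i

theorem act_single (i : Fin d) (M : Multiset (Fin d)) :
    act b i (Finsupp.single M 1) = actMonomial b M i := by
  simp [act]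

/-- The action of the Lie algebra. -/
def action : L →ₗ[k] Module.End k (Multiset (Fin d) →₀ k) := b.constr k (act b)

theorem action_basis (i : Fin d) : action b (b i) = act b i := by simp [action]

theorem action_apply (x : L) : action b x = ∑ c, b.repr x c • act b c := by
  rw [action, Module.Basis.constr_apply_fintype]; simp

theorem act_sub_mem (i : Fin d) (M : Multiset (Fin d)) :
    act b i (Finsupp.single M 1) - Finsupp.single (i ::ₘ M) 1 ∈ degLT k d (M.card + 1) := by
  rw [act_single]
  exact actMonomial_sub_mem b (M.card + 1) M i (Nat.lt_succ_self _)

theorem act_of_le (M : Multiset (Fin d)) (i : Fin d) (h : ∀ j ∈ M, i ≤ j) :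
    act b i (Finsupp.single M 1) = Finsupp.single (i ::ₘ M) 1 := by
  rw [act_single, actMonomial_of_le b M i h]

/-- Once the degree test is known to succeed, the recursive clause of `actMonomial` is exactly the
bracket relation. -/
theorem act_act_of_lt (T : Multiset (Fin d)) (i j : Fin d) (h : ∀ a ∈ T, j ≤ a) (hij : j < i) :
    act b i (act b j (Finsupp.single T 1)) = act b j (act b i (Finsupp.single T 1)) +
      action b ⁅b i, b j⁆ (Finsupp.single T 1) := by
  rw [act_of_le b T j h, act_single, actMonomial_of_lt b T i j h hij]
  have h1 : act b j (act b i (Finsupp.single T 1)) = act b j (Finsupp.single (i ::ₘ T) 1) +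
      act b j (act b i (Finsupp.single T 1) - Finsupp.single (i ::ₘ T) 1) := by
    rw [← map_add, add_sub_cancel]
  have h2 : ∀ a ∈ i ::ₘ T, j ≤ a := fun a ha => by
    rcases Multiset.mem_cons.1 ha with rfl | ha
    · exact hij.le
    · exact h a ha
  rw [h1, act_of_le b _ j h2, Multiset.cons_swap, action_apply]
  congr 1
  · congr 1
    have hm := act_sub_mem b i T
    rw [act_single] at hm ⊢
    conv_rhs => rw [act, Finsupp.linearCombination_apply]
    refine Finsupp.sum_congr fun M' hM' => ?_
    rw [if_pos]
    exact (Finsupp.mem_supported _ _).1 hm hM'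
  · simp [act_single]

/-- The relation `[x, y] v = x (y v) - y (x v)`. -/
def Rel (x y : L) (v : Multiset (Fin d) →₀ k) : Prop :=
  action b ⁅x, y⁆ v = action b x (action b y v) - action b y (action b x v)

theorem rel_extend {V : Submodule k (Multiset (Fin d) →₀ k)} {S : Set (Multiset (Fin d) →₀ k)}
    (hV : V = Submodule.span k S) (h : ∀ i j, ∀ v ∈ S, Rel b (b i) (b j) v) :
    ∀ x y, ∀ v ∈ V, Rel b x y v := by
  intro x y v hv
  have h1 : ∀ i j, Rel b (b i) (b j) v := by
    intro i j
    rw [hV] at hv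
    induction hv using Submodule.span_induction with
    | mem v hv => exact h i j v hv
    | zero => simp [Rel]
    | add v w _ _ hv hw => simp only [Rel, map_add] at hv hw ⊢; rw [hv, hw]; abel
    | smul r v _ hv => simp only [Rel, map_smul] at hv ⊢; rw [hv, smul_sub]
  have h2 : ∀ i, Rel b (b i) y v := by
    intro i
    induction (b.mem_span y) using Submodule.span_induction with
    | mem y hy => obtain ⟨j, rfl⟩ := hy; exact h1 i j
    | zero => simp [Rel]
    | add y z _ _ hy hz =>
      simp only [Rel, map_add, lie_add, LinearMap.add_apply] at hy hz ⊢; rw [hy, hz]; abel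
    | smul r y _ hy =>
      simp only [Rel, map_smul, lie_smul, LinearMap.smul_apply] at hy ⊢; rw [hy, smul_sub]
  induction (b.mem_span x) using Submodule.span_induction with
  | mem y hy => obtain ⟨j, rfl⟩ := hy; exact h2 j
  | zero => simp [Rel]
  | add y z _ _ hy hz =>
    simp only [Rel, map_add, add_lie, LinearMap.add_apply] at hy hz ⊢; rw [hy, hz]; abel
  | smul r y _ hy =>
    simp only [Rel, map_smul, smul_lie, LinearMap.smul_apply] at hy ⊢; rw [hy, smul_sub]

theorem rel_symm {x y : L} {v : Multiset (Fin d) →₀ k} (h : Rel b x y v) : Rel b y x v := by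
  simp only [Rel] at h ⊢
  rw [← lie_skew, map_neg, LinearMap.neg_apply, h, neg_sub]

theorem degLT_eq_span (n : ℕ) :
    degLT k d n = Submodule.span k ((fun M => Finsupp.single M (1 : k)) '' {M | M.card < n}) :=
  Finsupp.supported_eq_span_single _ _

theorem rel_of_le (T : Multiset (Fin d)) (i j : Fin d) (h : ∀ a ∈ T, j ≤ a) (hij : j < i) :
    Rel b (b i) (b j) (Finsupp.single T 1) := by
  simp only [Rel, action_basis]
  rw [act_act_of_lt b T i j h hij, add_sub_cancel_left]

/-- The Poincaré–Birkhoff–Witt induction on the degree. If `j` is at most every letter of `M`, the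
relation holds by construction. Otherwise `M = l ::ₘ T` with `l` minimal and `l < j < i`, so that
`z_M = b l z_T`. Moving `b l` to the left uses relations with the smaller letter `l` and relations
in lower degree, and the resulting terms cancel by the Jacobi identity. -/
theorem rel_degLT (n : ℕ) : ∀ x y, ∀ v ∈ degLT k d n, Rel b x y v := by
  induction n with
  | zero =>
    intro x y v hv
    have : v = 0 := by simpa [degLT] using hv
    simp [Rel, this]
  | succ n ih =>
    refine rel_extend b (degLT_eq_span _) ?_
    have main : ∀ i j, j < i → ∀ M : Multiset (Fin d), M.card < n + 1 →
        Rel b (b i) (b j) (Finsupp.single M 1) := by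
      intro i j hij M hM
      by_cases hj : ∀ a ∈ M, j ≤ a
      · exact rel_of_le b M i j hj hij
      rcases exists_min M with rfl | ⟨l, T, rfl, hl⟩
      · simp at hj
      have hlj : l < j := by
        by_contra hc
        exact hj fun a ha => by
          rcases Multiset.mem_cons.1 ha with rfl | ha
          · exact not_lt.1 hc
          · exact (not_lt.1 hc).trans (hl a ha)
      have hT : T.card < n := by rw [Multiset.card_cons] at hM; omega
      have hzT : Finsupp.single T (1 : k) ∈ degLT k d n := single_mem_degLT hT
      -- the basis element `b l` may be moved past `b i` on `b j z_T`
      have swap : ∀ i j, l < i → l < j →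
          Rel b (b i) (b l) (action b (b j) (Finsupp.single T 1)) := by
        intro i j hi hj
        have h1 : Rel b (b i) (b l) (Finsupp.single (j ::ₘ T) 1) :=
          rel_of_le b _ i l (fun a ha => by
            rcases Multiset.mem_cons.1 ha with rfl | ha
            · exact hj.le
            · exact hl a ha) hi
        -- Replacing `b j z_T` by its leading monomial costs terms of degree at most that of `T`,
        -- which the induction hypothesis covers.
        have h2 : Rel b (b i) (b l) (act b j (Finsupp.single T 1) - Finsupp.single (j ::ₘ T) 1) :=
          ih _ _ _ (degLT_mono (by omega) (act_sub_mem b j T))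
        rw [action_basis]
        simp only [Rel, map_sub] at h1 h2 ⊢
        rw [h1] at h2
        linear_combination (norm := module) h2
      have e1 : ∀ i, l < i → action b (b i) (Finsupp.single (l ::ₘ T) 1) =
          action b (b l) (action b (b i) (Finsupp.single T 1)) +
            action b ⁅b i, b l⁆ (Finsupp.single T 1) := by
        intro i hi
        have h1 := rel_of_le b T i l hl hi
        simp only [Rel] at h1
        rw [h1, action_basis b l, act_of_le b T l hl]
        abel
      have hli : l < i := hlj.trans hij
      have s1 := swap i j hli hlj
      have s2 := swap j i hlj hli
      have c1 := ih (b i) ⁅b j, b l⁆ _ hzT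
      have c2 := ih (b j) ⁅b i, b l⁆ _ hzT
      have c3 := ih (b i) (b j) _ hzT
      have c4 := ih ⁅b i, b j⁆ (b l) _ hzT
      have e2 : action b ⁅b i, b j⁆ (Finsupp.single (l ::ₘ T) 1) =
          action b ⁅b i, b j⁆ (action b (b l) (Finsupp.single T 1)) := by
        rw [action_basis b l, act_of_le b T l hl]
      have jac : action b ⁅⁅b i, b j⁆, b l⁆ (Finsupp.single T 1) =
          action b ⁅b i, ⁅b j, b l⁆⁆ (Finsupp.single T 1) -
            action b ⁅b j, ⁅b i, b l⁆⁆ (Finsupp.single T 1) := by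
        rw [leibniz_lie (b i) (b j) (b l), map_add, LinearMap.add_apply, add_sub_cancel_right]
      simp only [Rel] at s1 s2 c1 c2 c3 c4 ⊢
      rw [e2, e1 j hlj, e1 i hli, map_add, map_add]
      have c3' : action b (b l) (action b ⁅b i, b j⁆ (Finsupp.single T 1)) =
          action b (b l) (action b (b i) (action b (b j) (Finsupp.single T 1))) -
            action b (b l) (action b (b j) (action b (b i) (Finsupp.single T 1))) := by
        rw [c3, map_sub]
      rw [c1, c2] at jac
      rw [jac] at c4
      rw [c3'] at c4
      linear_combination (norm := module) -c4 + s1 - s2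
    rintro i j _ ⟨M, hM, rfl⟩
    rcases lt_trichotomy i j with h | rfl | h
    · exact rel_symm b (main j i h M hM)
    · simp [Rel]
    · exact main i j h M hM

attribute [local instance] LieRing.ofAssociativeRing

/-- The action of `L` on the span of the monomials as a morphism of Lie algebras. -/
def actionHom : L →ₗ⁅k⁆ Module.End k (Multiset (Fin d) →₀ k) :=
  { action b with
    map_lie' := fun {x y} => by
      ext1 M
      ext1
      have := rel_degLT b (M.card + 1) x y (Finsupp.single M 1)
        (single_mem_degLT (Nat.lt_succ_self _))
      simp only [Rel] at this
      simp only [LieRing.of_associative_ring_bracket]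
      exact this }

/-- Linear functionals on the enveloping algebra extending the coordinates of `L` and vanishing
at `1`. -/
theorem exists_coordinates : ∃ τ : Fin d → Module.Dual k (UniversalEnvelopingAlgebra k L),
    (∀ i, τ i 1 = 0) ∧
    ∀ i j, τ i (UniversalEnvelopingAlgebra.ι k (b j)) = if j = i then 1 else 0 := by
  -- `τ i u` is the coefficient of the monomial `{i}` in `u` applied to the empty monomial.
  refine ⟨fun i => Finsupp.lapply ({i} : Multiset (Fin d)) ∘ₗ
    (LinearMap.applyₗ (Finsupp.single (0 : Multiset (Fin d)) (1 : k))) ∘ₗ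
      (UniversalEnvelopingAlgebra.lift k (actionHom b)).toLinearMap, fun i => ?_, fun i j => ?_⟩
  · simp
  · have : actionHom b (b j) (Finsupp.single 0 1) = Finsupp.single {j} 1 := by
      change action b (b j) _ = _
      rw [action_basis, act_of_le b 0 j (by simp)]
      rfl
    simp only [LinearMap.comp_apply, AlgHom.toLinearMap_apply,
      UniversalEnvelopingAlgebra.lift_ι_apply, LinearMap.applyₗ_apply_apply, this,
      Finsupp.lapply_apply, Finsupp.single_apply, Multiset.singleton_inj]

end PBW

end

noncomputable section

/-! ## Multi-indices -/

section MultiIndex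

variable {d : ℕ}

/-- The increasing word in which the letter `i` occurs `e i` times. -/
def sortedWord (e : Fin d → ℕ) : List (Fin d) :=
  (List.ofFn fun i => List.replicate (e i) i).flatten

theorem sortedWord_length (e : Fin d → ℕ) : (sortedWord e).length = ∑ i, e i := by
  simp [sortedWord, List.length_flatten, List.map_ofFn, Function.comp_def, List.sum_ofFn]

theorem sortedWord_count (e : Fin d → ℕ) (i : Fin d) : (sortedWord e).count i = e i := by
  rw [sortedWord, List.count_flatten, List.map_ofFn, List.sum_ofFn]
  rw [Finset.sum_eq_single i]
  · rw [Function.comp_apply, List.count_replicate_self]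
  · intro j _ hj
    rw [Function.comp_apply, List.count_replicate, if_neg (by simpa using hj)]
  · intro h
    exact absurd (Finset.mem_univ i) h

theorem sortedWord_prod {M : Type*} [Monoid M] (x : Fin d → M) (e : Fin d → ℕ) :
    ((sortedWord e).map x).prod = (List.ofFn fun i => x i ^ e i).prod := by
  rw [sortedWord, List.map_flatten, List.prod_flatten, List.map_ofFn, List.map_ofFn]
  congr 2
  funext i
  rw [Function.comp_apply, Function.comp_apply, List.map_replicate, List.prod_replicate]

theorem sortedWord_perm {e f : Fin d → ℕ} (h : (sortedWord e).Perm (sortedWord f)) : e = f := by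
  funext i
  rw [← sortedWord_count e, h.count_eq, sortedWord_count]

theorem perm_sortedWord (l : List (Fin d)) : l.Perm (sortedWord fun i => l.count i) :=
  List.perm_iff_count.2 fun i => by rw [sortedWord_count]

theorem sortedWord_single (i : Fin d) : sortedWord (Pi.single i 1 : Fin d → ℕ) = [i] := by
  refine List.perm_singleton.1 (List.perm_iff_count.2 fun j => ?_)
  rw [sortedWord_count, List.count_singleton, Pi.single_apply]
  by_cases h : j = i
  · rw [if_pos h, if_pos (by simp [h])]
  · rw [if_neg h, if_neg (by simpa using fun h' => h h'.symm)]

theorem sortedWord_zero : sortedWord (0 : Fin d → ℕ) = [] :=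
  List.eq_nil_of_length_eq_zero (by rw [sortedWord_length]; simp)

/-- The finite set of multi-indices of degree less than `n`. -/
def lowDegree (d n : ℕ) : Finset (Fin d → ℕ) :=
  (Finset.range n).biUnion fun m => Finset.piAntidiag Finset.univ m

theorem mem_lowDegree {n : ℕ} {e : Fin d → ℕ} : e ∈ lowDegree d n ↔ ∑ i, e i < n := by
  simp [lowDegree]

theorem lowDegree_succ (n : ℕ) :
    lowDegree d (n + 1) = lowDegree d n ∪ Finset.piAntidiag Finset.univ n := by
  ext e
  rw [Finset.mem_union, mem_lowDegree, mem_lowDegree, Nat.lt_succ_iff_lt_or_eq]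
  simp

theorem lowDegree_disjoint (n : ℕ) :
    Disjoint (lowDegree d n) (Finset.piAntidiag Finset.univ n) := by
  refine Finset.disjoint_left.2 fun e he he' => ?_
  have h : ∑ i, e i = n := by simpa using he'
  rw [mem_lowDegree] at he
  omega

end MultiIndex

/-! ## The enveloping algebra -/

namespace Env

variable {k g : Type*} [Field k] [LieRing g] [LieAlgebra k g]

local notation "U" => UniversalEnvelopingAlgebra k g

attribute [local instance] LieRing.ofAssociativeRing

/-- By the universal property the lift into the generated subalgebra, followed by the inclusion, is
the identity. -/
theorem adjoin_ι : Algebra.adjoin k (Set.range (UniversalEnvelopingAlgebra.ι k : g → U)) = ⊤ := by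
  set S := Algebra.adjoin k (Set.range (UniversalEnvelopingAlgebra.ι k : g → U)) with hS
  let f : g →ₗ⁅k⁆ S :=
    { toFun := fun x => ⟨UniversalEnvelopingAlgebra.ι k x, Algebra.subset_adjoin ⟨x, rfl⟩⟩
      map_add' := fun x y => Subtype.ext (map_add _ _ _)
      map_smul' := fun c x => Subtype.ext (map_smul (UniversalEnvelopingAlgebra.ι k) c x)
      map_lie' := fun {x y} => Subtype.ext (by
        simp [LieRing.of_associative_ring_bracket]) }
  have h : S.val.comp (UniversalEnvelopingAlgebra.lift k f) = AlgHom.id k U := by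
    ext x
    simp only [LieHom.comp_apply, AlgHom.coe_toLieHom, AlgHom.comp_apply,
      UniversalEnvelopingAlgebra.lift_ι_apply, AlgHom.id_apply]
    rfl
  refine eq_top_iff.2 fun u _ => ?_
  have := DFunLike.congr_fun h u
  rw [AlgHom.id_apply] at this
  rw [← this]
  exact (UniversalEnvelopingAlgebra.lift k f u).2

theorem induction {P : U → Prop} (u : U) (alg : ∀ c, P (algebraMap k U c))
    (lie : ∀ x, P (UniversalEnvelopingAlgebra.ι k x)) (add : ∀ u v, P u → P v → P (u + v))
    (mul : ∀ u v, P u → P v → P (u * v)) : P u := by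
  have hu : u ∈ Algebra.adjoin k (Set.range (UniversalEnvelopingAlgebra.ι k : g → U)) := by
    rw [adjoin_ι]; trivial
  induction hu using Algebra.adjoin_induction with
  | mem _ h => obtain ⟨x, rfl⟩ := h; exact lie x
  | algebraMap c => exact alg c
  | add u v _ _ hu hv => exact add u v hu hv
  | mul u v _ _ hu hv => exact mul u v hu hv

variable {d : ℕ} (b : Module.Basis (Fin d) k g)

/-- The product of the basis elements along a word. -/
def word (l : List (Fin d)) : U := (l.map fun i => UniversalEnvelopingAlgebra.ι k (b i)).prod

theorem word_cons (i : Fin d) (l : List (Fin d)) :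
    word b (i :: l) = UniversalEnvelopingAlgebra.ι k (b i) * word b l := by
  simp [word]

theorem word_nil : word b [] = 1 := rfl

theorem word_append (l m : List (Fin d)) : word b (l ++ m) = word b l * word b m := by
  simp [word]

/-- The span of the words of length less than `n`. -/
def fil (n : ℕ) : Submodule k U := Submodule.span k (word b '' {l | l.length < n})

theorem word_mem_fil {n : ℕ} {l : List (Fin d)} (h : l.length < n) : word b l ∈ fil b n :=
  Submodule.subset_span ⟨l, h, rfl⟩

theorem fil_mono {m n : ℕ} (h : m ≤ n) : fil b m ≤ fil b n :=
  Submodule.span_mono (Set.image_mono fun _ hl => lt_of_lt_of_le hl h)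

theorem fil_zero : fil b 0 = ⊥ := by simp [fil]

theorem ι_mul_mem_fil (x : g) {n : ℕ} {u : U} (hu : u ∈ fil b n) :
    UniversalEnvelopingAlgebra.ι k x * u ∈ fil b (n + 1) := by
  induction hu using Submodule.span_induction with
  | mem u hu =>
    obtain ⟨l, hl, rfl⟩ := hu
    induction (b.mem_span x) using Submodule.span_induction with
    | mem x hx =>
      obtain ⟨i, rfl⟩ := hx
      rw [← word_cons]
      exact word_mem_fil b (by simpa using hl)
    | zero => simp
    | add x y _ _ hx hy => rw [map_add, add_mul]; exact add_mem hx hy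
    | smul r x _ hx => rw [map_smul, smul_mul_assoc]; exact Submodule.smul_mem _ _ hx
  | zero => simp
  | add u v _ _ hu hv => rw [mul_add]; exact add_mem hu hv
  | smul r u _ hu => rw [mul_smul_comm]; exact Submodule.smul_mem _ _ hu

/-- Exchanging two adjacent letters costs a bracket, hence a combination of words shorter by one
letter. -/
theorem perm_sub_mem {l m : List (Fin d)} (h : l.Perm m) :
    word b l - word b m ∈ fil b l.length := by
  induction h with
  | nil => simp
  | cons i _ ih =>
    rw [word_cons, word_cons, ← mul_sub]
    exact ι_mul_mem_fil b _ ih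
  | swap i j l =>
    have : word b (j :: i :: l) - word b (i :: j :: l) =
        UniversalEnvelopingAlgebra.ι k ⁅b j, b i⁆ * word b l := by
      simp only [word_cons, LieHom.map_lie, LieRing.of_associative_ring_bracket]
      noncomm_ring
    rw [this]
    exact ι_mul_mem_fil b _ (word_mem_fil b (by simp))
  | trans h1 h2 ih1 ih2 =>
    rw [← h1.length_eq] at ih2
    rw [← sub_add_sub_cancel]
    exact add_mem ih1 ih2

theorem word_mul_mem_fil (l : List (Fin d)) {n : ℕ} {u : U} (hu : u ∈ fil b n) :
    word b l * u ∈ fil b (l.length + n) := by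
  induction l with
  | nil => simpa [word] using hu
  | cons i l ih =>
    rw [word_cons, mul_assoc]
    exact fil_mono b (by simp only [List.length_cons]; omega) (ι_mul_mem_fil b _ ih)

theorem exists_mem_fil (u : U) : ∃ n, u ∈ fil b n := by
  induction u using induction with
  | alg c =>
    refine ⟨1, ?_⟩
    rw [Algebra.algebraMap_eq_smul_one]
    exact Submodule.smul_mem _ _ (word_mem_fil b (l := []) (by simp))
  | lie x =>
    refine ⟨2, ?_⟩
    rw [← mul_one (UniversalEnvelopingAlgebra.ι k x)]
    exact ι_mul_mem_fil b x (word_mem_fil b (l := []) (by simp))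
  | add u v hu hv =>
    obtain ⟨m, hm⟩ := hu
    obtain ⟨n, hn⟩ := hv
    exact ⟨max m n, add_mem (fil_mono b (le_max_left _ _) hm) (fil_mono b (le_max_right _ _) hn)⟩
  | mul u v hu hv =>
    obtain ⟨m, hm⟩ := hu
    obtain ⟨n, hn⟩ := hv
    refine ⟨m + n, ?_⟩
    induction hm using Submodule.span_induction with
    | mem u hu =>
      obtain ⟨l, hl, rfl⟩ := hu
      exact fil_mono b (Nat.add_le_add_right (le_of_lt hl) n) (word_mul_mem_fil b l hn)
    | zero => simp
    | add u v _ _ hu hv => rw [add_mul]; exact add_mem hu hv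
    | smul r u _ hu => rw [smul_mul_assoc]; exact Submodule.smul_mem _ _ hu

/-- The spanning half of Poincaré–Birkhoff–Witt, one degree at a time: words of length `n` may be
sorted modulo shorter ones. -/
theorem exists_top_sub_mem {n : ℕ} {u : U} (hu : u ∈ fil b (n + 1)) :
    ∃ c : (Fin d → ℕ) → k,
      u - ∑ e ∈ Finset.piAntidiag Finset.univ n, c e • word b (sortedWord e) ∈ fil b n := by
  induction hu using Submodule.span_induction with
  | mem u hu =>
    obtain ⟨l, hl, rfl⟩ := hu
    rcases Nat.lt_succ_iff_lt_or_eq.1 hl with h | h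
    · exact ⟨0, by simpa using word_mem_fil b h⟩
    · refine ⟨Pi.single (fun i => l.count i) 1, ?_⟩
      have hmem : (fun i => l.count i) ∈ Finset.piAntidiag (Finset.univ : Finset (Fin d)) n := by
        simp only [Finset.mem_piAntidiag, Finset.mem_univ, implies_true, and_true]
        rw [← sortedWord_length, ← (perm_sortedWord l).length_eq, h]
      rw [Finset.sum_eq_single_of_mem _ hmem fun e _ he => by simp [he], Pi.single_eq_same,
        one_smul, ← h]
      exact perm_sub_mem b (perm_sortedWord l)
  | zero => exact ⟨0, by simp⟩
  | add u v _ _ hu hv =>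
    obtain ⟨c, hc⟩ := hu
    obtain ⟨c', hc'⟩ := hv
    refine ⟨c + c', ?_⟩
    simp only [Pi.add_apply, add_smul, Finset.sum_add_distrib]
    rw [add_sub_add_comm]
    exact add_mem hc hc'
  | smul r u _ hu =>
    obtain ⟨c, hc⟩ := hu
    refine ⟨r • c, ?_⟩
    simp only [Pi.smul_apply, smul_assoc, ← Finset.smul_sum, ← smul_sub]
    exact Submodule.smul_mem _ _ hc

theorem exists_eq_sum {n : ℕ} {u : U} (hu : u ∈ fil b n) :
    ∃ c : (Fin d → ℕ) → k, u = ∑ e ∈ lowDegree d n, c e • word b (sortedWord e) := by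
  induction n generalizing u with
  | zero =>
    rw [fil_zero, Submodule.mem_bot] at hu
    exact ⟨0, by simp [hu]⟩
  | succ n ih =>
    obtain ⟨c, hc⟩ := exists_top_sub_mem b hu
    obtain ⟨c', hc'⟩ := ih hc
    refine ⟨fun e => if ∑ i, e i < n then c' e else c e, ?_⟩
    rw [lowDegree_succ, Finset.sum_union (lowDegree_disjoint n), sub_eq_iff_eq_add.1 hc']
    congr 1 <;> refine Finset.sum_congr rfl fun e he => ?_
    · have h := mem_lowDegree.1 he
      simp only [if_pos h]
    · have h : ∑ i, e i = n := by simpa using he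
      simp only [if_neg (not_lt.2 h.ge)]

/-! ### Slices of the coproduct -/

/-- The map `(id ⊗ τ) Δ`. -/
def slice (τ : Module.Dual k U) : U →ₗ[k] U :=
  TensorProduct.rid k U ∘ₗ TensorProduct.map LinearMap.id τ ∘ₗ (envComul k g).toLinearMap

theorem slice_one (τ : Module.Dual k U) : slice τ 1 = τ 1 • 1 := by
  simp [slice, Algebra.TensorProduct.one_def]

theorem slice_ι_mul (τ : Module.Dual k U) (x : g) (u : U) :
    slice τ (UniversalEnvelopingAlgebra.ι k x * u) =
      UniversalEnvelopingAlgebra.ι k x * slice τ u +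
        slice (τ ∘ₗ LinearMap.mulLeft k (UniversalEnvelopingAlgebra.ι k x)) u := by
  simp only [slice, LinearMap.comp_apply, AlgHom.toLinearMap_apply, map_mul, envComul_ι]
  generalize envComul k g u = t
  induction t with
  | zero => simp
  | tmul a c =>
    simp only [add_mul, Algebra.TensorProduct.tmul_mul_tmul, one_mul, map_add,
      TensorProduct.map_tmul, LinearMap.id_apply, LinearEquiv.coe_coe, TensorProduct.rid_tmul,
      mul_smul_comm,
      LinearMap.comp_apply, LinearMap.mulLeft_apply]
  | add s t hs ht =>
    rw [mul_add, map_add, map_add, hs, ht]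
    simp only [map_add, mul_add]
    abel

/-- In `Δ(word)` the only term whose first factor has full length is `word ⊗ 1`. -/
theorem slice_word_sub_mem (τ : Module.Dual k U) (l : List (Fin d)) :
    slice τ (word b l) - τ 1 • word b l ∈ fil b l.length := by
  induction l generalizing τ with
  | nil => simp [word, slice_one]
  | cons i l ih =>
    have h1 := ih τ
    have h2 := ih (τ ∘ₗ LinearMap.mulLeft k (UniversalEnvelopingAlgebra.ι k (b i)))
    have h3 : word b l ∈ fil b (l.length + 1) := word_mem_fil b (Nat.lt_succ_self _)
    have h4 := add_mem (add_mem (ι_mul_mem_fil b (b i) h1) (fil_mono b (Nat.le_succ _) h2))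
      (Submodule.smul_mem _ (τ (UniversalEnvelopingAlgebra.ι k (b i))) h3)
    rw [word_cons, slice_ι_mul]
    rw [List.length_cons]
    convert h4 using 1
    rw [LinearMap.comp_apply, LinearMap.mulLeft_apply, mul_one, mul_sub, mul_smul_comm]
    abel

/-- The source of conilpotence: repeated slicing by functionals vanishing at `1` kills every element
of `U(g)`. -/
theorem slice_mem_fil {τ : Module.Dual k U} (hτ : τ 1 = 0) {n : ℕ} {u : U}
    (hu : u ∈ fil b (n + 1)) : slice τ u ∈ fil b n := by
  induction hu using Submodule.span_induction with
  | mem u hu =>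
    obtain ⟨l, hl, rfl⟩ := hu
    have := slice_word_sub_mem b τ l
    rw [hτ, zero_smul, sub_zero] at this
    exact fil_mono b (Nat.lt_succ_iff.1 hl) this
  | zero => simp
  | add u v _ _ hu hv => rw [map_add]; exact add_mem hu hv
  | smul r u _ hu => rw [map_smul]; exact Submodule.smul_mem _ _ hu

/-! ### Functionals dual to the ordered monomials -/

section Coef

variable (τ : Fin d → Module.Dual k (UniversalEnvelopingAlgebra k g))

/-- The functional `τ_{w₁} * ⋯ * τ_{wₙ}`. -/
def coef (w : List (Fin d)) : Module.Dual k U :=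
  (envCounit k g).toLinearMap ∘ₗ (w.map fun i => (slice (τ i) : Module.End k U)).prod

theorem coef_append_singleton (w : List (Fin d)) (i : Fin d) (u : U) :
    coef τ (w ++ [i]) u = coef τ w (slice (τ i) u) := by
  simp [coef]

theorem coef_nil (u : U) : coef τ [] u = envCounit k g u := rfl

variable (h1 : ∀ i, τ i 1 = 0)
  (h2 : ∀ i j, τ i (UniversalEnvelopingAlgebra.ι k (b j)) = if j = i then 1 else 0)

include h1 in
theorem coef_eq_zero (w : List (Fin d)) {n : ℕ} (hn : n ≤ w.length) {u : U} (hu : u ∈ fil b n) :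
    coef τ w u = 0 := by
  replace hu := fil_mono b hn hu
  clear hn
  induction w using List.reverseRecOn generalizing u with
  | nil =>
    rw [List.length_nil, fil_zero, Submodule.mem_bot] at hu
    rw [hu, map_zero]
  | append_singleton w i ih =>
    rw [coef_append_singleton]
    rw [List.length_append, List.length_singleton] at hu
    exact ih (slice_mem_fil b (h1 i) hu)

-- Modulo shorter words, slicing by `τ i` acts as differentiation in the `i`-th letter.
include h1 h2 in
theorem slice_word_sub_count_mem (i : Fin d) (l : List (Fin d)) :
    slice (τ i) (word b l) - (l.count i : k) • word b (l.erase i) ∈ fil b (l.length - 1) := by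
  induction l with
  | nil => simp [word, slice_one, h1]
  | cons j l ih =>
    rw [word_cons, slice_ι_mul, List.length_cons, Nat.add_sub_cancel]
    have e1 := slice_word_sub_mem b
      (τ i ∘ₗ LinearMap.mulLeft k (UniversalEnvelopingAlgebra.ι k (b j))) l
    rw [LinearMap.comp_apply, LinearMap.mulLeft_apply, mul_one, h2] at e1
    have e2 : UniversalEnvelopingAlgebra.ι k (b j) *
        (slice (τ i) (word b l) - (l.count i : k) • word b (l.erase i)) ∈ fil b l.length := by
      -- For empty `l` the subtraction `l.length - 1` is truncated to `0`, so there the remainder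
      -- vanishes outright.
      rcases Nat.eq_zero_or_pos l.length with h | h
      · rw [h, Nat.zero_sub, fil_zero, Submodule.mem_bot] at ih
        rw [ih, mul_zero]; exact zero_mem _
      · exact fil_mono b (by omega) (ι_mul_mem_fil b _ ih)
    by_cases hj : j = i
    · subst hj
      rw [if_pos rfl, one_smul] at e1
      rw [List.count_cons_self, List.erase_cons_head]
      have e3 : (l.count j : k) • (word b (j :: l.erase j) - word b l) ∈ fil b l.length := by
        by_cases hl : j ∈ l
        · have hp := List.perm_cons_erase hl
          rw [hp.length_eq]
          exact Submodule.smul_mem _ _ (perm_sub_mem b hp.symm)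
        · rw [List.count_eq_zero.2 hl]; simp
      convert add_mem (add_mem e1 e2) e3 using 1
      rw [word_cons, mul_sub, mul_smul_comm, smul_sub]
      push_cast
      module
    · rw [if_neg hj, zero_smul, sub_zero] at e1
      rw [List.count_cons_of_ne hj, List.erase_cons_tail (by simpa using hj)]
      convert add_mem e1 e2 using 1
      rw [word_cons, mul_sub, mul_smul_comm]
      abel

-- Iterated differentiation leaves `0` unless the letters match, and then a product of factorials of
-- multiplicities, which is nonzero in characteristic zero.
include h1 h2 in
theorem coef_word [CharZero k] (w l : List (Fin d)) (h : w.length = l.length) :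
    (w.Perm l → coef τ w (word b l) ≠ 0) ∧ (¬ w.Perm l → coef τ w (word b l) = 0) := by
  induction w using List.reverseRecOn generalizing l with
  | nil =>
    rw [List.length_nil] at h
    rw [List.eq_nil_of_length_eq_zero h.symm]
    simp [coef_nil, word]
  | append_singleton w i ih =>
    rw [List.length_append, List.length_singleton] at h
    have e : coef τ (w ++ [i]) (word b l) = l.count i * coef τ w (word b (l.erase i)) := by
      have := coef_eq_zero b τ h1 w (by omega) (slice_word_sub_count_mem b τ h1 h2 i l)
      rw [map_sub, map_smul, sub_eq_zero, smul_eq_mul] at this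
      rw [coef_append_singleton, this]
    rw [e]
    have hp : (w ++ [i]).Perm l ↔ (i :: w).Perm l :=
      ⟨fun h => (List.perm_append_singleton i w).symm.trans h,
        fun h => (List.perm_append_singleton i w).trans h⟩
    rw [hp]
    by_cases hl : i ∈ l
    · have hc : (l.count i : k) ≠ 0 := by
        rw [Nat.cast_ne_zero]; exact (List.count_pos_iff.2 hl).ne'
      have hlen : w.length = (l.erase i).length := by
        rw [List.length_erase_of_mem hl]; omega
      have hq : (i :: w).Perm l ↔ w.Perm (l.erase i) :=
        ⟨fun h => (List.cons_perm_iff_perm_erase.1 h).2,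
          fun h => List.cons_perm_iff_perm_erase.2 ⟨hl, h⟩⟩
      rw [hq]
      exact ⟨fun h => mul_ne_zero hc ((ih _ hlen).1 h), fun h => by rw [(ih _ hlen).2 h, mul_zero]⟩
    · rw [List.count_eq_zero.2 hl]
      exact ⟨fun h => absurd (h.subset List.mem_cons_self) hl, fun _ => by simp⟩

include h1 h2 in
theorem coef_top [CharZero k] {n : ℕ} (c : (Fin d → ℕ) → k) (f : Fin d → ℕ) (hf : ∑ i, f i = n) :
    coef τ (sortedWord f)
      (∑ e ∈ Finset.piAntidiag Finset.univ n, c e • word b (sortedWord e)) =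
      c f * coef τ (sortedWord f) (word b (sortedWord f)) := by
  rw [map_sum, Finset.sum_eq_single_of_mem f (by simpa using hf)]
  · simp
  · intro e he hef
    rw [map_smul, (coef_word b τ h1 h2 _ _ _).2, smul_zero]
    · exact fun h => hef (sortedWord_perm h).symm
    · rw [sortedWord_length, sortedWord_length, hf]
      simp at he
      exact he.symm

-- Triangularity: the top degree part of `u` is visible on the functionals of that degree, so it can
-- be removed degree by degree down to `n`.
include h1 h2 in
theorem mem_fil_of_coef [CharZero k] {n : ℕ} {u : U}
    (h : ∀ e : Fin d → ℕ, n ≤ ∑ i, e i → coef τ (sortedWord e) u = 0) : u ∈ fil b n := by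
  obtain ⟨m, hm⟩ := exists_mem_fil b u
  induction m with
  | zero => exact fil_mono b (Nat.zero_le n) hm
  | succ m ih =>
    by_cases hmn : m < n
    · exact fil_mono b hmn hm
    refine ih ?_
    obtain ⟨c, hc⟩ := exists_top_sub_mem b hm
    have hc0 : ∀ f ∈ Finset.piAntidiag (Finset.univ : Finset (Fin d)) m, c f = 0 := by
      intro f hf
      have hf' : ∑ i, f i = m := by simpa using hf
      have e1 := coef_eq_zero b τ h1 (sortedWord f) (by rw [sortedWord_length, hf']) hc
      rw [map_sub, h f (by omega), coef_top b τ h1 h2 c f hf', zero_sub, neg_eq_zero] at e1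
      exact (mul_eq_zero.1 e1).resolve_right ((coef_word b τ h1 h2 _ _ rfl).1 (List.Perm.refl _))
    rwa [Finset.sum_eq_zero fun f hf => by rw [hc0 f hf, zero_smul], sub_zero] at hc

-- The triangular system is solved from the top degree downwards: functionals of degree `n` do not
-- see `fil b n`, so lower corrections leave the top values intact.
include h1 h2 in
theorem exists_coef_eq [CharZero k] (n : ℕ) (c : (Fin d → ℕ) → k) :
    ∃ u ∈ fil b n, ∀ e : Fin d → ℕ, ∑ i, e i < n → coef τ (sortedWord e) u = c e := by
  induction n generalizing c with
  | zero => exact ⟨0, zero_mem _, fun e he => absurd he (Nat.not_lt_zero _)⟩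
  | succ n ih =>
    set v := ∑ e ∈ Finset.piAntidiag (Finset.univ : Finset (Fin d)) n,
      (c e / coef τ (sortedWord e) (word b (sortedWord e))) • word b (sortedWord e) with hv
    have hvm : v ∈ fil b (n + 1) := by
      refine Submodule.sum_mem _ fun e he => Submodule.smul_mem _ _ (word_mem_fil b ?_)
      have h : ∑ i, e i = n := by simpa using he
      rw [sortedWord_length]
      omega
    obtain ⟨u, hu, hu'⟩ := ih fun e => c e - coef τ (sortedWord e) v
    refine ⟨u + v, add_mem (fil_mono b (Nat.le_succ n) hu) hvm, fun e he => ?_⟩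
    rw [map_add]
    rcases Nat.lt_succ_iff_lt_or_eq.1 he with h | h
    · rw [hu' e h, sub_add_cancel]
    · rw [coef_eq_zero b τ h1 (sortedWord e) (by rw [sortedWord_length, h]) hu, zero_add, hv,
        coef_top b τ h1 h2 _ e h,
        div_mul_cancel₀ _ ((coef_word b τ h1 h2 _ _ rfl).1 (List.Perm.refl _))]

include h1 h2 in
theorem eq_zero_of_coef [CharZero k] {u : U}
    (h : ∀ e : Fin d → ℕ, coef τ (sortedWord e) u = 0) : u = 0 := by
  have := mem_fil_of_coef b τ h1 h2 (n := 0) fun e _ => h e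
  rwa [fil_zero, Submodule.mem_bot] at this

include h1 h2 in
theorem coef_ι (e : Fin d → ℕ) (i : Fin d) :
    coef τ (sortedWord e) (UniversalEnvelopingAlgebra.ι k (b i)) =
      if e = Pi.single i 1 then 1 else 0 := by
  have hw : UniversalEnvelopingAlgebra.ι k (b i) = word b [i] := by simp [word]
  have hl := sortedWord_length e
  have hs : e = Pi.single i 1 ↔ sortedWord e = [i] :=
    ⟨fun h => by rw [h, sortedWord_single], fun h => sortedWord_perm (by
      rw [h, sortedWord_single])⟩
  simp only [hs]
  rcases hm : sortedWord e with _ | ⟨j, _ | ⟨j', l⟩⟩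
  · rw [if_neg (by simp), coef_nil, envCounit, UniversalEnvelopingAlgebra.lift_ι_apply]; rfl
  · have h3 : slice (τ j) (UniversalEnvelopingAlgebra.ι k (b i)) = if i = j then 1 else 0 := by
      have := slice_ι_mul (τ j) (b i) 1
      rw [mul_one, slice_one, h1, zero_smul, mul_zero, zero_add, slice_one] at this
      rw [this, LinearMap.comp_apply, LinearMap.mulLeft_apply, mul_one, h2, ite_smul, one_smul,
        zero_smul]
    have h4 := coef_append_singleton τ [] j (UniversalEnvelopingAlgebra.ι k (b i))
    rw [List.nil_append] at h4
    rw [h4, coef_nil, h3]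
    by_cases h : i = j
    · subst h; simp
    · rw [if_neg h, if_neg (by simpa using fun h' => h h'.symm), map_zero]
  · rw [if_neg (by simp), hw]
    exact coef_eq_zero b τ h1 (j :: j' :: l) (n := 2) (by simp) (word_mem_fil b (by simp))

end Coef

end Env

end

noncomputable section

/-! ## Completed tensor squares -/

section CompletedTensor

variable {R M : Type*} [CommRing R] [AddCommGroup M] [Module R M] [TopologicalSpace M]

theorem CTensor.proj_of_le (z : CTensor R M) {U V : OpenSub R M} (hUV : U.1 ≤ V.1) :
    TensorProduct.map (Submodule.factor hUV) (Submodule.factor hUV) (CTensor.proj U z) =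
      CTensor.proj V z :=
  z.2 U V hUV

theorem tensorMk_of_le {U V : OpenSub R M} (hUV : U.1 ≤ V.1) (t : M ⊗[R] M) :
    TensorProduct.map (Submodule.factor hUV) (Submodule.factor hUV) (tensorMk U t) =
      tensorMk V t := by
  rw [tensorMk, tensorMk, ← LinearMap.comp_apply, ← TensorProduct.map_comp]
  rfl

theorem CTensor.approx_of_le {z : CTensor R M} {U V : OpenSub R M} (hUV : U.1 ≤ V.1)
    {t : M ⊗[R] M} (h : tensorMk U t = CTensor.proj U z) : tensorMk V t = CTensor.proj V z := by
  rw [← tensorMk_of_le hUV, h, CTensor.proj_of_le]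

theorem CTensor.exists_approx (z : CTensor R M) (U : OpenSub R M) :
    ∃ t, tensorMk U t = CTensor.proj U z :=
  TensorProduct.map_surjective U.1.mkQ_surjective U.1.mkQ_surjective _

/-- The intersection of two open submodules. -/
def OpenSub.inf (U V : OpenSub R M) : OpenSub R M := ⟨U.1 ⊓ V.1, U.2.inter V.2⟩

theorem CTensor.eventually_approx {z : CTensor R M} {P : M ⊗[R] M → Prop} :
    (∀ᶠ t in CTensor.approx z, P t) ↔
      ∃ U : OpenSub R M, ∀ t, tensorMk U t = CTensor.proj U z → P t := by
  have : Nonempty (OpenSub R M) := ⟨⟨⊤, isOpen_univ⟩⟩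
  rw [Filter.Eventually, CTensor.approx, Filter.mem_iInf_of_directed]
  · rfl
  · intro U V
    refine ⟨U.inf V, ?_, ?_⟩
    · exact Filter.principal_mono.2 fun t ht => CTensor.approx_of_le (V := U) inf_le_left ht
    · exact Filter.principal_mono.2 fun t ht => CTensor.approx_of_le (V := V) inf_le_right ht

/-- This allows one algebraic tensor satisfying several eventual conditions at once to be extracted
by `.exists`. -/
instance (z : CTensor R M) : (CTensor.approx z).NeBot := by
  rw [Filter.neBot_iff]
  intro h
  have : ∀ᶠ _ in CTensor.approx z, False := by rw [h]; exact Filter.eventually_bot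
  obtain ⟨U, hU⟩ := CTensor.eventually_approx.1 this
  obtain ⟨t, ht⟩ := CTensor.exists_approx z U
  exact hU t ht

theorem CTensor.extend_eq {A B : Type*} [AddCommGroup A] [Module R A] [AddCommGroup B]
    [Module R B] (f : M →ₗ[R] A) (hf : IsOpen (LinearMap.ker f : Set M))
    (g : M →ₗ[R] B) (hg : IsOpen (LinearMap.ker g : Set M)) (z : CTensor R M) {U : OpenSub R M}
    (hUf : U.1 ≤ LinearMap.ker f) (hUg : U.1 ≤ LinearMap.ker g)
    {t : M ⊗[R] M} (ht : tensorMk U t = CTensor.proj U z) :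
    CTensor.extend f hf g hg z = TensorProduct.map f g t := by
  have h := CTensor.approx_of_le (V := ⟨LinearMap.ker f ⊓ LinearMap.ker g, hf.inter hg⟩)
    (le_inf hUf hUg) ht
  rw [CTensor.extend, LinearMap.comp_apply, ← h, tensorMk, ← LinearMap.comp_apply,
    ← TensorProduct.map_comp]
  rfl

/-- By right exactness the kernel of `M ⊗ M → M/U ⊗ M/U` is the sum of the images of `U ⊗ M` and `M
⊗ U`, so only pure tensors need to be tested. -/
theorem tensorMk_mem {U : OpenSub R M} {t : M ⊗[R] M} (ht : tensorMk U t = 0)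
    {P : Type*} [AddCommGroup P] [Module R P] (W : Submodule R P) (F : M ⊗[R] M →ₗ[R] P)
    (h1 : ∀ u ∈ U.1, ∀ m, F (u ⊗ₜ m) ∈ W) (h2 : ∀ u ∈ U.1, ∀ m, F (m ⊗ₜ u) ∈ W) : F t ∈ W := by
  have hk : t ∈ LinearMap.ker (TensorProduct.map U.1.mkQ U.1.mkQ) := ht
  rw [TensorProduct.map_ker (f := U.1.subtype) (g := U.1.mkQ) (f' := U.1.subtype) (g' := U.1.mkQ)
    (LinearMap.exact_subtype_mkQ U.1) U.1.mkQ_surjective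
    (LinearMap.exact_subtype_mkQ U.1) U.1.mkQ_surjective] at hk
  suffices h : LinearMap.range (LinearMap.lTensor M U.1.subtype) ⊔
      LinearMap.range (LinearMap.rTensor M U.1.subtype) ≤ W.comap F from h hk
  refine sup_le ?_ ?_
  · rintro _ ⟨s, rfl⟩
    induction s with
    | zero => simp
    | tmul a c => exact h2 _ c.2 a
    | add s s' hs hs' => rw [map_add]; exact add_mem hs hs'
  · rintro _ ⟨s, rfl⟩
    induction s with
    | zero => simp
    | tmul a c => exact h1 _ a.2 c
    | add s s' hs hs' => rw [map_add]; exact add_mem hs hs'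

theorem tensorMk_sub_mem {U : OpenSub R M} {s t : M ⊗[R] M} (ht : tensorMk U s = tensorMk U t)
    {P : Type*} [AddCommGroup P] [Module R P] (W : Submodule R P) (F : M ⊗[R] M →ₗ[R] P)
    (h1 : ∀ u ∈ U.1, ∀ m, F (u ⊗ₜ m) ∈ W) (h2 : ∀ u ∈ U.1, ∀ m, F (m ⊗ₜ u) ∈ W) :
    F s - F t ∈ W := by
  rw [← map_sub]
  exact tensorMk_mem (by rw [map_sub, ht, sub_self]) W F h1 h2

variable (R) in
/-- The map `M ⊗ M → M`, `a ⊗ b ↦ f(b) a`. -/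
def rightSlice (f : M →ₗ[R] R) : M ⊗[R] M →ₗ[R] M :=
  TensorProduct.rid R M ∘ₗ TensorProduct.map LinearMap.id f

omit [TopologicalSpace M] in
@[simp] theorem rightSlice_tmul (f : M →ₗ[R] R) (a c : M) :
    rightSlice R f (a ⊗ₜ c) = f c • a := by
  simp [rightSlice]

/-- The map `M/U ⊗ M/U → M/U` induced by `rightSlice R f`. -/
def rightSliceQ (U : Submodule R M) (f : M →ₗ[R] R) (hf : ∀ u ∈ U, ∀ m : M, f u • m ∈ U) :
    (M ⧸ U) ⊗[R] (M ⧸ U) →ₗ[R] M ⧸ U :=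
  TensorProduct.lift (LinearMap.flip (U.liftQ (f.smulRight (1 : Module.End R (M ⧸ U)))
    fun u hu => LinearMap.mem_ker.2 (LinearMap.ext fun q => by
      obtain ⟨m, rfl⟩ := U.mkQ_surjective q
      simp only [LinearMap.smulRight_apply, LinearMap.smul_apply, Module.End.one_apply,
        LinearMap.zero_apply, ← map_smul]
      exact (Submodule.Quotient.mk_eq_zero U).2 (hf u hu m))))

omit [TopologicalSpace M] in
theorem rightSliceQ_tmul (U : Submodule R M) (f : M →ₗ[R] R)
    (hf : ∀ u ∈ U, ∀ m : M, f u • m ∈ U) (a : M ⧸ U) (c : M) :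
    rightSliceQ U f hf (a ⊗ₜ U.mkQ c) = f c • a := rfl

theorem rightSliceQ_tensorMk (U : OpenSub R M) (f : M →ₗ[R] R)
    (hf : ∀ u ∈ U.1, ∀ m : M, f u • m ∈ U.1) (t : M ⊗[R] M) :
    rightSliceQ U.1 f hf (tensorMk U t) = U.1.mkQ (rightSlice R f t) := by
  induction t with
  | zero => simp
  | tmul a c => simp only [tensorMk, TensorProduct.map_tmul, rightSliceQ_tmul, rightSlice_tmul,
      map_smul]
  | add s t hs ht => simp only [map_add, hs, ht]

end CompletedTensor

/-! ## The `h`-adic filtration -/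

section Adic

variable {k : Type*} [Field k]

variable (k) in
/-- The submodule `h^n M`. -/
def hSub (M : Type*) [AddCommGroup M] [Module k⟦X⟧ M] (n : ℕ) : Submodule k⟦X⟧ M :=
  (Ideal.span {(PowerSeries.X : k⟦X⟧)}) ^ n • ⊤

theorem mem_hSub {M : Type*} [AddCommGroup M] [Module k⟦X⟧ M] {n : ℕ} {x : M} :
    x ∈ hSub k M n ↔ ∃ y, x = (PowerSeries.X : k⟦X⟧) ^ n • y := by
  rw [hSub, Ideal.span_singleton_pow, Submodule.ideal_span_singleton_smul,
    Submodule.mem_smul_pointwise_iff_exists]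
  simp [eq_comm]

theorem mem_hSub_self {n : ℕ} {r : k⟦X⟧} :
    r ∈ hSub k k⟦X⟧ n ↔ (PowerSeries.X : k⟦X⟧) ^ n ∣ r := mem_hSub

theorem pow_smul_mem_hSub {M : Type*} [AddCommGroup M] [Module k⟦X⟧ M] (n : ℕ) (y : M) :
    (PowerSeries.X : k⟦X⟧) ^ n • y ∈ hSub k M n := mem_hSub.2 ⟨y, rfl⟩

theorem hSub_anti {M : Type*} [AddCommGroup M] [Module k⟦X⟧ M] {m n : ℕ} (h : m ≤ n) :
    hSub k M n ≤ hSub k M m := by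
  intro x hx
  obtain ⟨y, rfl⟩ := mem_hSub.1 hx
  rw [← Nat.add_sub_cancel' h, pow_add, mul_smul]
  exact pow_smul_mem_hSub m _

theorem hSub_zero {M : Type*} [AddCommGroup M] [Module k⟦X⟧ M] (x : M) : x ∈ hSub k M 0 :=
  mem_hSub.2 ⟨x, by simp⟩

theorem map_mem_hSub {M N : Type*} [AddCommGroup M] [Module k⟦X⟧ M] [AddCommGroup N]
    [Module k⟦X⟧ N] (f : M →ₗ[k⟦X⟧] N) {n : ℕ} {x : M} (hx : x ∈ hSub k M n) :
    f x ∈ hSub k N n := by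
  obtain ⟨y, rfl⟩ := mem_hSub.1 hx
  rw [map_smul]
  exact pow_smul_mem_hSub _ _

theorem smul_mem_hSub {M : Type*} [AddCommGroup M] [Module k⟦X⟧ M] {n : ℕ} {r : k⟦X⟧}
    (hr : (PowerSeries.X : k⟦X⟧) ^ n ∣ r) (x : M) : r • x ∈ hSub k M n := by
  obtain ⟨s, rfl⟩ := hr
  rw [mul_smul]
  exact pow_smul_mem_hSub _ _

theorem smul_mem_hSub_add {M : Type*} [AddCommGroup M] [Module k⟦X⟧ M] {m n : ℕ} {r : k⟦X⟧}
    (hr : (PowerSeries.X : k⟦X⟧) ^ m ∣ r) {x : M} (hx : x ∈ hSub k M n) :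
    r • x ∈ hSub k M (m + n) := by
  obtain ⟨s, rfl⟩ := hr
  obtain ⟨y, rfl⟩ := mem_hSub.1 hx
  rw [smul_smul, mul_right_comm, ← pow_add, mul_smul]
  exact pow_smul_mem_hSub _ _

theorem mul_mem_hSub {A : Type*} [Ring A] [Algebra k⟦X⟧ A] {m n : ℕ} {x y : A}
    (hx : x ∈ hSub k A m) (hy : y ∈ hSub k A n) : x * y ∈ hSub k A (m + n) := by
  obtain ⟨x, rfl⟩ := mem_hSub.1 hx
  obtain ⟨y, rfl⟩ := mem_hSub.1 hy
  rw [smul_mul_smul_comm, ← pow_add]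
  exact pow_smul_mem_hSub _ _

theorem eq_zero_of_forall_dvd {r : k⟦X⟧} (h : ∀ n, (PowerSeries.X : k⟦X⟧) ^ n ∣ r) : r = 0 := by
  ext n
  exact PowerSeries.X_pow_dvd_iff.1 (h (n + 1)) n (Nat.lt_succ_self n)

theorem mem_nhds_powerSeries {s : Set k⟦X⟧} {r : k⟦X⟧} :
    s ∈ 𝓝 r ↔ ∃ n, ∀ q, (PowerSeries.X : k⟦X⟧) ^ n ∣ q - r → q ∈ s := by
  rw [(Ideal.hasBasis_nhds_adic (Ideal.span {(PowerSeries.X : k⟦X⟧)}) r).mem_iff]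
  simp only [true_and, Ideal.span_singleton_pow]
  refine exists_congr fun n => ⟨fun h q hq => h ⟨q - r, ?_, by simp⟩, ?_⟩
  · exact Ideal.mem_span_singleton.2 hq
  · rintro h _ ⟨q, hq, rfl⟩
    refine h _ ?_
    simpa using Ideal.mem_span_singleton.1 hq

namespace IsTopFree

variable {M : Type*} [AddCommGroup M] [Module k⟦X⟧ M] [TopologicalSpace M]
  (hM : IsTopFree k M)

include hM

theorem mem_nhds {s : Set M} {x : M} :
    s ∈ 𝓝 x ↔ ∃ n, ∀ y, y - x ∈ hSub k M n → y ∈ s := by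
  obtain ⟨ht, -, -⟩ := hM
  have hb := Ideal.adic_module_basis (Ideal.span {(PowerSeries.X : k⟦X⟧)}) M
  have h := (((Ideal.span {(PowerSeries.X : k⟦X⟧)}).ringFilterBasis.moduleFilterBasis
    hb).toAddGroupFilterBasis.nhds_hasBasis x)
  subst ht
  rw [h.mem_iff]
  constructor
  · rintro ⟨_, ⟨n, rfl⟩, hn⟩
    exact ⟨n, fun y hy => hn ⟨y - x, hy, by simp⟩⟩
  · rintro ⟨n, hn⟩
    refine ⟨_, ⟨n, rfl⟩, ?_⟩
    rintro _ ⟨y, hy, rfl⟩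
    exact hn _ (by rw [add_sub_cancel_left]; exact hy)

theorem isOpen_iff {s : Set M} : IsOpen s ↔ ∀ x ∈ s, ∃ n, ∀ y, y - x ∈ hSub k M n → y ∈ s := by
  simp only [isOpen_iff_mem_nhds, hM.mem_nhds]

theorem isOpen_hSub (n : ℕ) : IsOpen (hSub k M n : Set M) :=
  hM.isOpen_iff.2 fun x hx => ⟨n, fun y hy => by
    have := add_mem hy hx
    rwa [sub_add_cancel] at this⟩

theorem exists_hSub_le {U : Submodule k⟦X⟧ M} (hU : IsOpen (U : Set M)) :
    ∃ n, hSub k M n ≤ U := by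
  obtain ⟨n, hn⟩ := hM.isOpen_iff.1 hU 0 U.zero_mem
  exact ⟨n, fun x hx => hn x (by rwa [sub_zero])⟩

theorem pow_smul_eq_zero {n : ℕ} {x : M} (h : (PowerSeries.X : k⟦X⟧) ^ n • x = 0) : x = 0 := by
  induction n with
  | zero => simpa using h
  | succ n ih =>
    rw [pow_succ', mul_smul] at h
    exact ih (hM.torsionless _ h)

theorem pow_smul_cancel {n : ℕ} {x y : M}
    (h : (PowerSeries.X : k⟦X⟧) ^ n • x = (PowerSeries.X : k⟦X⟧) ^ n • y) : x = y := by
  rw [← sub_eq_zero]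
  apply hM.pow_smul_eq_zero (n := n)
  rw [smul_sub, h, sub_self]

theorem pow_smul_mem_hSub_iff {m n : ℕ} {x : M} :
    (PowerSeries.X : k⟦X⟧) ^ m • x ∈ hSub k M (m + n) ↔ x ∈ hSub k M n := by
  refine ⟨fun h => ?_, fun h => smul_mem_hSub_add dvd_rfl h⟩
  obtain ⟨y, hy⟩ := mem_hSub.1 h
  rw [pow_add, mul_smul] at hy
  rw [hM.pow_smul_cancel hy]
  exact pow_smul_mem_hSub _ _

theorem eq_of_forall_sub_mem {x y : M} (h : ∀ n, x - y ∈ hSub k M n) : x = y := by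
  have := hM.complete.toIsHausdorff
  rw [← sub_eq_zero]
  exact this.haus _ fun n => by
    rw [SModEq.zero]
    exact h n

theorem exists_limit (s : ℕ → M) (h : ∀ n, s (n + 1) - s n ∈ hSub k M n) :
    ∃ x, ∀ n, x - s n ∈ hSub k M n := by
  have := hM.complete.toIsPrecomplete
  have h2 : ∀ m n, m ≤ n → s n - s m ∈ hSub k M m := by
    intro m n hmn
    induction n, hmn using Nat.le_induction with
    | base => rw [sub_self]; exact zero_mem _
    | succ n hn ih =>
      rw [← sub_add_sub_cancel]
      exact add_mem (hSub_anti hn (h n)) ih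
  obtain ⟨x, hx⟩ := this.prec (f := s) fun {m n} hmn => by
    refine (SModEq.sub_mem.2 ?_).symm
    exact h2 m n hmn
  exact ⟨x, fun n => SModEq.sub_mem.1 (hx n).symm⟩

/-- The open submodule `h^n M`. -/
def hOpen (n : ℕ) : OpenSub k⟦X⟧ M := ⟨hSub k M n, hM.isOpen_hSub n⟩

end IsTopFree

/-- The reductions modulo `h` of the linear functionals on a complete torsionless module. -/
theorem exists_lift_functional {M V : Type*} [AddCommGroup M] [Module k⟦X⟧ M] [AddCommGroup V]
    [Module k V] (htf : ∀ x : M, (PowerSeries.X : k⟦X⟧) • x = 0 → x = 0)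
    (p : M →ₛₗ[PowerSeries.constantCoeff (R := k)] V) (hp : Function.Surjective p)
    (hk : ∀ x : M, p x = 0 ↔ ∃ y : M, x = (PowerSeries.X : k⟦X⟧) • y) (τ : V →ₗ[k] k) :
    ∃ f : M →ₗ[k⟦X⟧] k⟦X⟧, ∀ x, PowerSeries.constantCoeff (f x) = τ (p x) := by
  classical
  let b := Module.Basis.ofVectorSpace k V
  choose q hq using hp
  -- A `k`-linear section of `p`, with `k` acting on `M` through constant series.
  let s : V →+ M :=
    { toFun := fun v => (b.repr v).sum fun i c => PowerSeries.C c • q (b i)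
      map_zero' := by simp
      map_add' := fun v w => by
        rw [map_add, Finsupp.sum_add_index'] <;> intros <;> simp [add_smul] }
  have s_smul : ∀ (c : k) v, s (c • v) = PowerSeries.C c • s v := by
    intro c v
    change (b.repr (c • v)).sum (fun i c => PowerSeries.C c • q (b i)) =
      _ • (b.repr v).sum (fun i c => PowerSeries.C c • q (b i))
    rw [map_smul, Finsupp.sum_smul_index (fun i => by rw [map_zero, zero_smul]), Finsupp.smul_sum]
    simp only [map_mul, mul_smul]
  have ps : ∀ v, p (s v) = v := by
    intro v
    change p ((b.repr v).sum (fun i c => PowerSeries.C c • q (b i))) = v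
    rw [Finsupp.sum, map_sum]
    conv_rhs => rw [← b.linearCombination_repr v, Finsupp.linearCombination_apply, Finsupp.sum]
    refine Finset.sum_congr rfl fun i _ => ?_
    rw [map_smulₛₗ, hq]
    simp
  -- Writing `x = s (p x) + h · rem x` repeatedly, the elements `p (rem^[n] x)` are the coefficients
  -- of `x` in `V[[h]]`, and the functional applies `τ` to each of them.
  have hrem : ∀ x, ∃ y, x - s (p x) = (PowerSeries.X : k⟦X⟧) • y := fun x =>
    (hk _).1 (by rw [map_sub, ps, sub_self])
  choose rem hrem using hrem
  have cancel : ∀ x y : M, (PowerSeries.X : k⟦X⟧) • x = (PowerSeries.X : k⟦X⟧) • y → x = y := by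
    intro x y h
    rw [← sub_eq_zero]
    exact htf _ (by rw [smul_sub, h, sub_self])
  have rem_add : ∀ x y, rem (x + y) = rem x + rem y := fun x y => cancel _ _ (by
    rw [smul_add, ← hrem, ← hrem, ← hrem, map_add, map_add]; abel)
  have rem_smul : ∀ c x, rem (PowerSeries.C c • x) = PowerSeries.C c • rem x := fun c x =>
    cancel _ _ (by
      rw [← hrem, ← mul_smul, mul_comm, mul_smul, ← hrem, map_smulₛₗ, PowerSeries.constantCoeff_C,
        s_smul, smul_sub])
  have rem_X : ∀ x, rem ((PowerSeries.X : k⟦X⟧) • x) = x := fun x => cancel _ _ (by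
    rw [← hrem, map_smulₛₗ, PowerSeries.constantCoeff_X, zero_smul, map_zero, sub_zero])
  let f : M → k⟦X⟧ := fun x => PowerSeries.mk fun n => τ (p (rem^[n] x))
  have iter_add : ∀ n x y, rem^[n] (x + y) = rem^[n] x + rem^[n] y := by
    intro n
    induction n with
    | zero => intro x y; rfl
    | succ n ih => intro x y; simp only [Function.iterate_succ_apply, rem_add, ih]
  have iter_smul : ∀ n (c : k) x,
      rem^[n] (PowerSeries.C c • x) = PowerSeries.C c • rem^[n] x := by
    intro n c
    induction n with
    | zero => intro x; rfl
    | succ n ih => intro x; simp only [Function.iterate_succ_apply, rem_smul, ih]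
  have f_add : ∀ x y, f (x + y) = f x + f y := fun x y => by
    ext n; simp [f, iter_add]
  have f_smul : ∀ c x, f (PowerSeries.C c • x) = PowerSeries.C c * f x := fun c x => by
    ext n; simp [f, iter_smul]
  have f_X : ∀ x, f ((PowerSeries.X : k⟦X⟧) • x) = PowerSeries.X * f x := fun x => by
    ext n
    rcases n with _ | n
    · simp [f]
    · simp [f, PowerSeries.coeff_succ_X_mul, rem_X]
  -- Additivity and compatibility with constants and with `h` are known; a general scalar is handled
  -- modulo `h^n` by splitting off its constant term.
  have f_lin : ∀ n (r : k⟦X⟧) x, (PowerSeries.X : k⟦X⟧) ^ n ∣ f (r • x) - r * f x := by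
    intro n
    induction n with
    | zero => intro r x; simp
    | succ n ih =>
      intro r x
      obtain ⟨r', hr'⟩ : (PowerSeries.X : k⟦X⟧) ∣ r - PowerSeries.C (PowerSeries.constantCoeff r) :=
        PowerSeries.X_dvd_iff.2 (by simp)
      have hr : r = PowerSeries.C (PowerSeries.constantCoeff r) + PowerSeries.X * r' := by
        rw [← hr']; ring
      generalize PowerSeries.constantCoeff r = c at hr
      subst hr
      have e : f ((PowerSeries.C c + PowerSeries.X * r') • x) -
          (PowerSeries.C c + PowerSeries.X * r') * f x =
          PowerSeries.X * (f (r' • x) - r' * f x) := by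
        rw [add_smul, f_add, f_smul, mul_smul, f_X]
        ring
      rw [e, pow_succ']
      exact mul_dvd_mul_left _ (ih r' x)
  refine ⟨{ toFun := f, map_add' := f_add, map_smul' := fun r x => ?_ }, fun x => ?_⟩
  · rw [RingHom.id_apply, smul_eq_mul, ← sub_eq_zero]
    exact eq_zero_of_forall_dvd fun n => f_lin n r x
  · rw [← PowerSeries.coeff_zero_eq_constantCoeff_apply]
    simp [f]

end Adic

/-! ## Slices of the coproduct of a topologically free Hopf algebra -/

namespace TopHopf

variable {k H : Type*} [Field k] [Ring H] [Algebra k⟦X⟧ H] [TopologicalSpace H]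
  (T : TopHopf k⟦X⟧ H) (hH : IsTopFree k H)

omit [TopologicalSpace H] in
theorem smul_mem_of_mem_hSub (f : H →ₗ[k⟦X⟧] k⟦X⟧) {n : ℕ} :
    ∀ u ∈ hSub k H n, ∀ m : H, f u • m ∈ hSub k H n := fun _ hu m =>
  smul_mem_hSub (mem_hSub_self.1 (map_mem_hSub f hu)) m

theorem smul_mem_of_mem_hOpen (f : H →ₗ[k⟦X⟧] k⟦X⟧) {n : ℕ} :
    ∀ u ∈ (hH.hOpen n).1, ∀ m : H, f u • m ∈ (hH.hOpen n).1 :=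
  smul_mem_of_mem_hSub f

/-- Two tensors that approximate `Δ x` modulo `h^n` have slices that agree modulo `h^n`;
completeness supplies the limit. -/
theorem exists_slice (f : H →ₗ[k⟦X⟧] k⟦X⟧) (x : H) : ∃ y : H, ∀ (n : ℕ) (t : H ⊗[k⟦X⟧] H),
    tensorMk (hH.hOpen n) t = CTensor.proj (hH.hOpen n) (T.comul x) →
      y - rightSlice k⟦X⟧ f t ∈ hSub k H n := by
  have key : ∀ (n : ℕ) (s t : H ⊗[k⟦X⟧] H), tensorMk (hH.hOpen n) s = tensorMk (hH.hOpen n) t →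
      rightSlice k⟦X⟧ f s - rightSlice k⟦X⟧ f t ∈ hSub k H n := by
    intro n s t h
    refine tensorMk_sub_mem h _ _ (fun u hu m => ?_) (fun u hu m => ?_)
    · rw [rightSlice_tmul]
      exact Submodule.smul_mem _ _ hu
    · rw [rightSlice_tmul]
      exact smul_mem_of_mem_hSub f u hu m
  choose t ht using fun n => CTensor.exists_approx (T.comul x) (hH.hOpen n)
  obtain ⟨y, hy⟩ := hH.exists_limit (fun n => rightSlice k⟦X⟧ f (t n)) fun n =>
    key n _ _ (by rw [ht n]; exact CTensor.approx_of_le (hSub_anti (Nat.le_succ n)) (ht (n + 1)))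
  refine ⟨y, fun n s hs => ?_⟩
  rw [← sub_add_sub_cancel]
  exact add_mem (hy n) (key n _ _ (by rw [ht n, hs]))

/-- The map `(id ⊗ f) Δ : H → H`. -/
def slice (f : H →ₗ[k⟦X⟧] k⟦X⟧) : H →ₗ[k⟦X⟧] H where
  toFun x := (T.exists_slice hH f x).choose
  map_add' x y := hH.eq_of_forall_sub_mem fun n => by
    obtain ⟨s, hs⟩ := CTensor.exists_approx (T.comul x) (hH.hOpen n)
    obtain ⟨t, ht⟩ := CTensor.exists_approx (T.comul y) (hH.hOpen n)
    have h := (T.exists_slice hH f (x + y)).choose_spec n (s + t) (by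
      rw [map_add, map_add, map_add, hs, ht])
    have h' := sub_mem h (add_mem ((T.exists_slice hH f x).choose_spec n s hs)
      ((T.exists_slice hH f y).choose_spec n t ht))
    rwa [map_add (rightSlice k⟦X⟧ f), ← add_sub_add_comm, sub_sub_sub_cancel_right] at h'
  map_smul' r x := hH.eq_of_forall_sub_mem fun n => by
    obtain ⟨s, hs⟩ := CTensor.exists_approx (T.comul x) (hH.hOpen n)
    have h := (T.exists_slice hH f (r • x)).choose_spec n (r • s) (by
      rw [map_smul, map_smul, map_smul, hs])
    have h' := sub_mem h (Submodule.smul_mem _ r ((T.exists_slice hH f x).choose_spec n s hs))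
    rwa [map_smul (rightSlice k⟦X⟧ f), smul_sub, sub_sub_sub_cancel_right] at h'

theorem slice_sub_mem (f : H →ₗ[k⟦X⟧] k⟦X⟧) {n : ℕ} {x : H} {t : H ⊗[k⟦X⟧] H}
    (ht : tensorMk (hH.hOpen n) t = CTensor.proj (hH.hOpen n) (T.comul x)) :
    T.slice hH f x - rightSlice k⟦X⟧ f t ∈ hSub k H n :=
  (T.exists_slice hH f x).choose_spec n t ht

theorem mkQ_slice (f : H →ₗ[k⟦X⟧] k⟦X⟧) (n : ℕ) (x : H) :
    (hH.hOpen n).1.mkQ (T.slice hH f x) =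
      rightSliceQ (hH.hOpen n).1 f (smul_mem_of_mem_hOpen hH f)
        (CTensor.proj (hH.hOpen n) (T.comul x)) := by
  obtain ⟨t, ht⟩ := CTensor.exists_approx (T.comul x) (hH.hOpen n)
  rw [← ht, rightSliceQ_tensorMk, ← sub_eq_zero, ← map_sub, ← LinearMap.mem_ker,
    Submodule.ker_mkQ]
  exact T.slice_sub_mem hH f ht

theorem slice_eq_of_forall {f : H →ₗ[k⟦X⟧] k⟦X⟧} {x y : H}
    (h : ∀ n, ∃ t, tensorMk (hH.hOpen n) t = CTensor.proj (hH.hOpen n) (T.comul x) ∧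
      y - rightSlice k⟦X⟧ f t ∈ hSub k H n) : T.slice hH f x = y := by
  refine hH.eq_of_forall_sub_mem fun n => ?_
  obtain ⟨t, ht, hy⟩ := h n
  have := sub_mem (T.slice_sub_mem hH f ht) hy
  rwa [sub_sub_sub_cancel_right] at this

theorem slice_add (f f' : H →ₗ[k⟦X⟧] k⟦X⟧) :
    T.slice hH (f + f') = T.slice hH f + T.slice hH f' := by
  ext x
  refine T.slice_eq_of_forall hH fun n => ?_
  obtain ⟨t, ht⟩ := CTensor.exists_approx (T.comul x) (hH.hOpen n)
  refine ⟨t, ht, ?_⟩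
  have e : rightSlice k⟦X⟧ (f + f') t = rightSlice k⟦X⟧ f t + rightSlice k⟦X⟧ f' t := by
    simp [rightSlice, TensorProduct.map_add_right]
  rw [e, LinearMap.add_apply, add_sub_add_comm]
  exact add_mem (T.slice_sub_mem hH f ht) (T.slice_sub_mem hH f' ht)

theorem slice_smul (r : k⟦X⟧) (f : H →ₗ[k⟦X⟧] k⟦X⟧) :
    T.slice hH (r • f) = r • T.slice hH f := by
  ext x
  refine T.slice_eq_of_forall hH fun n => ?_
  obtain ⟨t, ht⟩ := CTensor.exists_approx (T.comul x) (hH.hOpen n)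
  refine ⟨t, ht, ?_⟩
  have e : rightSlice k⟦X⟧ (r • f) t = r • rightSlice k⟦X⟧ f t := by
    simp [rightSlice, TensorProduct.map_smul_right]
  rw [e, LinearMap.smul_apply, ← smul_sub]
  exact Submodule.smul_mem _ _ (T.slice_sub_mem hH f ht)

/-- `Δ(x)` may be approximated arbitrarily well, compatibly with the slices. -/
theorem eventually_slice (f : H →ₗ[k⟦X⟧] k⟦X⟧) (n : ℕ) (x : H) :
    ∀ᶠ t in CTensor.approx (T.comul x), T.slice hH f x - rightSlice k⟦X⟧ f t ∈ hSub k H n :=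
  CTensor.eventually_approx.2 ⟨hH.hOpen n, fun _ ht => T.slice_sub_mem hH f ht⟩

theorem slice_counit : T.slice hH T.counit.toLinearMap = LinearMap.id := by
  ext x
  refine hH.eq_of_forall_sub_mem fun n => ?_
  have h1 := T.eventually_slice hH T.counit.toLinearMap n x
  have h2 := (T.comul_counit x).eventually (hH.mem_nhds.2 ⟨n, fun y hy => hy⟩ :
    {y | y - x ∈ hSub k H n} ∈ 𝓝 x)
  obtain ⟨t, h1, h2⟩ := (h1.and h2).exists
  have := add_mem h1 h2
  change T.slice hH T.counit.toLinearMap x - rightSlice k⟦X⟧ T.counit.toLinearMap t +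
    (rightSlice k⟦X⟧ T.counit.toLinearMap t - x) ∈ _ at this
  rwa [sub_add_sub_cancel] at this

theorem counit_slice (f : H →ₗ[k⟦X⟧] k⟦X⟧) (x : H) : T.counit (T.slice hH f x) = f x := by
  rw [← sub_eq_zero]
  refine eq_zero_of_forall_dvd fun n => ?_
  have h1 := T.eventually_slice hH f n x
  have h2 := (T.counit_comul x).eventually (hH.mem_nhds.2 ⟨n, fun y hy => hy⟩ :
    {y | y - x ∈ hSub k H n} ∈ 𝓝 x)
  obtain ⟨t, h1, h2⟩ := (h1.and h2).exists
  have e : T.counit (rightSlice k⟦X⟧ f t) = f (TensorProduct.lid k⟦X⟧ H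
      (TensorProduct.map T.counit.toLinearMap LinearMap.id t)) := by
    clear h1 h2
    induction t with
    | zero => simp
    | tmul a c => simp [mul_comm]
    | add s t hs ht => simp only [map_add, hs, ht]
  have h3 := add_mem (map_mem_hSub T.counit.toLinearMap h1) (map_mem_hSub f h2)
  rw [map_sub, map_sub, AlgHom.toLinearMap_apply, AlgHom.toLinearMap_apply, e,
    sub_add_sub_cancel] at h3
  exact mem_hSub_self.1 h3

/-- In Sweedler notation both sides send `x` to `x₁ f(x₂) g(x₃)`. This is coassociativity contracted
in the last two factors, checked modulo each `h^n`. -/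
theorem slice_comp_slice (f g : H →ₗ[k⟦X⟧] k⟦X⟧) :
    T.slice hH (f ∘ₗ T.slice hH g) = T.slice hH f ∘ₗ T.slice hH g := by
  ext x
  refine hH.eq_of_forall_sub_mem fun n => ?_
  let U := hH.hOpen n
  -- On `W` both iterated coproducts vanish modulo `U`, so a single tensor `t` computes both
  -- extensions in `T.coassoc`.
  let W : OpenSub k⟦X⟧ H := U.inf ⟨_, T.isOpen_ker_comul U⟩
  obtain ⟨t, ht⟩ := CTensor.exists_approx (T.comul x) W
  have htU : tensorMk U t = CTensor.proj U (T.comul x) :=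
    CTensor.approx_of_le inf_le_left ht
  have hc := T.coassoc x U
  have hW1 : W.1 ≤ LinearMap.ker U.1.mkQ := by rw [Submodule.ker_mkQ]; exact inf_le_left
  rw [CTensor.extend_eq _ _ _ _ _ (U := W) inf_le_right hW1 ht,
    CTensor.extend_eq _ _ _ _ _ (U := W) hW1 inf_le_right ht] at hc
  let sf := rightSliceQ U.1 f (smul_mem_of_mem_hOpen hH f)
  let sg := rightSliceQ U.1 g (smul_mem_of_mem_hOpen hH g)
  have hc' := congrArg (fun z => sf (LinearMap.lTensor (H ⧸ U.1) sg z)) hc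
  have e1 : ∀ t : H ⊗[k⟦X⟧] H, sf (LinearMap.lTensor (H ⧸ U.1) sg (TensorProduct.map U.1.mkQ
      (CTensor.proj U ∘ₗ T.comul) t)) = U.1.mkQ (rightSlice k⟦X⟧ (f ∘ₗ T.slice hH g) t) := by
    intro t
    induction t with
    | zero => simp
    | tmul a c =>
      rw [TensorProduct.map_tmul, LinearMap.lTensor_tmul, rightSlice_tmul, map_smul,
        LinearMap.comp_apply, LinearMap.comp_apply]
      have : sg (CTensor.proj U (T.comul c)) = U.1.mkQ (T.slice hH g c) :=
        (T.mkQ_slice hH g n c).symm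
      rw [this]
      rfl
    | add s t hs ht => simp only [map_add, hs, ht]
  have e2 : ∀ (w : (H ⧸ U.1) ⊗[k⟦X⟧] (H ⧸ U.1)) (c : H), sf (LinearMap.lTensor (H ⧸ U.1) sg
      (TensorProduct.assoc k⟦X⟧ (H ⧸ U.1) (H ⧸ U.1) (H ⧸ U.1) (w ⊗ₜ U.1.mkQ c))) =
        g c • sf w := by
    intro w c
    induction w with
    | zero => simp
    | tmul a q =>
      rw [TensorProduct.assoc_tmul, LinearMap.lTensor_tmul]
      have : sg (q ⊗ₜ U.1.mkQ c) = g c • q := rfl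
      rw [this, TensorProduct.tmul_smul, map_smul]
    | add s t hs ht => simp only [map_add, TensorProduct.add_tmul, hs, ht, smul_add]
  have e3 : ∀ t : H ⊗[k⟦X⟧] H, sf (LinearMap.lTensor (H ⧸ U.1) sg
      (TensorProduct.assoc k⟦X⟧ (H ⧸ U.1) (H ⧸ U.1) (H ⧸ U.1)
        (TensorProduct.map (CTensor.proj U ∘ₗ T.comul) U.1.mkQ t))) =
          U.1.mkQ (T.slice hH f (rightSlice k⟦X⟧ g t)) := by
    intro t
    induction t with
    | zero => simp
    | tmul a c =>
      rw [TensorProduct.map_tmul, e2, rightSlice_tmul, map_smul, map_smul]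
      congr 1
      exact (T.mkQ_slice hH f n a).symm
    | add s t hs ht => simp only [map_add, hs, ht]
  change sf (LinearMap.lTensor (H ⧸ U.1) sg _) = sf (LinearMap.lTensor (H ⧸ U.1) sg _) at hc'
  rw [e1, e3, ← sub_eq_zero, ← map_sub, ← LinearMap.mem_ker, Submodule.ker_mkQ] at hc'
  have h1 := T.slice_sub_mem hH (f ∘ₗ T.slice hH g) htU
  have h2 := map_mem_hSub (T.slice hH f) (T.slice_sub_mem hH g htU)
  rw [map_sub] at h2
  have := sub_mem (sub_mem h1 hc') h2
  convert this using 1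
  rw [LinearMap.comp_apply]
  abel

end TopHopf

end

/-! ### Convolution words and systems of coordinates. -/

noncomputable section

namespace TopHopf

variable {k H : Type*} [Field k] [Ring H] [Algebra k⟦X⟧ H] [TopologicalSpace H]
  (T : TopHopf k⟦X⟧ H) (hH : IsTopFree k H)

theorem slice_one (f : H →ₗ[k⟦X⟧] k⟦X⟧) : T.slice hH f 1 = f 1 • 1 :=
  T.slice_eq_of_forall hH fun n => ⟨1, (T.comul_one _).symm, by
    rw [Algebra.TensorProduct.one_def, rightSlice_tmul, sub_self]; exact zero_mem _⟩

theorem slice_sub (f f' : H →ₗ[k⟦X⟧] k⟦X⟧) :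
    T.slice hH (f - f') = T.slice hH f - T.slice hH f' := by
  rw [eq_sub_iff_add_eq, ← slice_add, sub_add_cancel]

section Words

variable {d : ℕ} (t : Fin d → H →ₗ[k⟦X⟧] k⟦X⟧)

/-- The composite of the slices by the functionals `t i` along a word. -/
def wordOp (w : List (Fin d)) : Module.End k⟦X⟧ H :=
  (w.map fun i => (T.slice hH (t i) : Module.End k⟦X⟧ H)).prod

/-- The convolution product of the functionals `t i` along a word. -/
def wordCoord (w : List (Fin d)) : H →ₗ[k⟦X⟧] k⟦X⟧ :=
  T.counit.toLinearMap ∘ₗ T.wordOp hH t w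

theorem wordOp_nil (x : H) : T.wordOp hH t [] x = x := rfl

theorem wordOp_append (w v : List (Fin d)) (x : H) :
    T.wordOp hH t (w ++ v) x = T.wordOp hH t w (T.wordOp hH t v x) := by
  simp [wordOp]

theorem wordOp_singleton (i : Fin d) (x : H) : T.wordOp hH t [i] x = T.slice hH (t i) x := by
  simp [wordOp]

theorem wordOp_cons (i : Fin d) (w : List (Fin d)) (x : H) :
    T.wordOp hH t (i :: w) x = T.slice hH (t i) (T.wordOp hH t w x) := by
  simp [wordOp]

theorem wordCoord_apply (w : List (Fin d)) (x : H) :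
    T.wordCoord hH t w x = T.counit (T.wordOp hH t w x) := rfl

theorem wordCoord_append (w v : List (Fin d)) (x : H) :
    T.wordCoord hH t (w ++ v) x = T.wordCoord hH t w (T.wordOp hH t v x) := by
  rw [wordCoord_apply, wordOp_append, ← wordCoord_apply]

theorem wordCoord_nil (x : H) : T.wordCoord hH t [] x = T.counit x := rfl

theorem wordCoord_cons (i : Fin d) (w : List (Fin d)) (x : H) :
    T.wordCoord hH t (i :: w) x = t i (T.wordOp hH t w x) := by
  rw [wordCoord_apply, wordOp_cons, counit_slice]

theorem wordCoord_singleton (i : Fin d) : T.wordCoord hH t [i] = t i := by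
  ext1 x
  rw [wordCoord_cons, wordOp_nil]

/-- By coassociativity, slicing by a convolution product is composition of slices. The word
coordinates thereby govern the coproduct. -/
theorem slice_wordCoord (w : List (Fin d)) :
    T.slice hH (T.wordCoord hH t w) = T.wordOp hH t w := by
  induction w with
  | nil => exact T.slice_counit hH
  | cons i w ih =>
    have : T.wordCoord hH t (i :: w) = t i ∘ₗ T.slice hH (T.wordCoord hH t w) := by
      ext1 x
      rw [wordCoord_cons, LinearMap.comp_apply, ih]
    rw [this, slice_comp_slice, ih]
    ext x
    rw [wordOp_cons, LinearMap.comp_apply]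

end Words

/-- Coordinates on a topologically free Hopf algebra: functionals `t i` such that the ordered
monomials in the `t i` are the coordinate functions of a topological basis. -/
structure Coords (d : ℕ) where
  t : Fin d → H →ₗ[k⟦X⟧] k⟦X⟧
  t_one : ∀ i, t i 1 = 0
  detect : ∀ (n : ℕ) (x : H),
    (∀ e, (PowerSeries.X : k⟦X⟧) ^ n ∣ T.wordCoord hH t (sortedWord e) x) → x ∈ hSub k H n
  -- Modulo `h^n` only finitely many coordinates of an element are nonzero; `exists_of` asserts that
  -- every such family occurs.
  conilpotent : ∀ (n : ℕ) (x : H), ∃ m, ∀ w : List (Fin d), m ≤ w.length →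
    (PowerSeries.X : k⟦X⟧) ^ n ∣ T.wordCoord hH t w x
  exists_of : ∀ c : (Fin d → ℕ) → k⟦X⟧,
    (∀ n, ∃ m, ∀ e, m ≤ ∑ i, e i → (PowerSeries.X : k⟦X⟧) ^ n ∣ c e) →
      ∃ x, ∀ e, T.wordCoord hH t (sortedWord e) x = c e
  -- `U(g)` is cocommutative, so convolution is commutative modulo `h`; the condition `c 1 = 0`
  -- removes the constant term from the expansion of the commutator.
  comm : ∀ i j, ∃ c : H →ₗ[k⟦X⟧] k⟦X⟧, c 1 = 0 ∧ ∀ x,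
    T.slice hH (t i) (T.slice hH (t j) x) =
      T.slice hH (t j) (T.slice hH (t i) x) + (PowerSeries.X : k⟦X⟧) • T.slice hH c x

end TopHopf

/-! ## Existence of coordinates -/

section Existence

theorem exists_eq_X_smul {k M : Type*} [Field k] [AddCommGroup M] [Module k⟦X⟧ M]
    (f : M →ₗ[k⟦X⟧] k⟦X⟧) (hf : ∀ x, (PowerSeries.X : k⟦X⟧) ∣ f x) :
    ∃ c : M →ₗ[k⟦X⟧] k⟦X⟧, ∀ x, f x = PowerSeries.X * c x := by
  choose c hc using hf
  have hX : (PowerSeries.X : k⟦X⟧) ≠ 0 := PowerSeries.X_ne_zero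
  refine ⟨{ toFun := c, map_add' := fun x y => ?_, map_smul' := fun r x => ?_ }, hc⟩
  · apply mul_left_cancel₀ hX
    rw [mul_add, ← hc, ← hc, ← hc, map_add]
  · apply mul_left_cancel₀ hX
    rw [← hc, map_smul, hc x, RingHom.id_apply, smul_eq_mul, smul_eq_mul]
    ring

theorem X_pow_dvd_cancel {k : Type*} [Field k] {m n : ℕ} {r : k⟦X⟧}
    (h : (PowerSeries.X : k⟦X⟧) ^ (m + n) ∣ PowerSeries.X ^ m * r) :
    (PowerSeries.X : k⟦X⟧) ^ n ∣ r := by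
  rw [pow_add] at h
  exact (mul_dvd_mul_iff_left (pow_ne_zero _ PowerSeries.X_ne_zero)).1 h

variable {k g H : Type*} [Field k] [LieRing g] [LieAlgebra k g] [LieBialgebra k g]
  [Ring H] [Algebra k⟦X⟧ H] [TopologicalSpace H] {T : TopHopf k⟦X⟧ H}
  {p : H →ₛₗ[PowerSeries.constantCoeff (R := k)] UniversalEnvelopingAlgebra k g}
  (hp : IsQUEA T p)

/-- The functional `f` reduces to `τ` modulo `h`. -/
def Lifts (p : H →ₛₗ[PowerSeries.constantCoeff (R := k)] UniversalEnvelopingAlgebra k g)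
    (f : H →ₗ[k⟦X⟧] k⟦X⟧) (τ : Module.Dual k (UniversalEnvelopingAlgebra k g)) : Prop :=
  ∀ x, PowerSeries.constantCoeff (f x) = τ (p x)

include hp

namespace IsQUEA

theorem p_eq_of_sub_mem {x y : H} (h : x - y ∈ hSub k H 1) : p x = p y := by
  obtain ⟨z, hz⟩ := mem_hSub.1 h
  rw [← sub_eq_zero, ← map_sub]
  exact (hp.ker _).2 ⟨z, by rw [hz, pow_one]⟩

theorem p_slice {f : H →ₗ[k⟦X⟧] k⟦X⟧} {τ : Module.Dual k (UniversalEnvelopingAlgebra k g)}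
    (h : Lifts p f τ) (x : H) : p (T.slice hp.topFree f x) = Env.slice τ (p x) := by
  obtain ⟨t, h1, h2⟩ := ((T.eventually_slice hp.topFree f 1 x).and (hp.comul x)).exists
  rw [hp.p_eq_of_sub_mem h1, Env.slice, LinearMap.comp_apply, LinearMap.comp_apply,
    AlgHom.toLinearMap_apply, ← h2]
  clear h1 h2
  induction t with
  | zero => simp
  | tmul a c =>
    rw [rightSlice_tmul, TensorProduct.map_tmul, TensorProduct.map_tmul, map_smulₛₗ, h c]
    simp
  | add s t hs ht => simp only [map_add, hs, ht]

/-- The difference is `f ⊗ f'` evaluated on `Δ x - Δᵒᵖ x`, which is `h` times a lift of the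
cobracket. -/
theorem commutator {f f' : H →ₗ[k⟦X⟧] k⟦X⟧}
    {τ τ' : Module.Dual k (UniversalEnvelopingAlgebra k g)} (h : Lifts p f τ) (h' : Lifts p f' τ')
    (x : H) : ∃ r, f (T.slice hp.topFree f' x) - f' (T.slice hp.topFree f x) =
      PowerSeries.X * r ∧ PowerSeries.constantCoeff r =
        FormalSeries.pair (τ ⊗ₜ τ') (envCobracket k g (p x)) := by
  have hH := hp.topFree
  obtain ⟨w, hw, hw'⟩ := hp.cobracket x
  obtain ⟨U, hU⟩ := CTensor.eventually_approx.1 hw'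
  -- Precision `h^2` is needed because the identity is divided by `h` and then reduced modulo `h`.
  obtain ⟨s, hs⟩ := CTensor.exists_approx w (U.inf (hH.hOpen 2))
  have hs1 := hU s (CTensor.approx_of_le (V := U) inf_le_left hs)
  have hs2 := CTensor.approx_of_le (V := hH.hOpen 2) inf_le_right hs
  obtain ⟨t, ht⟩ := CTensor.exists_approx (T.comul x) (hH.hOpen 2)
  let F : H ⊗[k⟦X⟧] H →ₗ[k⟦X⟧] k⟦X⟧ :=
    (TensorProduct.lid k⟦X⟧ k⟦X⟧).toLinearMap ∘ₗ TensorProduct.map f f'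
  have hF1 : ∀ t, f (rightSlice k⟦X⟧ f' t) = F t := by
    intro t
    induction t with
    | zero => simp
    | tmul a c => simp [F, mul_comm]
    | add s t hs ht => simp only [map_add, hs, ht]
  have hF2 : ∀ t, f' (rightSlice k⟦X⟧ f t) = F (TensorProduct.comm k⟦X⟧ H H t) := by
    intro t
    induction t with
    | zero => simp
    | tmul a c => simp [F]
    | add s t hs ht => simp only [map_add, hs, ht]
  have hF3 : ∀ s, PowerSeries.constantCoeff (F s) =
      FormalSeries.pair (τ ⊗ₜ τ') (TensorProduct.map p p s) := by
    intro s
    induction s with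
    | zero => simp
    | tmul a c =>
      simp [F, FormalSeries.pair, TensorProduct.dualDistrib_apply, h a, h' c]
    | add s t hs ht => simp only [map_add, hs, ht]
  have hcomm : ∀ t, tensorMk (hH.hOpen 2) (TensorProduct.comm k⟦X⟧ H H t) =
      TensorProduct.comm _ _ _ (tensorMk (hH.hOpen 2) t) := by
    intro t
    induction t with
    | zero => simp
    | tmul a c => rfl
    | add s t hs ht => simp only [map_add, hs, ht]
  have e0 : tensorMk (hH.hOpen 2)
      ((PowerSeries.X : k⟦X⟧) • s - (t - TensorProduct.comm k⟦X⟧ H H t)) = 0 := by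
    rw [map_sub, map_sub, map_smul, hs2, hw, hcomm, ht, sub_self]
  have e1 : F ((PowerSeries.X : k⟦X⟧) • s - (t - TensorProduct.comm k⟦X⟧ H H t)) ∈
      hSub k k⟦X⟧ 2 := by
    refine tensorMk_mem e0 _ F (fun u hu m => ?_) (fun u hu m => ?_)
    · exact mem_hSub_self.2 (Dvd.dvd.mul_right (mem_hSub_self.1 (map_mem_hSub f hu)) _)
    · exact mem_hSub_self.2 (Dvd.dvd.mul_left (mem_hSub_self.1 (map_mem_hSub f' hu)) _)
  have e2 := map_mem_hSub f (T.slice_sub_mem hH f' ht)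
  have e3 := map_mem_hSub f' (T.slice_sub_mem hH f ht)
  rw [map_sub, hF1] at e2
  rw [map_sub, hF2] at e3
  rw [map_sub, map_sub, map_smul, smul_eq_mul] at e1
  obtain ⟨q, hq⟩ := mem_hSub_self.1 (sub_mem (sub_mem e2 e3) e1)
  refine ⟨F s + PowerSeries.X * q, ?_, ?_⟩
  · linear_combination hq
  · rw [map_add, RingHom.map_mul, PowerSeries.constantCoeff_X, zero_mul, add_zero, hF3, hs1]

variable {d : ℕ} {t : Fin d → H →ₗ[k⟦X⟧] k⟦X⟧}
  {τ : Fin d → Module.Dual k (UniversalEnvelopingAlgebra k g)}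

theorem p_wordOp (ht : ∀ i, Lifts p (t i) (τ i)) (w : List (Fin d)) (x : H) :
    p (T.wordOp hp.topFree t w x) =
      (w.map fun i => (Env.slice (τ i) : Module.End k _)).prod (p x) := by
  induction w with
  | nil => rfl
  | cons i w ih =>
    rw [TopHopf.wordOp_cons, hp.p_slice (ht i), ih]
    simp

theorem lifts_wordCoord (ht : ∀ i, Lifts p (t i) (τ i)) (w : List (Fin d)) :
    Lifts p (T.wordCoord hp.topFree t w) (Env.coef τ w) := by
  intro x
  rw [TopHopf.wordCoord_apply, hp.counit, hp.p_wordOp ht]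
  rfl

variable [CharZero k] (b : Module.Basis (Fin d) k g) (ht : ∀ i, Lifts p (t i) (τ i))
  (h1 : ∀ i, τ i 1 = 0)
  (h2 : ∀ i j, τ i (UniversalEnvelopingAlgebra.ι k (b j)) = if j = i then 1 else 0)

include ht h1

-- `p x` lies in some step of the filtration, and each slice lowers it by one.
omit [CharZero k] in
include b in
theorem exists_wordOp_mem (x : H) :
    ∃ m, ∀ w : List (Fin d), m ≤ w.length → T.wordOp hp.topFree t w x ∈ hSub k H 1 := by
  obtain ⟨m, hm⟩ := Env.exists_mem_fil b (p x)
  refine ⟨m, fun w hw => ?_⟩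
  have : p (T.wordOp hp.topFree t w x) = 0 := by
    rw [hp.p_wordOp ht]
    have key : ∀ (w : List (Fin d)) u, u ∈ Env.fil b w.length →
        (w.map fun i => (Env.slice (τ i) : Module.End k _)).prod u = 0 := by
      intro w
      induction w using List.reverseRecOn with
      | nil =>
        intro u hu
        rw [List.length_nil, Env.fil_zero, Submodule.mem_bot] at hu
        rw [hu, map_zero]
      | append_singleton w i ih =>
        intro u hu
        rw [List.length_append, List.length_singleton] at hu
        have := ih _ (Env.slice_mem_fil b (h1 i) hu)
        simpa using this
    exact key w _ (Env.fil_mono b hw hm)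
  obtain ⟨y, hy⟩ := (hp.ker _).1 this
  exact mem_hSub.2 ⟨y, by rw [hy, pow_one]⟩

-- The last `m` letters of a long word produce a factor `h`, and the remaining letters act on the
-- quotient. As there are finitely many words of length `m`, the bounds for these quotients are
-- uniform.
omit [CharZero k] in
include b in
theorem exists_forall_dvd (n : ℕ) (x : H) : ∃ m, ∀ w : List (Fin d), m ≤ w.length →
    (PowerSeries.X : k⟦X⟧) ^ n ∣ T.wordCoord hp.topFree t w x := by
  induction n generalizing x with
  | zero => exact ⟨0, fun w _ => by simp⟩
  | succ n ih =>
    obtain ⟨m, hm⟩ := hp.exists_wordOp_mem b ht h1 x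
    have hm' : ∀ w : List (Fin d), ∃ y, m ≤ w.length →
        T.wordOp hp.topFree t w x = (PowerSeries.X : k⟦X⟧) • y := fun w => by
      by_cases hw : m ≤ w.length
      · obtain ⟨y, hy⟩ := mem_hSub.1 (hm w hw)
        exact ⟨y, fun _ => by rw [hy, pow_one]⟩
      · exact ⟨0, fun h => absurd h hw⟩
    choose y hy using hm'
    choose M hM using ih
    have hfin : {w : List (Fin d) | w.length = m}.Finite := List.finite_length_eq (Fin d) m
    obtain ⟨N, hN⟩ := (hfin.image fun w => M (y w)).bddAbove
    refine ⟨N + m, fun w hw => ?_⟩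
    have hl : (w.drop (w.length - m)).length = m := by rw [List.length_drop]; omega
    rw [← List.take_append_drop (w.length - m) w, TopHopf.wordCoord_append, hy _ hl.ge, map_smul,
      smul_eq_mul, pow_succ']
    refine mul_dvd_mul_left _ (hM _ _ ?_)
    refine (hN ⟨_, hl, rfl⟩).trans ?_
    rw [List.length_take]
    omega

include h2

/-- If `x = h^n y` and all coordinates of `x` are divisible by `h^(n+1)`, then every functional
`coef` vanishes on `p y`; these functionals separate points of `U(g)`. -/
theorem mem_hSub_of_forall_dvd (n : ℕ) (x : H)
    (h : ∀ e, (PowerSeries.X : k⟦X⟧) ^ n ∣ T.wordCoord hp.topFree t (sortedWord e) x) :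
    x ∈ hSub k H n := by
  induction n with
  | zero => exact hSub_zero x
  | succ n ih =>
    obtain ⟨y, rfl⟩ := mem_hSub.1 (ih fun e => (pow_dvd_pow _ (Nat.le_succ n)).trans (h e))
    have : p y = 0 := by
      refine Env.eq_zero_of_coef b τ h1 h2 fun e => ?_
      rw [← hp.lifts_wordCoord ht, ← PowerSeries.X_dvd_iff, ← pow_one PowerSeries.X]
      refine X_pow_dvd_cancel (m := n) ?_
      have := h e
      rwa [map_smul, smul_eq_mul] at this
    obtain ⟨z, rfl⟩ := (hp.ker _).1 this
    rw [smul_smul, ← pow_succ]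
    exact pow_smul_mem_hSub _ _

/-- The coordinate map `Θ` from `H` to the module `N` of families tending to `0` is onto modulo `h`
by `Env.exists_coef_eq`. It is then onto, since `H` is complete and `N` is separated. -/
theorem exists_wordCoord_eq (c : (Fin d → ℕ) → k⟦X⟧)
    (hc : ∀ n, ∃ m, ∀ e, m ≤ ∑ i, e i → (PowerSeries.X : k⟦X⟧) ^ n ∣ c e) :
    ∃ x, ∀ e, T.wordCoord hp.topFree t (sortedWord e) x = c e := by
  let N : Submodule k⟦X⟧ ((Fin d → ℕ) → k⟦X⟧) :=
    { carrier := {c | ∀ n, ∃ m, ∀ e, m ≤ ∑ i, e i → (PowerSeries.X : k⟦X⟧) ^ n ∣ c e}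
      add_mem' := fun {c c'} hc hc' n => by
        obtain ⟨m, hm⟩ := hc n
        obtain ⟨m', hm'⟩ := hc' n
        exact ⟨max m m', fun e he => dvd_add (hm e ((le_max_left _ _).trans he))
          (hm' e ((le_max_right _ _).trans he))⟩
      zero_mem' := fun n => ⟨0, fun e _ => dvd_zero _⟩
      smul_mem' := fun r c hc n => by
        obtain ⟨m, hm⟩ := hc n
        exact ⟨m, fun e he => Dvd.dvd.mul_left (hm e he) r⟩ }
  let Θ : H →ₗ[k⟦X⟧] N :=
    { toFun := fun x => ⟨fun e => T.wordCoord hp.topFree t (sortedWord e) x, fun n => by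
        obtain ⟨m, hm⟩ := hp.exists_forall_dvd b ht h1 n x
        exact ⟨m, fun e he => hm _ (by rwa [sortedWord_length])⟩⟩
      map_add' := fun x y => Subtype.ext (funext fun e => map_add _ x y)
      map_smul' := fun r x => Subtype.ext (funext fun e => map_smul _ r x) }
  have hN : IsHausdorff (Ideal.span {(PowerSeries.X : k⟦X⟧)}) N := ⟨fun c hc => by
    refine Subtype.ext (funext fun e => eq_zero_of_forall_dvd fun n => ?_)
    have := hc n
    rw [SModEq.zero] at this
    obtain ⟨c', rfl⟩ := mem_hSub.1 this
    exact ⟨_, rfl⟩⟩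
  have := hp.topFree.complete
  suffices hs : Function.Surjective Θ by
    obtain ⟨x, hx⟩ := hs ⟨c, hc⟩
    exact ⟨x, fun e => congrFun (congrArg Subtype.val hx) e⟩
  refine surjective_of_mkQ_comp_surjective (I := Ideal.span {(PowerSeries.X : k⟦X⟧)}) ?_
  intro q
  obtain ⟨c, rfl⟩ := Submodule.mkQ_surjective _ q
  obtain ⟨m, hm⟩ := c.2 1
  obtain ⟨u, hu, hu'⟩ := Env.exists_coef_eq b τ h1 h2 m fun e => PowerSeries.constantCoeff (c.1 e)
  obtain ⟨x, rfl⟩ := hp.surjective u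
  refine ⟨x, ?_⟩
  have hd : ∀ e, (PowerSeries.X : k⟦X⟧) ∣ T.wordCoord hp.topFree t (sortedWord e) x - c.1 e := by
    intro e
    rw [PowerSeries.X_dvd_iff, map_sub, hp.lifts_wordCoord ht, sub_eq_zero]
    by_cases he : ∑ i, e i < m
    · exact hu' e he
    · rw [Env.coef_eq_zero b τ h1 _ (by rw [sortedWord_length]; exact not_lt.1 he) hu]
      have := hm e (not_lt.1 he)
      rw [pow_one, PowerSeries.X_dvd_iff] at this
      exact this.symm
  choose c' hc' using hd
  -- Division by `h` stays inside `N`: the convergence condition is only shifted by one power.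
  have hc'N : c' ∈ N := fun n => by
    obtain ⟨m, hm⟩ := (Θ x - c).2 (1 + n)
    refine ⟨m, fun e he => X_pow_dvd_cancel (m := 1) ?_⟩
    rw [pow_one, ← hc' e]
    exact hm e he
  rw [LinearMap.comp_apply, ← sub_eq_zero, ← map_sub, ← LinearMap.mem_ker, Submodule.ker_mkQ]
  have : Θ x - c = (PowerSeries.X : k⟦X⟧) • (⟨c', hc'N⟩ : N) :=
    Subtype.ext (funext fun e => hc' e)
  rw [this]
  exact Submodule.smul_mem_smul (Ideal.mem_span_singleton_self _) trivial

omit ht h1 h2 in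
/-- A quantised universal enveloping algebra has coordinates lifting those of `U(g)`. -/
theorem exists_coords : ∃ (τ : Fin d → Module.Dual k (UniversalEnvelopingAlgebra k g))
    (C : T.Coords hp.topFree d), (∀ i, τ i 1 = 0) ∧
    (∀ i j, τ i (UniversalEnvelopingAlgebra.ι k (b j)) = if j = i then 1 else 0) ∧
    ∀ i, Lifts p (C.t i) (τ i) := by
  obtain ⟨τ, h1, h2⟩ := PBW.exists_coordinates b
  choose f hf using fun i => exists_lift_functional hp.topFree.torsionless p hp.surjective hp.ker
    (τ i)
  -- Subtracting a multiple of the counit gives `t i 1 = 0`; the reduction is unchanged because `τ i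
  -- 1 = 0`.
  let t : Fin d → H →ₗ[k⟦X⟧] k⟦X⟧ := fun i => f i - f i 1 • T.counit.toLinearMap
  have t_one : ∀ i, t i 1 = 0 := fun i => by simp [t]
  have ht : ∀ i, Lifts p (t i) (τ i) := fun i x => by
    simp [t, hf, hp.map_one, h1]
  refine ⟨τ, ⟨t, t_one, hp.mem_hSub_of_forall_dvd b ht h1 h2, hp.exists_forall_dvd b ht h1,
    hp.exists_wordCoord_eq b ht h1 h2, fun i j => ?_⟩, h1, h2, ht⟩
  obtain ⟨c, hc⟩ := exists_eq_X_smul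
    (t i ∘ₗ T.slice hp.topFree (t j) - t j ∘ₗ T.slice hp.topFree (t i)) fun x => by
      obtain ⟨r, hr, -⟩ := hp.commutator (ht i) (ht j) x
      exact ⟨r, hr⟩
  refine ⟨c, ?_, fun x => ?_⟩
  · have := hc 1
    rw [LinearMap.sub_apply, LinearMap.comp_apply, LinearMap.comp_apply, TopHopf.slice_one,
      TopHopf.slice_one, map_smul, map_smul, t_one, t_one, smul_zero, sub_zero] at this
    exact (mul_eq_zero.1 this.symm).resolve_left PowerSeries.X_ne_zero
  · have hc' : t i ∘ₗ T.slice hp.topFree (t j) - t j ∘ₗ T.slice hp.topFree (t i) =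
        (PowerSeries.X : k⟦X⟧) • c := LinearMap.ext hc
    have := LinearMap.congr_fun (congrArg (T.slice hp.topFree) hc') x
    rw [T.slice_sub, T.slice_smul, T.slice_comp_slice, T.slice_comp_slice] at this
    rw [← sub_eq_iff_eq_add']
    exact this

end IsQUEA

end Existence

end

noncomputable section

/-! ## Expansions in coordinates -/

namespace TopHopf.Coords

variable {k H : Type*} [Field k] [Ring H] [Algebra k⟦X⟧ H] [TopologicalSpace H]
  {T : TopHopf k⟦X⟧ H} {hH : IsTopFree k H} {d : ℕ} (C : T.Coords hH d)

/-- The composite of slices along the ordered word of `e`. -/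
def op (e : Fin d → ℕ) : Module.End k⟦X⟧ H := T.wordOp hH C.t (sortedWord e)

/-- The coordinate function of index `e`. -/
def coord (e : Fin d → ℕ) : H →ₗ[k⟦X⟧] k⟦X⟧ := T.wordCoord hH C.t (sortedWord e)

theorem slice_coord (e : Fin d → ℕ) : T.slice hH (C.coord e) = C.op e :=
  T.slice_wordCoord hH C.t _

theorem exists_basis (f : Fin d → ℕ) : ∃ x, ∀ e, C.coord e x = if e = f then 1 else 0 :=
  C.exists_of _ fun n => ⟨∑ i, f i + 1, fun e he => by
    rw [if_neg]
    · exact dvd_zero _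
    · rintro rfl
      omega⟩

/-- The topological basis dual to the coordinate functions. -/
def y (f : Fin d → ℕ) : H := (C.exists_basis f).choose

theorem coord_y (e f : Fin d → ℕ) : C.coord e (C.y f) = if e = f then 1 else 0 :=
  (C.exists_basis f).choose_spec e

theorem ext {x x' : H} (h : ∀ e, C.coord e x = C.coord e x') : x = x' :=
  hH.eq_of_forall_sub_mem fun n => C.detect n _ fun e => by
    have := h e
    rw [coord] at this
    rw [map_sub, this, sub_self]
    exact dvd_zero _

theorem wordOp_one (w : List (Fin d)) : T.wordOp hH C.t w 1 = if w = [] then 1 else 0 := by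
  induction w with
  | nil => rfl
  | cons i w ih =>
    rw [TopHopf.wordOp_cons, ih, if_neg (List.cons_ne_nil _ _)]
    split_ifs
    · rw [TopHopf.slice_one, C.t_one, zero_smul]
    · rw [map_zero]

theorem sortedWord_eq_nil {e : Fin d → ℕ} : sortedWord e = [] ↔ e = 0 := by
  refine ⟨fun h => ?_, fun h => by rw [h, sortedWord_zero]⟩
  refine sortedWord_perm ?_
  rw [h, sortedWord_zero]

theorem coord_one (e : Fin d → ℕ) : C.coord e 1 = if e = 0 then 1 else 0 := by
  rw [coord, wordCoord_apply, wordOp_one]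
  simp only [sortedWord_eq_nil]
  split_ifs
  · exact _root_.map_one _
  · exact map_zero _

theorem y_zero : C.y 0 = 1 := C.ext fun e => by rw [coord_y, coord_one]

theorem op_zero (x : H) : C.op 0 x = x := by rw [op, sortedWord_zero, wordOp_nil]

theorem coord_zero (x : H) : C.coord 0 x = T.counit x := by
  rw [coord, sortedWord_zero, wordCoord_nil]

theorem coord_sum (s : Finset (Fin d → ℕ)) (c : (Fin d → ℕ) → k⟦X⟧) (f : Fin d → ℕ) :
    C.coord f (∑ e ∈ s, c e • C.y e) = if f ∈ s then c f else 0 := by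
  rw [map_sum, ← Finset.sum_ite_eq s f c]
  refine Finset.sum_congr rfl fun e _ => ?_
  rw [map_smul, coord_y, smul_eq_mul, mul_ite, mul_one, mul_zero]

theorem sub_sum_mem {n m : ℕ} {x : H}
    (h : ∀ e : Fin d → ℕ, m ≤ ∑ i, e i → (PowerSeries.X : k⟦X⟧) ^ n ∣ C.coord e x) :
    x - ∑ e ∈ lowDegree d m, C.coord e x • C.y e ∈ hSub k H n := by
  refine C.detect n _ fun f => ?_
  change _ ∣ C.coord f _
  rw [map_sub, coord_sum]
  split_ifs with hf
  · rw [sub_self]; exact dvd_zero _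
  · rw [sub_zero]
    rw [mem_lowDegree, not_lt] at hf
    exact h f hf

theorem eventually_sub_sum_mem (n : ℕ) (x : H) :
    ∀ᶠ m in atTop, x - ∑ e ∈ lowDegree d m, C.coord e x • C.y e ∈ hSub k H n := by
  obtain ⟨m₀, h⟩ := C.conilpotent n x
  filter_upwards [eventually_ge_atTop m₀] with m hm
  exact C.sub_sum_mem fun e he => h _ (by rw [sortedWord_length]; omega)

theorem eventually_tensorMk (n : ℕ) (t : H ⊗[k⟦X⟧] H) : ∀ᶠ m in atTop,
    tensorMk (hH.hOpen n) t = tensorMk (hH.hOpen n)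
      (∑ e ∈ lowDegree d m, rightSlice k⟦X⟧ (C.coord e) t ⊗ₜ C.y e) := by
  induction t with
  | zero => simp
  | tmul a c =>
    filter_upwards [C.eventually_sub_sum_mem n c] with m hm
    simp only [rightSlice_tmul, TensorProduct.smul_tmul]
    rw [← TensorProduct.tmul_sum, tensorMk, TensorProduct.map_tmul, TensorProduct.map_tmul]
    congr 1
    rw [← sub_eq_zero, ← map_sub, ← LinearMap.mem_ker, Submodule.ker_mkQ]
    exact hm
  | add s t hs ht =>
    filter_upwards [hs, ht] with m hs ht
    simp only [map_add, TensorProduct.add_tmul, Finset.sum_add_distrib] at *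
    rw [hs, ht]

/-- The truncated expansion `∑ D^e x ⊗ y_e` of `Δ x`. -/
def expansion (m : ℕ) (x : H) : H ⊗[k⟦X⟧] H := ∑ e ∈ lowDegree d m, C.op e x ⊗ₜ C.y e

theorem tensorMk_slice_tmul {n : ℕ} {x : H} {t : H ⊗[k⟦X⟧] H}
    (ht : tensorMk (hH.hOpen n) t = CTensor.proj (hH.hOpen n) (T.comul x)) (e : Fin d → ℕ)
    (c : H) : tensorMk (hH.hOpen n) (C.op e x ⊗ₜ c) =
      tensorMk (hH.hOpen n) (rightSlice k⟦X⟧ (C.coord e) t ⊗ₜ c) := by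
  rw [tensorMk, TensorProduct.map_tmul, TensorProduct.map_tmul]
  congr 1
  rw [← sub_eq_zero, ← map_sub, ← LinearMap.mem_ker, Submodule.ker_mkQ, ← slice_coord]
  exact T.slice_sub_mem hH _ ht

/-- Expand the second tensor factor of `Δ x` in the basis `y_e`: the first factor at `y_e` is the
slice of `x` by `coord e`, which is `op e x`. -/
theorem tendsto_expansion (x : H) :
    Tendsto (fun m => C.expansion m x) atTop (CTensor.approx (T.comul x)) := by
  intro s hs
  obtain ⟨U, hU⟩ := CTensor.eventually_approx.1 hs
  obtain ⟨n, hn⟩ := hH.exists_hSub_le U.2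
  obtain ⟨t, ht⟩ := CTensor.exists_approx (T.comul x) (hH.hOpen n)
  rw [mem_map]
  filter_upwards [C.eventually_tensorMk n t] with m hm
  refine hU _ (CTensor.approx_of_le (U := hH.hOpen n) hn ?_)
  rw [← ht, hm]
  simp only [expansion, map_sum]
  exact Finset.sum_congr rfl fun e _ => C.tensorMk_slice_tmul ht e _

theorem eventually_slice_sub (f : H →ₗ[k⟦X⟧] k⟦X⟧) (n : ℕ) (x : H) : ∀ᶠ m in atTop,
    T.slice hH f x - ∑ e ∈ lowDegree d m, f (C.y e) • C.op e x ∈ hSub k H n := by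
  filter_upwards [(C.tendsto_expansion x).eventually (T.eventually_slice hH f n x)] with m hm
  rw [expansion, map_sum] at hm
  simpa only [rightSlice_tmul] using hm

/-! ## The subalgebra of elements with coordinates in `h^|e|` -/

/-- The elements whose coordinate of index `e` is divisible by `h^|e|`. -/
def divided : Submodule k⟦X⟧ H where
  carrier := {a | ∀ e, (PowerSeries.X : k⟦X⟧) ^ (∑ i, e i) ∣ C.coord e a}
  add_mem' ha hb e := by rw [map_add]; exact dvd_add (ha e) (hb e)
  zero_mem' e := by rw [map_zero]; exact dvd_zero _
  smul_mem' r a ha e := by rw [map_smul]; exact Dvd.dvd.mul_left (ha e) r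

variable {C}

/-- The exchange replaces the letters `i j` by `h` times `slice c`, and `slice c` is the series `∑
c(y_e) D^e`. Since `c 1 = 0`, every surviving word is nonempty: two letters are lost, one is
regained, and the factor `h` makes up for the other. -/
theorem dvd_swap {a : H} {M : ℕ}
    (ih : ∀ w, (PowerSeries.X : k⟦X⟧) ^ min w.length M ∣ T.wordCoord hH C.t w a)
    (u l : List (Fin d)) (i j : Fin d) :
    (PowerSeries.X : k⟦X⟧) ^ min (u.length + l.length + 2) (M + 1) ∣
      T.wordCoord hH C.t (u ++ i :: j :: l) a - T.wordCoord hH C.t (u ++ j :: i :: l) a := by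
  obtain ⟨c, hc1, hc⟩ := C.comm i j
  set z := T.wordOp hH C.t l a
  have e1 : T.wordCoord hH C.t (u ++ i :: j :: l) a - T.wordCoord hH C.t (u ++ j :: i :: l) a =
      PowerSeries.X * T.wordCoord hH C.t u (T.slice hH c z) := by
    rw [wordCoord_append, wordCoord_append, wordOp_cons, wordOp_cons, wordOp_cons, wordOp_cons,
      hc, map_add, add_sub_cancel_left, map_smul, smul_eq_mul]
  obtain ⟨m, hm⟩ := (C.eventually_slice_sub c (M + 1) z).exists
  have h1 := mem_hSub_self.1 (map_mem_hSub (T.wordCoord hH C.t u) hm)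
  have e2 : min (u.length + l.length + 2) (M + 1) = 1 + min (u.length + l.length + 1) M := by omega
  rw [e1, e2, pow_add, pow_one]
  refine mul_dvd_mul_left _ ?_
  rw [map_sub] at h1
  rw [← dvd_sub_right (a := (PowerSeries.X : k⟦X⟧) ^ min (u.length + l.length + 1) M)
    (b := T.wordCoord hH C.t u (∑ e ∈ lowDegree d m, c (C.y e) • C.op e z))]
  · rw [dvd_sub_comm]
    exact (pow_dvd_pow _ (by omega)).trans h1
  rw [map_sum]
  refine Finset.dvd_sum fun e _ => ?_
  rw [map_smul, smul_eq_mul]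
  by_cases he : e = 0
  · rw [he, y_zero, hc1, zero_mul]; exact dvd_zero _
  · refine Dvd.dvd.mul_left ?_ _
    rw [op, ← wordCoord_append, ← wordCoord_append]
    refine (pow_dvd_pow _ ?_).trans (ih _)
    have : 0 < (sortedWord e).length := List.length_pos_of_ne_nil (mt sortedWord_eq_nil.1 he)
    simp only [List.length_append]
    omega

/-- The prefix `u` is carried along so that the `cons` case of the induction on permutations can be
absorbed into it. -/
theorem dvd_perm {a : H} {M : ℕ}
    (ih : ∀ w, (PowerSeries.X : k⟦X⟧) ^ min w.length M ∣ T.wordCoord hH C.t w a)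
    {w w' : List (Fin d)} (hw : w.Perm w') : ∀ u : List (Fin d),
    (PowerSeries.X : k⟦X⟧) ^ min (u.length + w.length) (M + 1) ∣
      T.wordCoord hH C.t (u ++ w) a - T.wordCoord hH C.t (u ++ w') a := by
  induction hw with
  | nil => intro u; rw [sub_self]; exact dvd_zero _
  | cons x _ h =>
    intro u
    have := h (u ++ [x])
    simp only [List.append_assoc, List.singleton_append, List.length_append,
      List.length_singleton] at this
    rw [List.length_cons]
    convert this using 2
    omega
  | swap x y l =>
    intro u
    exact dvd_swap ih u l y x
  | trans h _ h1 h2 =>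
    intro u
    rw [← sub_add_sub_cancel]
    refine dvd_add (h1 u) ?_
    rw [h.length_eq]
    exact h2 u

/-- Induction on the precision `M`. If all words satisfy the divisibility up to `h^M`, sorting a
word changes its coordinate only by a multiple of `h^min(|w|, M+1)`, and sorted words satisfy it by
the definition of `divided`. -/
theorem dvd_wordCoord {a : H} (ha : a ∈ C.divided) (w : List (Fin d)) :
    (PowerSeries.X : k⟦X⟧) ^ w.length ∣ T.wordCoord hH C.t w a := by
  have key : ∀ M w, (PowerSeries.X : k⟦X⟧) ^ min w.length M ∣ T.wordCoord hH C.t w a := by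
    intro M
    induction M with
    | zero => intro w; simp
    | succ M ih =>
      intro w
      have h := dvd_perm ih (perm_sortedWord w) []
      rw [List.nil_append, List.nil_append, List.length_nil, zero_add] at h
      rw [dvd_sub_comm] at h
      rw [← dvd_sub_right (a := (PowerSeries.X : k⟦X⟧) ^ min w.length (M + 1)) (c := _) ?_]
      · exact h
      · refine (pow_dvd_pow _ ?_).trans (ha _)
        rw [← sortedWord_length, ← (perm_sortedWord w).length_eq]
        exact min_le_left _ _
  simpa using key w.length w

theorem smul_mem_divided_iff {n : ℕ} {a : H}
    (h : ∀ e, (PowerSeries.X : k⟦X⟧) ^ (n + ∑ i, e i) ∣ C.coord e a) :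
    ∃ a' ∈ C.divided, a = (PowerSeries.X : k⟦X⟧) ^ n • a' := by
  obtain ⟨a', rfl⟩ := mem_hSub.1 (C.detect n a fun e =>
    (pow_dvd_pow _ (Nat.le_add_right _ _)).trans (h e))
  refine ⟨a', fun e => X_pow_dvd_cancel (m := n) ?_, rfl⟩
  have := h e
  rwa [map_smul, smul_eq_mul] at this

/-- Divisibility for the concatenation of an ordered word with the arbitrary word `w` is what
permits division by `h^|w|` inside `divided`. -/
theorem exists_wordOp_eq {a : H} (ha : a ∈ C.divided) (w : List (Fin d)) :
    ∃ a' ∈ C.divided, T.wordOp hH C.t w a = (PowerSeries.X : k⟦X⟧) ^ w.length • a' := by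
  refine smul_mem_divided_iff fun e => ?_
  have := dvd_wordCoord ha (sortedWord e ++ w)
  rwa [wordCoord_append, List.length_append, sortedWord_length, add_comm] at this

theorem exists_op_eq {a : H} (ha : a ∈ C.divided) (e : Fin d → ℕ) :
    ∃ a' ∈ C.divided, C.op e a = (PowerSeries.X : k⟦X⟧) ^ (∑ i, e i) • a' := by
  rw [← sortedWord_length]
  exact exists_wordOp_eq ha _

theorem one_mem_divided : (1 : H) ∈ C.divided := fun e => by
  rw [coord_one]
  split_ifs with h
  · simp [h]
  · exact dvd_zero _

theorem pow_smul_y_mem (e : Fin d → ℕ) :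
    (PowerSeries.X : k⟦X⟧) ^ (∑ i, e i) • C.y e ∈ C.divided := fun f => by
  rw [map_smul, coord_y, smul_eq_mul]
  split_ifs with h
  · rw [h, mul_one]
  · rw [mul_zero]; exact dvd_zero _

theorem mem_divided_of_forall {x : H} (h : ∀ n, ∃ a ∈ C.divided, x - a ∈ hSub k H n) :
    x ∈ C.divided := fun e => by
  obtain ⟨a, ha, hx⟩ := h (∑ i, e i)
  have := dvd_add (mem_hSub_self.1 (map_mem_hSub (C.coord e) hx)) (ha e)
  rwa [map_sub, sub_add_cancel] at this

theorem sum_pos_of_ne_zero {e : Fin d → ℕ} (he : e ≠ 0) : 1 ≤ ∑ i, e i := by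
  rw [← sortedWord_length]
  exact List.length_pos_of_ne_nil (mt sortedWord_eq_nil.1 he)

theorem eventually_slice_mul (f : H →ₗ[k⟦X⟧] k⟦X⟧) (n : ℕ) (x x' : H) : ∀ᶠ m in atTop,
    T.slice hH f (x * x') - ∑ e ∈ lowDegree d m, ∑ e' ∈ lowDegree d m,
      f (C.y e * C.y e') • (C.op e x * C.op e' x') ∈ hSub k H n := by
  filter_upwards [((C.tendsto_expansion x).prodMk (C.tendsto_expansion x')).eventually
    (T.comul_mul x x' (hH.hOpen n))] with m hm
  have := T.slice_sub_mem hH f hm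
  rw [expansion, expansion, Finset.sum_mul_sum, map_sum] at this
  simpa only [map_sum, Algebra.TensorProduct.tmul_mul_tmul, rightSlice_tmul] using this

/-- Slicing a product by `t i` gives `∑ t i (y_e y_e') D^e a · D^e' a'`. The term with `e = e' = 0`
vanishes as `t i 1 = 0`; every other term is a multiple of `h` times a product of two elements of
`divided`. Induction on the word then applies. -/
theorem mul_mem_divided {a a' : H} (ha : a ∈ C.divided) (ha' : a' ∈ C.divided) :
    a * a' ∈ C.divided := by
  suffices h : ∀ (w : List (Fin d)) (a a' : H), a ∈ C.divided → a' ∈ C.divided →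
      (PowerSeries.X : k⟦X⟧) ^ w.length ∣ T.wordCoord hH C.t w (a * a') by
    intro e
    rw [← sortedWord_length]
    exact h _ _ _ ha ha'
  intro w
  induction w using List.reverseRecOn with
  | nil => intro a a' _ _; simp
  | append_singleton w i ih =>
    intro a a' ha ha'
    obtain ⟨m, hm⟩ := (eventually_slice_mul (C := C) (C.t i) (w ++ [i]).length a a').exists
    have h1 := mem_hSub_self.1 (map_mem_hSub (T.wordCoord hH C.t w) hm)
    rw [map_sub] at h1
    rw [wordCoord_append, wordOp_singleton, ← dvd_sub_right
      (a := (PowerSeries.X : k⟦X⟧) ^ (w ++ [i]).length) (c := T.wordCoord hH C.t w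
        (T.slice hH (C.t i) (a * a'))) (b := T.wordCoord hH C.t w (∑ e ∈ lowDegree d m,
          ∑ e' ∈ lowDegree d m, C.t i (C.y e * C.y e') • (C.op e a * C.op e' a')))]
    · rw [dvd_sub_comm]
      exact h1
    simp only [map_sum]
    refine Finset.dvd_sum fun e _ => Finset.dvd_sum fun e' _ => ?_
    obtain ⟨c, hc, hc'⟩ := exists_op_eq ha e
    obtain ⟨c', hc1, hc1'⟩ := exists_op_eq ha' e'
    rw [hc', hc1', smul_mul_smul_comm, ← pow_add, map_smul, map_smul, smul_eq_mul, smul_eq_mul]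
    by_cases h0 : e = 0 ∧ e' = 0
    · rw [h0.1, h0.2, y_zero, mul_one, C.t_one, zero_mul]
      exact dvd_zero _
    · refine Dvd.dvd.mul_left ?_ _
      rw [List.length_append, List.length_singleton, add_comm, pow_add]
      refine mul_dvd_mul (pow_dvd_pow _ ?_) (ih c c' hc hc1)
      rcases not_and_or.1 h0 with h | h
      · exact (sum_pos_of_ne_zero h).trans (Nat.le_add_right _ _)
      · exact (sum_pos_of_ne_zero h).trans (Nat.le_add_left _ _)

variable (C) in
/-- The subalgebra of elements whose coordinate of index `e` is divisible by `h^|e|`. -/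
def alg : Subalgebra k⟦X⟧ H :=
  C.divided.toSubalgebra one_mem_divided fun _ _ => mul_mem_divided

theorem mem_alg {a : H} : a ∈ C.alg ↔ a ∈ C.divided := Iff.rfl

/-- The antipode axiom gives `S a = ε(a) - ∑_{e ≠ 0} S(D^e a) y_e`. Since `D^e a` carries a factor
`h^|e|`, approximations of `S` on `divided` modulo `h^n` yield approximations modulo `h^(n+1)`, and
`divided` is closed. -/
theorem antipode_mem {a : H} (ha : a ∈ C.divided) : T.antipode a ∈ C.divided := by
  suffices h : ∀ n, ∀ a ∈ C.divided, ∃ c ∈ C.divided, T.antipode a - c ∈ hSub k H n from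
    mem_divided_of_forall fun n => h n a ha
  intro n
  induction n with
  | zero => exact fun a _ => ⟨0, zero_mem _, hSub_zero _⟩
  | succ n ih =>
    intro a ha
    have h1 := (C.tendsto_expansion a).eventually ((T.antipode_comul a).eventually
      (hH.mem_nhds.2 ⟨n + 1, fun y hy => hy⟩ :
        {y | y - algebraMap k⟦X⟧ H (T.counit a) ∈ hSub k H (n + 1)} ∈ _))
    obtain ⟨m, hm, hm0⟩ := (h1.and (eventually_gt_atTop 0)).exists
    have h0 : (0 : Fin d → ℕ) ∈ lowDegree d m := mem_lowDegree.2 (by simpa using hm0)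
    rw [expansion, map_sum, map_sum, ← Finset.add_sum_erase _ _ h0] at hm
    simp only [TensorProduct.map_tmul, LinearMap.mul'_apply, LinearMap.id_apply, op_zero,
      y_zero, mul_one] at hm
    have h2 : ∀ e ∈ (lowDegree d m).erase 0, ∃ c ∈ C.divided,
        T.antipode (C.op e a) * C.y e - c ∈ hSub k H (n + 1) := by
      intro e he
      obtain ⟨a', ha', h'⟩ := exists_op_eq ha e
      obtain ⟨c, hc, hc'⟩ := ih a' ha'
      -- The factor `h^|e|` of `D^e a` is moved to `y_e`, which puts both factors in `divided` and
      -- gains at least one power of `h`.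
      refine ⟨c * ((PowerSeries.X : k⟦X⟧) ^ (∑ i, e i) • C.y e),
        mul_mem_divided hc (pow_smul_y_mem e), ?_⟩
      rw [h', map_smul, smul_mul_assoc, ← mul_smul_comm, ← sub_mul]
      refine mul_mem_hSub hc' ?_
      exact hSub_anti (sum_pos_of_ne_zero (Finset.ne_of_mem_erase he)) (pow_smul_mem_hSub _ _)
    choose! c hc hc' using h2
    refine ⟨algebraMap k⟦X⟧ H (T.counit a) - ∑ e ∈ (lowDegree d m).erase 0, c e, ?_, ?_⟩
    · refine sub_mem ?_ (sum_mem hc)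
      rw [Algebra.algebraMap_eq_smul_one]
      exact Submodule.smul_mem _ _ one_mem_divided
    · have h3 := sub_mem hm (sum_mem hc')
      rw [Finset.sum_sub_distrib] at h3
      convert h3 using 1
      abel

end TopHopf.Coords

end

noncomputable section

namespace TopHopf.Coords

variable {k H : Type*} [Field k] [Ring H] [Algebra k⟦X⟧ H] [TopologicalSpace H]
  {T : TopHopf k⟦X⟧ H} {hH : IsTopFree k H} {d : ℕ} (C : T.Coords hH d)

/-! ## Divided coordinates -/

/-- The operator on `C.alg` obtained by dividing that of the word `w` by `h^|w|`. -/
def dword (w : List (Fin d)) : C.alg →ₗ[k⟦X⟧] C.alg where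
  toFun a := ⟨(exists_wordOp_eq (mem_alg.1 a.2) w).choose,
    (exists_wordOp_eq (mem_alg.1 a.2) w).choose_spec.1⟩
  map_add' a b := Subtype.ext (hH.pow_smul_cancel (n := w.length) (by
    rw [← (exists_wordOp_eq (mem_alg.1 (a + b).2) w).choose_spec.2, Subalgebra.coe_add,
      Subalgebra.coe_add, map_add, smul_add,
      ← (exists_wordOp_eq (mem_alg.1 a.2) w).choose_spec.2,
      ← (exists_wordOp_eq (mem_alg.1 b.2) w).choose_spec.2]))
  map_smul' r a := Subtype.ext (hH.pow_smul_cancel (n := w.length) (by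
    rw [← (exists_wordOp_eq (mem_alg.1 (r • a).2) w).choose_spec.2, Subalgebra.coe_smul,
      Subalgebra.coe_smul, map_smul, smul_comm, RingHom.id_apply,
      ← (exists_wordOp_eq (mem_alg.1 a.2) w).choose_spec.2]))

theorem pow_smul_dword (w : List (Fin d)) (a : C.alg) :
    (PowerSeries.X : k⟦X⟧) ^ w.length • (C.dword w a : H) = T.wordOp hH C.t w a :=
  (exists_wordOp_eq (mem_alg.1 a.2) w).choose_spec.2.symm

theorem dword_append (w v : List (Fin d)) (a : C.alg) :
    C.dword (w ++ v) a = C.dword w (C.dword v a) :=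
  Subtype.ext (hH.pow_smul_cancel (n := (w ++ v).length) (by
    rw [pow_smul_dword, wordOp_append, ← pow_smul_dword C v, map_smul, ← pow_smul_dword C w,
      smul_smul, ← pow_add, List.length_append, add_comm]))

theorem dword_nil (a : C.alg) : C.dword [] a = a :=
  Subtype.ext (by
    have := C.pow_smul_dword [] a
    rwa [List.length_nil, pow_zero, one_smul] at this)

/-- The operator on `C.alg` obtained by dividing `C.op e` by `h^|e|`. -/
def dop (e : Fin d → ℕ) : C.alg →ₗ[k⟦X⟧] C.alg := C.dword (sortedWord e)

theorem pow_smul_dop (e : Fin d → ℕ) (a : C.alg) :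
    (PowerSeries.X : k⟦X⟧) ^ (∑ i, e i) • (C.dop e a : H) = C.op e a := by
  rw [← sortedWord_length]
  exact C.pow_smul_dword _ a

theorem dop_zero (a : C.alg) : C.dop 0 a = a := by rw [dop, sortedWord_zero, dword_nil]

/-- The counit of `C.alg`. -/
def algCounit : C.alg →ₐ[k⟦X⟧] k⟦X⟧ := T.counit.comp C.alg.val

theorem algCounit_apply (a : C.alg) : C.algCounit a = T.counit (a : H) := rfl

/-- The coordinate of index `e` divided by `h^|e|`. -/
def dcoord (e : Fin d → ℕ) : C.alg →ₗ[k⟦X⟧] k⟦X⟧ := C.algCounit.toLinearMap ∘ₗ C.dop e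

theorem dcoord_apply (e : Fin d → ℕ) (a : C.alg) : C.dcoord e a = T.counit (C.dop e a : H) := rfl

theorem pow_mul_dcoord (e : Fin d → ℕ) (a : C.alg) :
    (PowerSeries.X : k⟦X⟧) ^ (∑ i, e i) * C.dcoord e a = C.coord e a := by
  rw [dcoord_apply, ← smul_eq_mul, ← map_smul, pow_smul_dop]
  rfl

/-- The element `h^|e| y_e` of `C.alg`. -/
def dy (e : Fin d → ℕ) : C.alg := ⟨_, pow_smul_y_mem (C := C) e⟩

theorem coe_dy (e : Fin d → ℕ) : (C.dy e : H) = (PowerSeries.X : k⟦X⟧) ^ (∑ i, e i) • C.y e := rfl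

theorem dy_zero : C.dy 0 = 1 := Subtype.ext (by rw [coe_dy, y_zero]; simp)

theorem dcoord_dy (e f : Fin d → ℕ) : C.dcoord e (C.dy f) = if e = f then 1 else 0 := by
  apply mul_left_cancel₀ (pow_ne_zero (∑ i, e i) (PowerSeries.X_ne_zero (R := k)))
  rw [pow_mul_dcoord, coe_dy, map_smul, coord_y, smul_eq_mul]
  split_ifs with h
  · rw [h]
  · rw [mul_zero, mul_zero]

theorem exists_smul_eq {n : ℕ} {a : C.alg}
    (h : ∀ e, (PowerSeries.X : k⟦X⟧) ^ n ∣ C.dcoord e a) :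
    ∃ a' : C.alg, a = (PowerSeries.X : k⟦X⟧) ^ n • a' := by
  obtain ⟨a', ha', h'⟩ := smul_mem_divided_iff (C := C) (n := n) (a := a) fun e => by
    rw [← pow_mul_dcoord, add_comm, pow_add]
    exact mul_dvd_mul_left _ (h e)
  exact ⟨⟨a', ha'⟩, Subtype.ext h'⟩

theorem alg_ext {a b : C.alg} (h : ∀ e, C.dcoord e a = C.dcoord e b) : a = b :=
  Subtype.ext (C.ext fun e => by rw [← pow_mul_dcoord, ← pow_mul_dcoord, h])

theorem exists_dcoord_eq (c : (Fin d → ℕ) → k⟦X⟧) : ∃ a, ∀ e, C.dcoord e a = c e := by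
  obtain ⟨x, hx⟩ := C.exists_of (fun e => PowerSeries.X ^ (∑ i, e i) * c e) fun n =>
    ⟨n, fun e he => (pow_dvd_pow _ he).trans (dvd_mul_right _ _)⟩
  refine ⟨⟨x, fun e => Dvd.intro _ (hx e).symm⟩, fun e => ?_⟩
  apply mul_left_cancel₀ (pow_ne_zero (∑ i, e i) (PowerSeries.X_ne_zero (R := k)))
  rw [pow_mul_dcoord]
  exact hx e

/-- The submodules `C.alg ∩ h^n H`. -/
def algSub (n : ℕ) : Submodule k⟦X⟧ C.alg := (hSub k H n).comap C.alg.val.toLinearMap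

theorem mem_algSub {n : ℕ} {a : C.alg} : a ∈ C.algSub n ↔ (a : H) ∈ hSub k H n := Iff.rfl

theorem algSub_anti {m n : ℕ} (h : m ≤ n) : C.algSub n ≤ C.algSub m := fun _ ha => hSub_anti h ha

/-- The condition is empty for `|e| ≥ n`. Only finitely many divided coordinates are constrained, so
the topology induced from `H` is a product topology. -/
theorem mem_algSub_iff {n : ℕ} {a : C.alg} : a ∈ C.algSub n ↔
    ∀ e, (PowerSeries.X : k⟦X⟧) ^ n ∣ PowerSeries.X ^ (∑ i, e i) * C.dcoord e a := by
  simp only [pow_mul_dcoord]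
  exact ⟨fun h e => mem_hSub_self.1 (map_mem_hSub _ h), fun h => C.detect n _ h⟩

theorem isOpen_alg_iff {s : Set C.alg} :
    IsOpen s ↔ ∀ a ∈ s, ∃ n, ∀ b : C.alg, b - a ∈ C.algSub n → b ∈ s := by
  simp only [isOpen_iff_mem_nhds, Topology.IsInducing.subtypeVal.nhds_eq_comap, mem_comap]
  refine forall₂_congr fun a _ => ⟨?_, ?_⟩
  · rintro ⟨v, hv, hvs⟩
    obtain ⟨n, hn⟩ := hH.mem_nhds.1 hv
    exact ⟨n, fun b hb => hvs (hn _ hb)⟩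
  · rintro ⟨n, hn⟩
    exact ⟨{y | y - (a : H) ∈ hSub k H n}, hH.mem_nhds.2 ⟨n, fun y hy => hy⟩, fun b hb => hn b hb⟩

theorem exists_algSub_le (U : OpenSub k⟦X⟧ C.alg) : ∃ n, C.algSub n ≤ U.1 := by
  obtain ⟨n, hn⟩ := C.isOpen_alg_iff.1 U.2 0 U.1.zero_mem
  exact ⟨n, fun a ha => hn a (by rwa [sub_zero])⟩

theorem isOpen_of_algSub_le {W : Submodule k⟦X⟧ C.alg} {n : ℕ} (h : C.algSub n ≤ W) :
    IsOpen (W : Set C.alg) :=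
  C.isOpen_alg_iff.2 fun a ha => ⟨n, fun b hb => by
    have := add_mem (h hb) (show a ∈ W from ha)
    rwa [sub_add_cancel] at this⟩

theorem dy_mem_algSub {n : ℕ} {e : Fin d → ℕ} (h : n ≤ ∑ i, e i) : C.dy e ∈ C.algSub n :=
  hSub_anti h (pow_smul_mem_hSub _ _)

theorem dop_mem_algSub {n m : ℕ} {e : Fin d → ℕ} (h : n + ∑ i, e i ≤ m) {a : C.alg}
    (ha : a ∈ C.algSub m) : C.dop e a ∈ C.algSub n := by
  rw [mem_algSub, ← hH.pow_smul_mem_hSub_iff (m := ∑ i, e i), pow_smul_dop, add_comm]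
  exact hSub_anti h (map_mem_hSub _ ha)

theorem alg_sub_sum_mem {n m : ℕ} (h : n ≤ m) (a : C.alg) :
    a - ∑ e ∈ lowDegree d m, C.dcoord e a • C.dy e ∈ C.algSub n := by
  refine C.algSub_anti h ?_
  have := C.sub_sum_mem (n := m) (m := m) (x := (a : H)) fun e he =>
    (pow_dvd_pow _ he).trans (a.2 e)
  rw [mem_algSub]
  convert this using 1
  rw [Subalgebra.coe_sub, AddSubmonoidClass.coe_finsetSum]
  congr 1
  refine Finset.sum_congr rfl fun e _ => ?_
  rw [Subalgebra.coe_smul, coe_dy, smul_smul, mul_comm, pow_mul_dcoord]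

/-! ## The coproduct of `C.alg` -/

/-- The truncated expansion of the coproduct of `C.alg`. -/
def algExpansion (m : ℕ) : C.alg →ₗ[k⟦X⟧] C.alg ⊗[k⟦X⟧] C.alg :=
  ∑ e ∈ lowDegree d m, (TensorProduct.mk k⟦X⟧ C.alg C.alg).flip (C.dy e) ∘ₗ C.dop e

theorem algExpansion_apply (m : ℕ) (a : C.alg) :
    C.algExpansion m a = ∑ e ∈ lowDegree d m, C.dop e a ⊗ₜ C.dy e := by
  simp [algExpansion]

theorem tensorMk_tmul_eq_zero_left {U : OpenSub k⟦X⟧ C.alg} {a b : C.alg} (ha : a ∈ U.1) :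
    tensorMk U (a ⊗ₜ b) = 0 := by
  rw [← Submodule.ker_mkQ U.1, LinearMap.mem_ker] at ha
  rw [tensorMk, TensorProduct.map_tmul, ha, TensorProduct.zero_tmul]

theorem tensorMk_tmul_eq_zero_right {U : OpenSub k⟦X⟧ C.alg} {a b : C.alg} (hb : b ∈ U.1) :
    tensorMk U (a ⊗ₜ b) = 0 := by
  rw [← Submodule.ker_mkQ U.1, LinearMap.mem_ker] at hb
  rw [tensorMk, TensorProduct.map_tmul, hb, TensorProduct.tmul_zero]

theorem lowDegree_subset {m n : ℕ} (h : m ≤ n) : lowDegree d m ⊆ lowDegree d n := fun e he => by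
  rw [mem_lowDegree] at *
  omega

/-- The sum defining the coproduct is finite modulo `U`, because `h^|e| y_e` lies in `U` for `|e| ≥
m`. -/
theorem tensorMk_algExpansion {U : OpenSub k⟦X⟧ C.alg} {m n : ℕ} (hmn : m ≤ n)
    (h : C.algSub m ≤ U.1) (a : C.alg) :
    tensorMk U (C.algExpansion n a) = tensorMk U (C.algExpansion m a) := by
  rw [algExpansion_apply, algExpansion_apply, map_sum, map_sum]
  refine (Finset.sum_subset (lowDegree_subset hmn) fun e _ he => ?_).symm
  rw [mem_lowDegree, not_lt] at he
  exact C.tensorMk_tmul_eq_zero_right (h (C.dy_mem_algSub he))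

/-- An integer `n` with `C.alg ∩ h^n H ⊆ U`. -/
def level (U : OpenSub k⟦X⟧ C.alg) : ℕ := (C.exists_algSub_le U).choose

theorem algSub_level (U : OpenSub k⟦X⟧ C.alg) : C.algSub (C.level U) ≤ U.1 :=
  (C.exists_algSub_le U).choose_spec

/-- The coproduct of `C.alg`. -/
def algComul : C.alg →ₗ[k⟦X⟧] CTensor k⟦X⟧ C.alg :=
  LinearMap.codRestrict _ (LinearMap.pi fun U => tensorMk U ∘ₗ C.algExpansion (C.level U))
    fun a U V hUV => by
      simp only [LinearMap.pi_apply, LinearMap.comp_apply]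
      rw [tensorMk_of_le,
        ← C.tensorMk_algExpansion (le_max_left (C.level U) (C.level V))
          ((C.algSub_level U).trans hUV),
        ← C.tensorMk_algExpansion (le_max_right (C.level U) (C.level V)) (C.algSub_level V)]

theorem proj_algComul (U : OpenSub k⟦X⟧ C.alg) {m : ℕ} (hm : C.level U ≤ m) (a : C.alg) :
    CTensor.proj U (C.algComul a) = tensorMk U (C.algExpansion m a) := by
  rw [C.tensorMk_algExpansion hm (C.algSub_level U)]
  rfl

theorem tendsto_algExpansion (a : C.alg) :
    Tendsto (fun m => C.algExpansion m a) atTop (CTensor.approx (C.algComul a)) := by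
  intro s hs
  obtain ⟨U, hU⟩ := CTensor.eventually_approx.1 hs
  rw [mem_map]
  filter_upwards [eventually_ge_atTop (C.level U)] with m hm
  exact hU _ (C.proj_algComul U hm a).symm

theorem map_val_algExpansion (m : ℕ) (a : C.alg) :
    TensorProduct.map C.alg.val.toLinearMap C.alg.val.toLinearMap (C.algExpansion m a) =
      C.expansion m (a : H) := by
  rw [algExpansion_apply, map_sum, expansion]
  refine Finset.sum_congr rfl fun e _ => ?_
  rw [TensorProduct.map_tmul, ← pow_smul_dop, TensorProduct.smul_tmul]
  rfl

theorem continuous_val_alg : Continuous C.alg.val := continuous_subtype_val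

theorem tensorMk_map_val {V : OpenSub k⟦X⟧ C.alg} {U : OpenSub k⟦X⟧ H}
    (hVU : ∀ a ∈ V.1, (a : H) ∈ U.1) {s t : C.alg ⊗[k⟦X⟧] C.alg}
    (h : tensorMk V s = tensorMk V t) :
    tensorMk U (TensorProduct.map C.alg.val.toLinearMap C.alg.val.toLinearMap s) =
      tensorMk U (TensorProduct.map C.alg.val.toLinearMap C.alg.val.toLinearMap t) := by
  rw [← sub_eq_zero, ← (Submodule.mem_bot k⟦X⟧)]
  have hz : ∀ u ∈ V.1, U.1.mkQ (u : H) = 0 := fun u hu =>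
    (Submodule.Quotient.mk_eq_zero U.1).2 (hVU u hu)
  refine tensorMk_sub_mem h ⊥ (tensorMk U ∘ₗ
    TensorProduct.map C.alg.val.toLinearMap C.alg.val.toLinearMap) ?_ ?_
  · intro u hu a
    simp [tensorMk, show U.1.mkQ (u : H) = 0 from hz u hu, -Submodule.mkQ_apply]
  · intro u hu a
    simp [tensorMk, show U.1.mkQ (u : H) = 0 from hz u hu, -Submodule.mkQ_apply]

/-- The inclusion into `H` respects coproducts. The counit and antipode axioms, whose values lie in
`H`, are inherited through it. -/
theorem tendsto_map_val (a : C.alg) : Tendsto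
    (TensorProduct.map C.alg.val.toLinearMap C.alg.val.toLinearMap)
    (CTensor.approx (C.algComul a)) (CTensor.approx (T.comul (a : H))) := by
  intro s hs
  obtain ⟨U, hU⟩ := CTensor.eventually_approx.1 hs
  let V : OpenSub k⟦X⟧ C.alg :=
    ⟨U.1.comap C.alg.val.toLinearMap, U.2.preimage C.continuous_val_alg⟩
  refine CTensor.eventually_approx.2 ⟨V, fun t ht => hU _ ?_⟩
  have h1 := (C.tendsto_expansion (a : H)).eventually
    (CTensor.eventually_approx.2 ⟨U, fun t ht => ht⟩)
  obtain ⟨m, h1, hm⟩ := (h1.and (eventually_ge_atTop (C.level V))).exists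
  rw [← h1, ← map_val_algExpansion]
  refine C.tensorMk_map_val (V := V) (fun a ha => ha) ?_
  rw [ht, C.proj_algComul V hm]

/-- The pairing of the coordinates of indices `e` and `e'` with a tensor. -/
def coord₂ (e e' : Fin d → ℕ) : H ⊗[k⟦X⟧] H →ₗ[k⟦X⟧] k⟦X⟧ :=
  (TensorProduct.lid k⟦X⟧ k⟦X⟧).toLinearMap ∘ₗ TensorProduct.map (C.coord e) (C.coord e')

@[simp] theorem coord₂_tmul (e e' : Fin d → ℕ) (a b : H) :
    C.coord₂ e e' (a ⊗ₜ b) = C.coord e a * C.coord e' b := by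
  simp [coord₂]

theorem coord₂_mem {n : ℕ} {t : H ⊗[k⟦X⟧] H} (ht : tensorMk (hH.hOpen n) t = 0)
    (e e' : Fin d → ℕ) : (PowerSeries.X : k⟦X⟧) ^ n ∣ C.coord₂ e e' t := by
  refine mem_hSub_self.1 (tensorMk_mem ht _ _ (fun u hu m => ?_) (fun u hu m => ?_))
  · rw [coord₂_tmul]
    exact mem_hSub_self.2 (Dvd.dvd.mul_right (mem_hSub_self.1 (map_mem_hSub _ hu)) _)
  · rw [coord₂_tmul]
    exact mem_hSub_self.2 (Dvd.dvd.mul_left (mem_hSub_self.1 (map_mem_hSub _ hu)) _)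

/-- The pairing of the divided coordinates of indices `e` and `e'` with a tensor. -/
def dcoord₂ (e e' : Fin d → ℕ) : C.alg ⊗[k⟦X⟧] C.alg →ₗ[k⟦X⟧] k⟦X⟧ :=
  (TensorProduct.lid k⟦X⟧ k⟦X⟧).toLinearMap ∘ₗ TensorProduct.map (C.dcoord e) (C.dcoord e')

@[simp] theorem dcoord₂_tmul (e e' : Fin d → ℕ) (a b : C.alg) :
    C.dcoord₂ e e' (a ⊗ₜ b) = C.dcoord e a * C.dcoord e' b := by
  simp [dcoord₂]

theorem pow_mul_dcoord₂ (e e' : Fin d → ℕ) (w : C.alg ⊗[k⟦X⟧] C.alg) :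
    (PowerSeries.X : k⟦X⟧) ^ (∑ i, e i + ∑ i, e' i) * C.dcoord₂ e e' w = C.coord₂ e e'
      (TensorProduct.map C.alg.val.toLinearMap C.alg.val.toLinearMap w) := by
  induction w with
  | zero => simp
  | tmul a b =>
    rw [dcoord₂_tmul, TensorProduct.map_tmul, coord₂_tmul, pow_add]
    change _ = C.coord e (a : H) * C.coord e' (b : H)
    rw [← pow_mul_dcoord, ← pow_mul_dcoord]
    ring
  | add s t hs ht => simp only [map_add, mul_add, hs, ht]

theorem tensorMk_eq_sum {U : OpenSub k⟦X⟧ C.alg} {n : ℕ} (h : C.algSub n ≤ U.1)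
    (w : C.alg ⊗[k⟦X⟧] C.alg) : tensorMk U w = ∑ e ∈ lowDegree d n, ∑ e' ∈ lowDegree d n,
      C.dcoord₂ e e' w • tensorMk U (C.dy e ⊗ₜ C.dy e') := by
  induction w with
  | zero => simp
  | tmul a b =>
    have key : ∀ a, U.1.mkQ a = ∑ e ∈ lowDegree d n, C.dcoord e a • U.1.mkQ (C.dy e) := by
      intro a
      have := h (C.alg_sub_sum_mem le_rfl a)
      rw [← Submodule.ker_mkQ U.1, LinearMap.mem_ker, map_sub, sub_eq_zero, map_sum] at this
      rw [this]
      exact Finset.sum_congr rfl fun e _ => map_smul _ _ _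
    rw [tensorMk, TensorProduct.map_tmul, key a, key b, TensorProduct.sum_tmul]
    refine Finset.sum_congr rfl fun e _ => ?_
    rw [TensorProduct.tmul_sum]
    refine Finset.sum_congr rfl fun e' _ => ?_
    rw [TensorProduct.smul_tmul_smul, dcoord₂_tmul, TensorProduct.map_tmul]
  | add s t hs ht => simp only [map_add, add_smul, Finset.sum_add_distrib, hs, ht]

/-- A quantitative form of injectivity into `H ⊗ H`. Modulo `U` only indices with `|e|, |e'| < n`
matter. Dividing `h^(2n)` by `h^(|e|+|e'|)` leaves at least `h^(n-|e|)`, which puts the multiple of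
`h^|e| y_e` into `h^n H`. -/
theorem tensorMk_eq_zero {U : OpenSub k⟦X⟧ C.alg} {n : ℕ} (h : C.algSub n ≤ U.1)
    {w : C.alg ⊗[k⟦X⟧] C.alg} (hw : ∀ e e', (PowerSeries.X : k⟦X⟧) ^ (n + n) ∣ C.coord₂ e e'
      (TensorProduct.map C.alg.val.toLinearMap C.alg.val.toLinearMap w)) : tensorMk U w = 0 := by
  rw [C.tensorMk_eq_sum h]
  refine Finset.sum_eq_zero fun e he => Finset.sum_eq_zero fun e' he' => ?_
  rw [mem_lowDegree] at he he'
  have h1 := hw e e'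
  rw [← pow_mul_dcoord₂] at h1
  have h2 : (PowerSeries.X : k⟦X⟧) ^ (n - ∑ i, e i) ∣ C.dcoord₂ e e' w := by
    refine X_pow_dvd_cancel (m := ∑ i, e i + ∑ i, e' i) ((pow_dvd_pow _ ?_).trans h1)
    omega
  rw [← map_smul, TensorProduct.smul_tmul']
  refine C.tensorMk_tmul_eq_zero_left (h ?_)
  have h3 := smul_mem_hSub_add h2 (pow_smul_mem_hSub (k := k) (∑ i, e i) (C.y e))
  rwa [Nat.sub_add_cancel he.le] at h3

end TopHopf.Coords

end

/-! ### The topological Hopf algebra structure of `C.alg`. -/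

noncomputable section

section TensorMul

variable {R M : Type*} [CommRing R] [Ring M] [Algebra R M] [TopologicalSpace M]
  {U V : OpenSub R M} (hV : ∀ v ∈ V.1, ∀ x : M, v * x ∈ U.1 ∧ x * v ∈ U.1)

include hV

theorem tensorMk_mul_congr_left {s s' : M ⊗[R] M} (h : tensorMk V s = tensorMk V s')
    (r : M ⊗[R] M) : tensorMk U (s * r) = tensorMk U (s' * r) := by
  rw [← sub_eq_zero, ← Submodule.mem_bot R]
  induction r with
  | zero => simp
  | tmul a b =>
    refine tensorMk_sub_mem h ⊥ (tensorMk U ∘ₗ LinearMap.mulRight R (a ⊗ₜ b)) ?_ ?_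
    · intro u hu m
      have h0 : u * a ∈ LinearMap.ker U.1.mkQ := by rw [Submodule.ker_mkQ]; exact (hV u hu a).1
      rw [LinearMap.mem_ker] at h0
      rw [Submodule.mem_bot, LinearMap.comp_apply, LinearMap.mulRight_apply,
        Algebra.TensorProduct.tmul_mul_tmul, tensorMk, TensorProduct.map_tmul, h0,
        TensorProduct.zero_tmul]
    · intro u hu m
      have h0 : u * b ∈ LinearMap.ker U.1.mkQ := by rw [Submodule.ker_mkQ]; exact (hV u hu b).1
      rw [LinearMap.mem_ker] at h0
      rw [Submodule.mem_bot, LinearMap.comp_apply, LinearMap.mulRight_apply,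
        Algebra.TensorProduct.tmul_mul_tmul, tensorMk, TensorProduct.map_tmul, h0,
        TensorProduct.tmul_zero]
  | add r r' hr hr' =>
    rw [mul_add, mul_add, map_add, map_add, add_sub_add_comm]
    exact add_mem hr hr'

theorem tensorMk_mul_congr_right {s s' : M ⊗[R] M} (h : tensorMk V s = tensorMk V s')
    (r : M ⊗[R] M) : tensorMk U (r * s) = tensorMk U (r * s') := by
  rw [← sub_eq_zero, ← Submodule.mem_bot R]
  induction r with
  | zero => simp
  | tmul a b =>
    refine tensorMk_sub_mem h ⊥ (tensorMk U ∘ₗ LinearMap.mulLeft R (a ⊗ₜ b)) ?_ ?_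
    · intro u hu m
      have h0 : a * u ∈ LinearMap.ker U.1.mkQ := by rw [Submodule.ker_mkQ]; exact (hV u hu a).2
      rw [LinearMap.mem_ker] at h0
      rw [Submodule.mem_bot, LinearMap.comp_apply, LinearMap.mulLeft_apply,
        Algebra.TensorProduct.tmul_mul_tmul, tensorMk, TensorProduct.map_tmul, h0,
        TensorProduct.zero_tmul]
    · intro u hu m
      have h0 : b * u ∈ LinearMap.ker U.1.mkQ := by rw [Submodule.ker_mkQ]; exact (hV u hu b).2
      rw [LinearMap.mem_ker] at h0
      rw [Submodule.mem_bot, LinearMap.comp_apply, LinearMap.mulLeft_apply,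
        Algebra.TensorProduct.tmul_mul_tmul, tensorMk, TensorProduct.map_tmul, h0,
        TensorProduct.tmul_zero]
  | add r r' hr hr' =>
    rw [add_mul, add_mul, map_add, map_add, add_sub_add_comm]
    exact add_mem hr hr'

/-- Products of approximations approximate products. -/
theorem CTensor.eventually_mul {z z' : CTensor R M} {s s' : M ⊗[R] M}
    (hs : tensorMk V s = CTensor.proj V z) (hs' : tensorMk V s' = CTensor.proj V z') :
    ∀ᶠ q in CTensor.approx z ×ˢ CTensor.approx z', tensorMk U (q.1 * q.2) = tensorMk U (s * s') := by
  have h1 : ∀ᶠ t in CTensor.approx z, tensorMk V t = CTensor.proj V z :=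
    CTensor.eventually_approx.2 ⟨V, fun t ht => ht⟩
  have h2 : ∀ᶠ t in CTensor.approx z', tensorMk V t = CTensor.proj V z' :=
    CTensor.eventually_approx.2 ⟨V, fun t ht => ht⟩
  refine (h1.prod_mk h2).mono fun q hq => ?_
  rw [tensorMk_mul_congr_left hV (hq.1.trans hs.symm),
    tensorMk_mul_congr_right hV (hq.2.trans hs'.symm)]

end TensorMul

namespace TopHopf.Coords

variable {k H : Type*} [Field k] [Ring H] [Algebra k⟦X⟧ H] [TopologicalSpace H]
  {T : TopHopf k⟦X⟧ H} {hH : IsTopFree k H} {d : ℕ} (C : T.Coords hH d)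

theorem alg_mul_mem {n : ℕ} {v : C.alg} (hv : v ∈ C.algSub n) (x : C.alg) :
    v * x ∈ C.algSub n ∧ x * v ∈ C.algSub n := by
  constructor
  · have := mul_mem_hSub (k := k) (C.mem_algSub.1 hv) (hSub_zero (x : H))
    rwa [add_zero] at this
  · have := mul_mem_hSub (k := k) (hSub_zero (x : H)) (C.mem_algSub.1 hv)
    rwa [zero_add] at this

/-- The open submodule `C.alg ∩ h^n H` of `C.alg`. -/
def algOpen (n : ℕ) : OpenSub k⟦X⟧ C.alg := ⟨C.algSub n, C.isOpen_of_algSub_le le_rfl⟩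

theorem algContinuous_mul (U : OpenSub k⟦X⟧ C.alg) : ∃ V : OpenSub k⟦X⟧ C.alg, ∀ v ∈ V.1,
    ∀ x : C.alg, v * x ∈ U.1 ∧ x * v ∈ U.1 := by
  obtain ⟨n, hn⟩ := C.exists_algSub_le U
  exact ⟨C.algOpen n, fun v hv x =>
    ⟨hn (C.alg_mul_mem hv x).1, hn (C.alg_mul_mem hv x).2⟩⟩

theorem isOpen_ker_algComul (U : OpenSub k⟦X⟧ C.alg) :
    IsOpen (LinearMap.ker (CTensor.proj U ∘ₗ C.algComul) : Set C.alg) := by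
  -- `dop e` loses `|e|` powers of `h`, and only `|e|` below the level occur; twice the level leaves
  -- enough.
  refine C.isOpen_of_algSub_le (n := C.level U + C.level U) fun a ha => ?_
  rw [LinearMap.mem_ker, LinearMap.comp_apply, C.proj_algComul U le_rfl, algExpansion_apply,
    map_sum]
  refine Finset.sum_eq_zero fun e he => ?_
  rw [mem_lowDegree] at he
  exact C.tensorMk_tmul_eq_zero_left (C.algSub_level U (C.dop_mem_algSub (by omega) ha))

/-- The antipode of `C.alg`. -/
def algAntipode : C.alg →ₗ[k⟦X⟧] C.alg where
  toFun a := ⟨T.antipode a, antipode_mem a.2⟩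
  map_add' _ _ := Subtype.ext (map_add T.antipode _ _)
  map_smul' _ _ := Subtype.ext (map_smul T.antipode _ _)

theorem algComul_one (U : OpenSub k⟦X⟧ C.alg) :
    CTensor.proj U (C.algComul 1) = tensorMk U 1 := by
  rw [C.proj_algComul U (Nat.le_succ _), algExpansion_apply]
  congr 1
  have h0 : (0 : Fin d → ℕ) ∈ lowDegree d (C.level U).succ := mem_lowDegree.2 (by simp)
  rw [Finset.sum_eq_single_of_mem _ h0, dop_zero, dy_zero, Algebra.TensorProduct.one_def]
  intro e _ he
  have : C.dop e 1 = 0 := Subtype.ext (hH.pow_smul_eq_zero (n := ∑ i, e i) (by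
    rw [pow_smul_dop, op, Subalgebra.coe_one, wordOp_one, if_neg (mt sortedWord_eq_nil.1 he)]))
  rw [this, TensorProduct.zero_tmul]

theorem map_val_mul (s t : C.alg ⊗[k⟦X⟧] C.alg) :
    TensorProduct.map C.alg.val.toLinearMap C.alg.val.toLinearMap (s * t) =
      TensorProduct.map C.alg.val.toLinearMap C.alg.val.toLinearMap s *
        TensorProduct.map C.alg.val.toLinearMap C.alg.val.toLinearMap t :=
  map_mul (Algebra.TensorProduct.map C.alg.val C.alg.val) s t

/-- Multiplicativity holds in `H ⊗ H` modulo `h^(2n)`, and `tensorMk_eq_zero` carries it back to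
`C.alg ⊗ C.alg`. -/
theorem eventually_algExpansion_mul (x y : C.alg) (U : OpenSub k⟦X⟧ C.alg) : ∀ᶠ m in atTop,
    tensorMk U (C.algExpansion m x * C.algExpansion m y) =
      CTensor.proj U (C.algComul (x * y)) := by
  set n := C.level U
  have h1 := ((C.tendsto_expansion (x : H)).prodMk (C.tendsto_expansion (y : H))).eventually
    (T.comul_mul x y (hH.hOpen (n + n)))
  have h2 := (C.tendsto_expansion ((x * y : C.alg) : H)).eventually
    (CTensor.eventually_approx.2 ⟨hH.hOpen (n + n), fun t ht => ht⟩)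
  filter_upwards [h1, h2, eventually_ge_atTop n] with m h1 h2 hm
  rw [C.proj_algComul U hm, ← sub_eq_zero, ← map_sub]
  refine C.tensorMk_eq_zero (C.algSub_level U) fun e e' => C.coord₂_mem ?_ e e'
  rw [map_sub, map_sub, map_val_mul, map_val_algExpansion, map_val_algExpansion,
    map_val_algExpansion, h2, h1, Subalgebra.coe_mul, sub_self]

theorem algComul_mul (x y : C.alg) (U : OpenSub k⟦X⟧ C.alg) :
    ∀ᶠ q in CTensor.approx (C.algComul x) ×ˢ CTensor.approx (C.algComul y),
      tensorMk U (q.1 * q.2) = CTensor.proj U (C.algComul (x * y)) := by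
  obtain ⟨V, hV⟩ := C.algContinuous_mul U
  obtain ⟨m, h, hm⟩ :=
    ((C.eventually_algExpansion_mul x y U).and (eventually_ge_atTop (C.level V))).exists
  rw [← h]
  exact CTensor.eventually_mul hV (C.proj_algComul V hm x).symm (C.proj_algComul V hm y).symm

theorem mkQ_eq_of_sub_mem {U : OpenSub k⟦X⟧ C.alg} {a b : C.alg} (h : a - b ∈ U.1) :
    U.1.mkQ a = U.1.mkQ b := by
  rwa [← sub_eq_zero, ← map_sub, ← LinearMap.mem_ker, Submodule.ker_mkQ]

/-- The operator of the concatenated word is a slice by its word coordinate; expanding that slice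
and dividing by `h^M` gives the structure constants of coassociativity. -/
theorem eventually_dop_dop (n : ℕ) (x : C.alg) (e e' : Fin d → ℕ) : ∀ᶠ m in atTop,
    C.dop e (C.dop e' x) - ∑ f ∈ lowDegree d m, C.dcoord e (C.dop e' (C.dy f)) • C.dop f x ∈
      C.algSub n := by
  set M := (sortedWord e ++ sortedWord e').length
  filter_upwards [C.eventually_slice_sub (T.wordCoord hH C.t (sortedWord e ++ sortedWord e'))
    (M + n) (x : H)] with m hm
  rw [mem_algSub, ← hH.pow_smul_mem_hSub_iff (m := M)]
  convert hm using 1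
  rw [Subalgebra.coe_sub, smul_sub, AddSubmonoidClass.coe_finsetSum, Finset.smul_sum,
    slice_wordCoord, dop, dop, ← dword_append, pow_smul_dword]
  congr 1
  refine Finset.sum_congr rfl fun f _ => ?_
  have h1 : (PowerSeries.X : k⟦X⟧) ^ M * C.dcoord e (C.dword (sortedWord e') (C.dy f)) =
      PowerSeries.X ^ (∑ i, f i) *
        T.wordCoord hH C.t (sortedWord e ++ sortedWord e') (C.y f) := by
    rw [dcoord_apply, dop, ← dword_append, ← smul_eq_mul, ← map_smul, pow_smul_dword, coe_dy,
      map_smul, map_smul, smul_eq_mul, wordCoord_apply]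
  rw [Subalgebra.coe_smul, smul_smul, h1, mul_comm, mul_smul, pow_smul_dop]

theorem assoc_sum_tmul {R Q ι : Type*} [CommRing R] [AddCommGroup Q] [Module R Q]
    {s S : Finset ι} {r q : ι → Q} {c : ι → ι → ι → R} {r' : ι → ι → Q}
    (h : ∀ j ∈ s, ∀ i ∈ s, r' j i = ∑ f ∈ S, c j i f • r f) :
    ∑ j ∈ s, TensorProduct.assoc R Q Q Q ((∑ i ∈ s, r' j i ⊗ₜ[R] q i) ⊗ₜ[R] q j) =
      ∑ f ∈ S, r f ⊗ₜ[R] ∑ j ∈ s, ∑ i ∈ s, c j i f • (q i ⊗ₜ[R] q j) := by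
  have e1 : ∀ j ∈ s, TensorProduct.assoc R Q Q Q ((∑ i ∈ s, r' j i ⊗ₜ[R] q i) ⊗ₜ[R] q j) =
      ∑ i ∈ s, ∑ f ∈ S, c j i f • (r f ⊗ₜ[R] (q i ⊗ₜ[R] q j)) := by
    intro j hj
    rw [TensorProduct.sum_tmul, map_sum]
    refine Finset.sum_congr rfl fun i hi => ?_
    rw [TensorProduct.assoc_tmul, h j hj i hi, TensorProduct.sum_tmul]
    exact Finset.sum_congr rfl fun f _ => (TensorProduct.smul_tmul' _ _ _).symm
  have e2 : ∀ f ∈ S, r f ⊗ₜ[R] ∑ j ∈ s, ∑ i ∈ s, c j i f • (q i ⊗ₜ[R] q j) =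
      ∑ j ∈ s, ∑ i ∈ s, c j i f • (r f ⊗ₜ[R] (q i ⊗ₜ[R] q j)) := by
    intro f _
    rw [TensorProduct.tmul_sum]
    refine Finset.sum_congr rfl fun j _ => ?_
    rw [TensorProduct.tmul_sum]
    exact Finset.sum_congr rfl fun i _ => TensorProduct.tmul_smul _ _ _
  rw [Finset.sum_congr rfl e1, Finset.sum_congr rfl e2]
  refine Eq.trans ?_ Finset.sum_comm
  exact Finset.sum_congr rfl fun j _ => Finset.sum_comm

theorem proj_algComul_eq_sum (U : OpenSub k⟦X⟧ C.alg) {n : ℕ} (hn : C.level U ≤ n) (a : C.alg) :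
    CTensor.proj U (C.algComul a) =
      ∑ e ∈ lowDegree d n, U.1.mkQ (C.dop e a) ⊗ₜ[k⟦X⟧] U.1.mkQ (C.dy e) := by
  rw [C.proj_algComul U hn, algExpansion_apply, map_sum]
  rfl

theorem mkQ_eq_sum {U : OpenSub k⟦X⟧ C.alg} {n : ℕ} (h : C.algSub n ≤ U.1) (a : C.alg) :
    U.1.mkQ a = ∑ e ∈ lowDegree d n, C.dcoord e a • U.1.mkQ (C.dy e) := by
  rw [C.mkQ_eq_of_sub_mem (h (C.alg_sub_sum_mem le_rfl a)), map_sum]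
  exact Finset.sum_congr rfl fun e _ => map_smul _ _ _

theorem proj_algComul_dy (U : OpenSub k⟦X⟧ C.alg) (f : Fin d → ℕ) :
    CTensor.proj U (C.algComul (C.dy f)) = ∑ e' ∈ lowDegree d (C.level U),
      ∑ e ∈ lowDegree d (C.level U), C.dcoord e (C.dop e' (C.dy f)) •
        (U.1.mkQ (C.dy e) ⊗ₜ[k⟦X⟧] U.1.mkQ (C.dy e')) := by
  rw [C.proj_algComul_eq_sum U le_rfl]
  refine Finset.sum_congr rfl fun e' _ => ?_
  rw [C.mkQ_eq_sum (C.algSub_level U) (C.dop e' _), TensorProduct.sum_tmul]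
  exact Finset.sum_congr rfl fun e _ => TensorProduct.smul_tmul' _ _ _

theorem extend_algComul {A B : Type*} [AddCommGroup A] [Module k⟦X⟧ A] [AddCommGroup B]
    [Module k⟦X⟧ B] (f : C.alg →ₗ[k⟦X⟧] A) (hf : IsOpen (LinearMap.ker f : Set C.alg))
    (g : C.alg →ₗ[k⟦X⟧] B) (hg : IsOpen (LinearMap.ker g : Set C.alg)) (x : C.alg) :
    ∀ᶠ m in atTop, CTensor.extend f hf g hg (C.algComul x) =
      ∑ e ∈ lowDegree d m, f (C.dop e x) ⊗ₜ[k⟦X⟧] g (C.dy e) := by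
  let W : OpenSub k⟦X⟧ C.alg := OpenSub.inf ⟨_, hf⟩ ⟨_, hg⟩
  filter_upwards [eventually_ge_atTop (C.level W)] with m hm
  rw [CTensor.extend_eq f hf g hg _ (U := W) inf_le_left inf_le_right
    (C.proj_algComul W hm x).symm, algExpansion_apply, map_sum]
  rfl

/-- Checked in coordinates. One side is `∑ dop e (dop e' x) ⊗ dy e ⊗ dy e'`, the other `∑ dop f x ⊗
Δ(dy f)`; `eventually_dop_dop` matches their coefficients. -/
theorem algCoassoc (x : C.alg) (U : OpenSub k⟦X⟧ C.alg) :
    TensorProduct.assoc k⟦X⟧ (C.alg ⧸ U.1) (C.alg ⧸ U.1) (C.alg ⧸ U.1)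
      (CTensor.extend (CTensor.proj U ∘ₗ C.algComul) (C.isOpen_ker_algComul U) U.1.mkQ
        (isOpen_ker_mkQ U) (C.algComul x)) =
      CTensor.extend U.1.mkQ (isOpen_ker_mkQ U) (CTensor.proj U ∘ₗ C.algComul)
        (C.isOpen_ker_algComul U) (C.algComul x) := by
  have hn := C.algSub_level U
  have key : ∀ᶠ m in atTop, ∀ e ∈ lowDegree d (C.level U), ∀ e' ∈ lowDegree d (C.level U),
      C.dop e (C.dop e' x) - ∑ f ∈ lowDegree d m, C.dcoord e (C.dop e' (C.dy f)) • C.dop f x ∈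
        C.algSub (C.level U) :=
    (Filter.eventually_all_finset _).2 fun e _ => (Filter.eventually_all_finset _).2 fun e' _ =>
      C.eventually_dop_dop _ x e e'
  obtain ⟨m, hm, h1, h2, hmn⟩ := (key.and ((C.extend_algComul (CTensor.proj U ∘ₗ C.algComul)
    (C.isOpen_ker_algComul U) U.1.mkQ (isOpen_ker_mkQ U) x).and
      ((C.extend_algComul U.1.mkQ (isOpen_ker_mkQ U) (CTensor.proj U ∘ₗ C.algComul)
        (C.isOpen_ker_algComul U) x).and (eventually_ge_atTop (C.level U))))).exists
  -- On one side the sum is cut down to the level of `U`, beyond which `dy f` vanishes modulo `U`;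
  -- the other side keeps all indices below `m`.
  rw [h1, h2, ← Finset.sum_subset (lowDegree_subset hmn) (f := fun e =>
    (CTensor.proj U ∘ₗ C.algComul) (C.dop e x) ⊗ₜ[k⟦X⟧] U.1.mkQ (C.dy e)) fun f _ hf => ?_]
  · simp only [LinearMap.comp_apply, proj_algComul_dy, C.proj_algComul_eq_sum U le_rfl (C.dop _ x)]
    rw [map_sum]
    refine assoc_sum_tmul fun e' he' e he => ?_
    rw [C.mkQ_eq_of_sub_mem (hn (hm e he e' he')), map_sum]
    exact Finset.sum_congr rfl fun f _ => map_smul _ _ _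
  · rw [mem_lowDegree, not_lt] at hf
    have := hn (C.dy_mem_algSub hf)
    rw [← Submodule.ker_mkQ U.1, LinearMap.mem_ker] at this
    change _ ⊗ₜ[k⟦X⟧] U.1.mkQ (C.dy f) = 0
    rw [this]
    exact TensorProduct.tmul_zero _ _

/-- The topological Hopf algebra structure of `C.alg`. -/
def algHopf : TopHopf k⟦X⟧ C.alg where
  comul := C.algComul
  counit := C.algCounit
  antipode := C.algAntipode
  continuous_mul := C.algContinuous_mul
  isOpen_ker_comul := C.isOpen_ker_algComul
  continuous_counit := T.continuous_counit.comp C.continuous_val_alg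
  continuous_antipode := Topology.IsInducing.subtypeVal.continuous_iff.2
    (T.continuous_antipode.comp C.continuous_val_alg)
  comul_one := C.algComul_one
  comul_mul := C.algComul_mul
  coassoc := C.algCoassoc
  counit_comul x := by
    rw [Topology.IsInducing.subtypeVal.tendsto_nhds_iff]
    refine ((T.counit_comul (x : H)).comp (C.tendsto_map_val x)).congr fun t => ?_
    induction t with
    | zero => simp
    | tmul a b => simp [algCounit_apply]
    | add s t hs ht => simp_all
  comul_counit x := by
    rw [Topology.IsInducing.subtypeVal.tendsto_nhds_iff]
    refine ((T.comul_counit (x : H)).comp (C.tendsto_map_val x)).congr fun t => ?_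
    induction t with
    | zero => simp
    | tmul a b => simp [algCounit_apply]
    | add s t hs ht => simp_all
  antipode_comul x := by
    rw [Topology.IsInducing.subtypeVal.tendsto_nhds_iff]
    refine ((T.antipode_comul (x : H)).comp (C.tendsto_map_val x)).congr fun t => ?_
    induction t with
    | zero => simp
    | tmul a b => simp [algAntipode]
    | add s t hs ht => simp_all
  comul_antipode x := by
    rw [Topology.IsInducing.subtypeVal.tendsto_nhds_iff]
    refine ((T.comul_antipode (x : H)).comp (C.tendsto_map_val x)).congr fun t => ?_
    induction t with
    | zero => simp
    | tmul a b => simp [algAntipode]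
    | add s t hs ht => simp_all

theorem isHom_val : TopHopf.IsHom C.algHopf T C.alg.val where
  continuous := C.continuous_val_alg
  comul a U := (C.tendsto_map_val a).eventually
    (CTensor.eventually_approx.2 ⟨U, fun _ ht => ht⟩)
  counit _ := rfl
  antipode _ := rfl

theorem isTopProduct_alg {k : Type*} {H : Type u} [Field k] [Ring H] [Algebra k⟦X⟧ H]
    [TopologicalSpace H] {T : TopHopf k⟦X⟧ H} {hH : IsTopFree k H} {d : ℕ} (C : T.Coords hH d) :
    IsTopProduct k C.alg := by
  -- The divided coordinates give the isomorphism; `ULift` places the index set in the universe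
  -- required by `IsTopProduct`.
  let f : C.alg →ₗ[k⟦X⟧] (ULift.{u} (Fin d → ℕ) → k⟦X⟧) :=
    LinearMap.pi fun e => C.dcoord e.down
  have hf : Function.Bijective f := by
    refine ⟨fun a b h => C.alg_ext fun e => congrFun h ⟨e⟩, fun c => ?_⟩
    obtain ⟨a, ha⟩ := C.exists_dcoord_eq fun e => c ⟨e⟩
    exact ⟨a, funext fun e => ha e.down⟩
  refine ⟨ULift.{u} (Fin d → ℕ), ⟨{ LinearEquiv.ofBijective f hf with
    continuous_toFun := ?_, continuous_invFun := ?_ }⟩⟩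
  · refine continuous_pi fun e => ?_
    change Continuous fun a => C.dcoord e.down a
    rw [continuous_iff_continuousAt]
    intro a s hs
    obtain ⟨n, hn⟩ := mem_nhds_powerSeries.1 hs
    rw [mem_map]
    refine mem_nhds_iff.2 ⟨{b | b - a ∈ C.algSub (n + ∑ i, e.down i)}, fun b hb => ?_, ?_, ?_⟩
    · refine hn _ ?_
      rw [← map_sub]
      exact mem_hSub_self.1
        (map_mem_hSub T.counit.toLinearMap (C.dop_mem_algSub (e := e.down) le_rfl hb))
    · refine C.isOpen_alg_iff.2 fun b hb => ⟨n + ∑ i, e.down i, fun c hc => ?_⟩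
      have := add_mem hc hb
      rwa [sub_add_sub_cancel] at this
    · change a - a ∈ C.algSub _
      rw [sub_self]
      exact zero_mem _
  · change Continuous (LinearEquiv.ofBijective f hf).symm
    rw [continuous_def]
    intro s hs
    rw [C.isOpen_alg_iff] at hs
    rw [isOpen_iff_mem_nhds]
    intro c hc
    obtain ⟨n, hn⟩ := hs _ hc
    have hopen : {c' : ULift.{u} (Fin d → ℕ) → k⟦X⟧ | ∀ e ∈ lowDegree d n,
        (PowerSeries.X : k⟦X⟧) ^ n ∣ c' ⟨e⟩ - c ⟨e⟩} ∈ 𝓝 c := by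
      refine (Filter.eventually_all_finset _).2 fun e _ => ?_
      exact (continuous_apply (ULift.up e)).continuousAt.eventually
        (mem_nhds_powerSeries.2 ⟨n, fun q hq => hq⟩ : {q | _ ∣ q - c ⟨e⟩} ∈ 𝓝 (c ⟨e⟩))
    refine Filter.mem_of_superset hopen fun c' hc' => hn _ ?_
    rw [mem_algSub_iff]
    intro e
    have h1 : C.dcoord e ((LinearEquiv.ofBijective f hf).symm c' -
        (LinearEquiv.ofBijective f hf).symm c) = c' ⟨e⟩ - c ⟨e⟩ := by
      have := congrFun ((LinearEquiv.ofBijective f hf).apply_symm_apply (c' - c)) ⟨e⟩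
      rw [map_sub] at this
      exact this
    rw [h1]
    by_cases he : e ∈ lowDegree d n
    · exact Dvd.dvd.mul_left (hc' e he) _
    · rw [mem_lowDegree, not_lt] at he
      exact Dvd.dvd.mul_right (pow_dvd_pow _ he) _

end TopHopf.Coords

end

noncomputable section

/-! ## Iterated coproducts -/

section PowComul

variable {R : Type*} [CommRing R]

theorem CTensor.eventually_extend {M : Type*} [AddCommGroup M] [Module R M] [TopologicalSpace M]
    {A B : Type*} [AddCommGroup A] [Module R A] [AddCommGroup B] [Module R B]
    (f : M →ₗ[R] A) (hf : IsOpen (LinearMap.ker f : Set M))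
    (g : M →ₗ[R] B) (hg : IsOpen (LinearMap.ker g : Set M)) (z : CTensor R M) :
    ∀ᶠ t in CTensor.approx z, CTensor.extend f hf g hg z = TensorProduct.map f g t :=
  CTensor.eventually_approx.2 ⟨OpenSub.inf ⟨_, hf⟩ ⟨_, hg⟩, fun _ ht =>
    CTensor.extend_eq f hf g hg z inf_le_left inf_le_right ht⟩

theorem map_consTensor {A B : Type*} [AddCommGroup A] [Module R A] [AddCommGroup B] [Module R B]
    (g : A →ₗ[R] B) (n : ℕ) (a : A) (z : ⨂[R]^n A) :
    PiTensorProduct.map (fun _ => g) (consTensor R A n (a ⊗ₜ z)) =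
      consTensor R B n (g a ⊗ₜ PiTensorProduct.map (fun _ => g) z) := by
  induction z using PiTensorProduct.induction_on with
  | smul_tprod r b =>
    rw [TensorProduct.tmul_smul, map_smul, map_smul, map_smul, TensorProduct.tmul_smul, map_smul,
      consTensor_tmul, PiTensorProduct.map_tprod, PiTensorProduct.map_tprod, consTensor_tmul]
    congr 2
    ext i
    refine Fin.cases ?_ (fun j => ?_) i <;> simp
  | add x y hx hy =>
    simp only [TensorProduct.tmul_add, map_add, hx, hy]

namespace TopHopf

variable [TopologicalSpace R] {H : Type*} [Ring H] [Algebra R H]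
  [TopologicalSpace H] [IsTopologicalAddGroup H] (T : TopHopf R H)
  {B : Type*} [AddCommGroup B] [Module R B]

theorem powComul_zero (φ : H →ₗ[R] B) (hφ : IsOpen (LinearMap.ker φ : Set H)) (a : H) :
    (T.powComul φ hφ 0).1 a = PiTensorProduct.tprod R fun _ : Fin 1 => φ a :=
  PiTensorProduct.subsingletonEquiv_symm_apply' _ _

theorem eventually_powComul (φ : H →ₗ[R] B) (hφ : IsOpen (LinearMap.ker φ : Set H)) (n : ℕ)
    (a : H) : ∀ᶠ t in CTensor.approx (T.comul a), (T.powComul φ hφ (n + 1)).1 a =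
      consTensor R B (n + 1) (TensorProduct.map φ (T.powComul φ hφ n).1 t) :=
  (CTensor.eventually_extend φ hφ _ (T.powComul φ hφ n).2 (T.comul a)).mono fun t ht => by
    rw [← ht]
    rfl

/-- Applied to the projections `H/U → H/V`, this shows that the components form an element of the
completed tensor power. -/
theorem powComul_comp {B' : Type*} [AddCommGroup B'] [Module R B'] (φ : H →ₗ[R] B)
    (hφ : IsOpen (LinearMap.ker φ : Set H)) (g : B →ₗ[R] B')
    (hg : IsOpen (LinearMap.ker (g ∘ₗ φ) : Set H)) (n : ℕ) (a : H) :
    (T.powComul (g ∘ₗ φ) hg n).1 a =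
      PiTensorProduct.map (fun _ => g) ((T.powComul φ hφ n).1 a) := by
  induction n generalizing a with
  | zero =>
    rw [powComul_zero, powComul_zero, PiTensorProduct.map_tprod]
    rfl
  | succ n ih =>
    obtain ⟨t, h1, h2⟩ := ((T.eventually_powComul _ hg n a).and
      (T.eventually_powComul _ hφ n a)).exists
    rw [h1, h2]
    clear h1 h2
    induction t with
    | zero => simp
    | tmul x y =>
      rw [TensorProduct.map_tmul, TensorProduct.map_tmul, map_consTensor, ih]
      rfl
    | add s t hs ht => simp only [map_add, hs, ht]

theorem powComul_smul (φ : H →ₗ[R] B) (hφ : IsOpen (LinearMap.ker φ : Set H)) (r : R)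
    (ψ : H →ₗ[R] B) (h : ψ = r • φ) (hr : IsOpen (LinearMap.ker ψ : Set H)) (n : ℕ) (a : H) :
    (T.powComul ψ hr n).1 a = r ^ (n + 1) • (T.powComul φ hφ n).1 a := by
  subst h
  have hr' : IsOpen (LinearMap.ker ((r • LinearMap.id : B →ₗ[R] B) ∘ₗ φ) : Set H) := hr
  refine (T.powComul_comp φ hφ (r • LinearMap.id) hr' n a).trans ?_
  generalize (T.powComul φ hφ n).1 a = z
  induction z using PiTensorProduct.induction_on with
  | smul_tprod c b =>
    rw [map_smul, PiTensorProduct.map_tprod, smul_comm]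
    congr 1
    refine ((PiTensorProduct.tprod R).map_smul_univ (fun _ => r) b).trans ?_
    rw [Finset.prod_const, Finset.card_univ, Fintype.card_fin]
  | add x y hx hy => rw [map_add, hx, hy, smul_add]

theorem powComul_hom {A : Type*} [Ring A] [Algebra R A] [TopologicalSpace A]
    [IsTopologicalAddGroup A] {S : TopHopf R A} {T : TopHopf R H}
    {f : A →ₐ[R] H} (hf : TopHopf.IsHom S T f) (φ : H →ₗ[R] B)
    (hφ : IsOpen (LinearMap.ker φ : Set H))
    (hφ' : IsOpen (LinearMap.ker (φ ∘ₗ f.toLinearMap) : Set A)) (n : ℕ) (a : A) :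
    (S.powComul (φ ∘ₗ f.toLinearMap) hφ' n).1 a = (T.powComul φ hφ n).1 (f a) := by
  induction n generalizing a with
  | zero => rfl
  | succ n ih =>
    have ht : Tendsto (TensorProduct.map f.toLinearMap f.toLinearMap)
        (CTensor.approx (S.comul a)) (CTensor.approx (T.comul (f a))) := by
      intro s hs
      obtain ⟨U, hU⟩ := CTensor.eventually_approx.1 hs
      exact (hf.comul a U).mono fun t ht => hU _ ht
    obtain ⟨t, h1, h2⟩ := ((S.eventually_powComul _ hφ' n a).and
      (ht.eventually (T.eventually_powComul _ hφ n (f a)))).exists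
    rw [h1, h2]
    clear h1 h2
    induction t with
    | zero => simp
    | tmul x y => simp only [TensorProduct.map_tmul, ih]; rfl
    | add s t hs ht => simp only [map_add, hs, ht]

end TopHopf

end PowComul

/-! ## Drinfeld's subalgebra in coordinates -/

namespace TopHopf.Coords

variable {k H : Type*} [Field k] [Ring H] [Algebra k⟦X⟧ H] [TopologicalSpace H]
  {T : TopHopf k⟦X⟧ H} {hH : IsTopFree k H} {d : ℕ} (C : T.Coords hH d)

theorem mem_prime [IsTopologicalAddGroup H] [ContinuousSMul k⟦X⟧ H] {a : H} :
    a ∈ T.prime (PowerSeries.X : k⟦X⟧) ↔ ∀ n, ∃ z ∈ CPow k⟦X⟧ H (n + 1),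
      ∀ U, (PowerSeries.X : k⟦X⟧) ^ (n + 1) • z U =
        (T.powComul (U.1.mkQ ∘ₗ T.augProj) (T.isOpen_ker_augProj U) n).1 a := by
  simp only [prime, Submodule.mem_iInf, Submodule.mem_comap, Submodule.mem_map, funext_iff]
  rfl

section Functional

variable (n : ℕ)

/-- The functional on `H / h^n H` induced by `C.t i`. -/
def tQ (i : Fin d) : (H ⧸ (hH.hOpen n).1) →ₗ[k⟦X⟧]
    k⟦X⟧ ⧸ Ideal.span {(PowerSeries.X : k⟦X⟧) ^ n} :=
  (hH.hOpen n).1.liftQ ((Ideal.Quotient.mkₐ k⟦X⟧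
    (Ideal.span {(PowerSeries.X : k⟦X⟧) ^ n})).toLinearMap ∘ₗ C.t i) fun x hx => by
      rw [LinearMap.mem_ker]
      exact Ideal.Quotient.eq_zero_iff_mem.2 (Ideal.mem_span_singleton.2
        (mem_hSub_self.1 (map_mem_hSub (C.t i) hx)))

/-- The functional on `(H / h^n H)^{⊗ m}` given by the product of the functionals `C.t (w j)`. -/
def tensorFunctional {m : ℕ} (w : Fin m → Fin d) : (⨂[k⟦X⟧]^m (H ⧸ (hH.hOpen n).1)) →ₗ[k⟦X⟧]
    k⟦X⟧ ⧸ Ideal.span {(PowerSeries.X : k⟦X⟧) ^ n} :=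
  PiTensorProduct.lift ((MultilinearMap.mkPiAlgebra k⟦X⟧ (Fin m)
    (k⟦X⟧ ⧸ Ideal.span {(PowerSeries.X : k⟦X⟧) ^ n})).compLinearMap fun j => C.tQ n (w j))

theorem tensorFunctional_tprod {m : ℕ} (w : Fin m → Fin d) (b : Fin m → H ⧸ (hH.hOpen n).1) :
    C.tensorFunctional n w (PiTensorProduct.tprod _ b) = ∏ j, C.tQ n (w j) (b j) := by
  simp [tensorFunctional]

theorem tensorFunctional_consTensor {m : ℕ} (w : Fin (m + 1) → Fin d) (a : H ⧸ (hH.hOpen n).1)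
    (z : ⨂[k⟦X⟧]^m (H ⧸ (hH.hOpen n).1)) :
    C.tensorFunctional n w (consTensor k⟦X⟧ _ m (a ⊗ₜ z)) =
      C.tQ n (w 0) a * C.tensorFunctional n (fun j => w j.succ) z := by
  induction z using PiTensorProduct.induction_on with
  | smul_tprod r b =>
    rw [TensorProduct.tmul_smul, map_smul, map_smul, map_smul, mul_smul_comm, consTensor_tmul,
      tensorFunctional_tprod, tensorFunctional_tprod, Fin.prod_univ_succ]
    simp
  | add x y hx hy => simp only [TensorProduct.tmul_add, map_add, mul_add, hx, hy]

theorem tQ_augProj (i : Fin d) (a : H) : C.tQ n i ((hH.hOpen n).1.mkQ (T.augProj a)) =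
    Ideal.Quotient.mk _ (C.t i a) := by
  change Ideal.Quotient.mk _ (C.t i (T.augProj a)) = _
  congr 1
  rw [augProj, LinearMap.sub_apply, LinearMap.id_apply, map_sub, LinearMap.comp_apply,
    Algebra.linearMap_apply, Algebra.algebraMap_eq_smul_one, map_smul, C.t_one, smul_zero,
    sub_zero]

/-- A product of functionals evaluated on `δ` is their convolution product; the projection `id - ε`
disappears because `t i 1 = 0`. -/
theorem tensorFunctional_powComul [IsTopologicalAddGroup H] [ContinuousSMul k⟦X⟧ H] {m : ℕ}
    (w : Fin (m + 1) → Fin d) (a : H) : C.tensorFunctional n w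
      ((T.powComul ((hH.hOpen n).1.mkQ ∘ₗ T.augProj) (T.isOpen_ker_augProj _) m).1 a) =
        Ideal.Quotient.mk _ (T.wordCoord hH C.t (List.ofFn w) a) := by
  induction m generalizing a with
  | zero =>
    rw [powComul_zero, tensorFunctional_tprod, Fin.prod_univ_one, LinearMap.comp_apply, tQ_augProj]
    congr 1
    rw [List.ofFn_succ, List.ofFn_zero, wordCoord_singleton]
  | succ m ih =>
    obtain ⟨t, h1, h2⟩ := ((T.eventually_powComul ((hH.hOpen n).1.mkQ ∘ₗ T.augProj)
      (T.isOpen_ker_augProj _) m a).and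
        (T.eventually_slice hH (T.wordCoord hH C.t (List.ofFn fun j => w j.succ)) n a)).exists
    rw [h1, List.ofFn_succ, wordCoord_cons, ← slice_wordCoord]
    have h3 := mem_hSub_self.1 (map_mem_hSub (C.t (w 0)) h2)
    rw [map_sub] at h3
    rw [(Ideal.Quotient.mk_eq_mk_iff_sub_mem _ _).2 (Ideal.mem_span_singleton.2 h3)]
    clear h1 h2 h3
    induction t with
    | zero => simp
    | tmul x y =>
      rw [TensorProduct.map_tmul, tensorFunctional_consTensor, ih, LinearMap.comp_apply,
        tQ_augProj, rightSlice_tmul, map_smul, smul_eq_mul, map_mul, mul_comm]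
    | add s t hs ht => simp only [map_add, hs, ht]

end Functional

/-- Evaluate the functional of the word `w` on `δ(a) = h^|w| z`. Working modulo `h^|w|` is precise
enough to read off divisibility by `h^|w|`. -/
theorem mem_divided_of_mem_prime [IsTopologicalAddGroup H] [ContinuousSMul k⟦X⟧ H] {a : H}
    (ha : a ∈ T.prime (PowerSeries.X : k⟦X⟧)) : a ∈ C.divided := by
  intro e
  rw [coord, ← sortedWord_length]
  generalize sortedWord e = w
  rcases hw : w.length with _ | n
  · simp
  · obtain ⟨z, -, hz⟩ := mem_prime.1 ha n
    have h1 := C.tensorFunctional_powComul (n + 1) (fun j : Fin (n + 1) => w.get (j.cast hw.symm)) a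
    rw [← hz, map_smul] at h1
    have h2 : (List.ofFn fun j : Fin (n + 1) => w.get (j.cast hw.symm)) = w := by
      rw [← List.ofFn_congr hw, List.ofFn_get]
    obtain ⟨r, hr⟩ := Ideal.Quotient.mk_surjective (C.tensorFunctional (n + 1)
      (fun j : Fin (n + 1) => w.get (j.cast hw.symm)) (z (hH.hOpen (n + 1))))
    rw [h2, ← hr] at h1
    change Ideal.Quotient.mk _ (PowerSeries.X ^ (n + 1) * r) = _ at h1
    rw [Ideal.Quotient.eq, Ideal.mem_span_singleton] at h1
    exact (dvd_sub_right (dvd_mul_right _ _)).1 h1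

/-- `id - ε` removes the coordinate of index `0`, and all other coordinates of an element of `C.alg`
are divisible by `h`. -/
theorem exists_divided_augProj : ∃ q : C.alg →ₗ[k⟦X⟧] H,
    ∀ a, (PowerSeries.X : k⟦X⟧) • q a = T.augProj (a : H) := by
  have h : ∀ a : C.alg, ∃ y : H, T.augProj (a : H) = (PowerSeries.X : k⟦X⟧) • y := by
    intro a
    have := C.detect 1 (T.augProj (a : H)) fun e => by
      change _ ∣ C.coord e _
      rw [augProj, LinearMap.sub_apply, LinearMap.id_apply, map_sub, LinearMap.comp_apply,
        Algebra.linearMap_apply, Algebra.algebraMap_eq_smul_one, map_smul, coord_one]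
      split_ifs with he
      · rw [he, coord_zero]
        simp
      · rw [smul_zero, sub_zero]
        exact (pow_dvd_pow _ (sum_pos_of_ne_zero he)).trans (a.2 e)
    obtain ⟨y, hy⟩ := mem_hSub.1 this
    exact ⟨y, by rw [hy, pow_one]⟩
  choose q hq using h
  have cancel : ∀ {x y : H}, (PowerSeries.X : k⟦X⟧) • x = (PowerSeries.X : k⟦X⟧) • y → x = y :=
    fun {x y} h => hH.pow_smul_cancel (n := 1) (by rwa [pow_one])
  refine ⟨{ toFun := q, map_add' := fun a b => cancel ?_, map_smul' := fun r a => cancel ?_ },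
    fun a => (hq a).symm⟩
  · rw [smul_add, ← hq, ← hq, ← hq, Subalgebra.coe_add, map_add]
  · rw [RingHom.id_apply, smul_comm, ← hq, ← hq, Subalgebra.coe_smul, map_smul]

instance [IsTopologicalAddGroup H] : IsTopologicalAddGroup C.alg :=
  Topology.IsInducing.topologicalAddGroup C.alg.val Topology.IsInducing.subtypeVal

/-- On `C.alg` one has `id - ε = h q`. Computing the iterated coproduct inside `C.alg` gives
`δ_{n+1}(a) = h^(n+1) q^{⊗(n+1)} Δ^{n+1}(a)`, which exhibits the required quotient. -/
theorem mem_prime_of_mem_divided [IsTopologicalAddGroup H] [ContinuousSMul k⟦X⟧ H] {a : H}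
    (ha : a ∈ C.divided) : a ∈ T.prime (PowerSeries.X : k⟦X⟧) := by
  obtain ⟨q, hq⟩ := C.exists_divided_augProj
  have hopen : ∀ U : OpenSub k⟦X⟧ H, IsOpen (LinearMap.ker (U.1.mkQ ∘ₗ q) : Set C.alg) := by
    intro U
    obtain ⟨n, hn⟩ := hH.exists_hSub_le U.2
    -- Division by `h` in `q` costs one power of `h`.
    refine C.isOpen_of_algSub_le (n := 1 + n) fun b hb => ?_
    rw [LinearMap.ker_comp, Submodule.ker_mkQ]
    refine hn ?_
    rw [← hH.pow_smul_mem_hSub_iff (m := 1), pow_one, hq]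
    exact map_mem_hSub _ hb
  refine mem_prime.2 fun n => ⟨fun U => (C.algHopf.powComul (U.1.mkQ ∘ₗ q) (hopen U) n).1 ⟨a, ha⟩,
    fun U V hUV => (C.algHopf.powComul_comp (U.1.mkQ ∘ₗ q) (hopen U) (Submodule.factor hUV)
      (hopen V) n ⟨a, ha⟩).symm, fun U => ?_⟩
  have e : (PowerSeries.X : k⟦X⟧) • (U.1.mkQ ∘ₗ q) =
      (U.1.mkQ ∘ₗ T.augProj) ∘ₗ C.alg.val.toLinearMap :=
    LinearMap.ext fun b => by
      rw [LinearMap.smul_apply, LinearMap.comp_apply, ← map_smul, hq]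
      rfl
  have h1 : IsOpen (LinearMap.ker ((U.1.mkQ ∘ₗ T.augProj) ∘ₗ C.alg.val.toLinearMap) : Set C.alg) :=
    (T.isOpen_ker_augProj U).preimage C.continuous_val_alg
  rw [← C.algHopf.powComul_smul _ _ _ _ e.symm h1]
  exact powComul_hom C.isHom_val _ (T.isOpen_ker_augProj U) h1 n ⟨a, ha⟩

theorem prime_eq [IsTopologicalAddGroup H] [ContinuousSMul k⟦X⟧ H] :
    T.prime (PowerSeries.X : k⟦X⟧) = C.divided :=
  le_antisymm (fun _ => C.mem_divided_of_mem_prime) fun _ => C.mem_prime_of_mem_divided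

end TopHopf.Coords

end

noncomputable section

/-! ## First order expansions -/

theorem eq_single_of_sum_eq_one {d : ℕ} {e : Fin d → ℕ} (h : ∑ i, e i = 1) :
    ∃ i, e = Pi.single i 1 := by
  rw [← sortedWord_length, List.length_eq_one_iff] at h
  obtain ⟨i, hi⟩ := h
  exact ⟨i, sortedWord_perm (by rw [hi, sortedWord_single])⟩

theorem sum_single {d : ℕ} (i : Fin d) : ∑ j, (Pi.single i 1 : Fin d → ℕ) j = 1 := by
  rw [← sortedWord_length, sortedWord_single, List.length_singleton]

theorem sum_lowDegree_sub_mem {R M : Type*} [Ring R] [AddCommGroup M] [Module R M] {d m : ℕ}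
    (hm : 2 ≤ m) (W : Submodule R M) (F : (Fin d → ℕ) → M)
    (hF : ∀ e : Fin d → ℕ, 2 ≤ ∑ i, e i → F e ∈ W) :
    ∑ e ∈ lowDegree d m, F e - (F 0 + ∑ i, F (Pi.single i 1)) ∈ W := by
  classical
  have h0 : (0 : Fin d → ℕ) ∉ Finset.univ.image fun i : Fin d => (Pi.single i 1 : Fin d → ℕ) := by
    rw [Finset.mem_image]
    rintro ⟨i, -, hi⟩
    have := sum_single i
    rw [hi] at this
    simp at this
  have hinj : Function.Injective fun i : Fin d => (Pi.single i 1 : Fin d → ℕ) := by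
    intro i j hij
    have := congrArg sortedWord hij
    simpa [sortedWord_single] using this
  have e1 : F 0 + ∑ i, F (Pi.single i 1) = ∑ e ∈ insert 0 (Finset.univ.image fun i : Fin d =>
      (Pi.single i 1 : Fin d → ℕ)), F e := by
    rw [Finset.sum_insert h0, Finset.sum_image fun i _ j _ h => hinj h]
  have hsub : insert 0 (Finset.univ.image fun i : Fin d => (Pi.single i 1 : Fin d → ℕ)) ⊆
      lowDegree d m := by
    intro e he
    rw [mem_lowDegree]
    rcases Finset.mem_insert.1 he with rfl | he
    · simp; omega
    · obtain ⟨i, -, rfl⟩ := Finset.mem_image.1 he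
      rw [sum_single]
      omega
  rw [e1, ← Finset.sum_sdiff hsub, add_sub_cancel_right]
  refine sum_mem fun e he => hF e ?_
  rw [Finset.mem_sdiff, Finset.mem_insert, Finset.mem_image, not_or] at he
  by_contra! hlt
  rcases Nat.lt_succ_iff_lt_or_eq.1 hlt with h | h
  · refine he.2.1 (sortedWord_perm ?_)
    have : sortedWord e = [] := by
      rw [← List.length_eq_zero_iff, sortedWord_length]
      omega
    rw [this, sortedWord_zero]
  · obtain ⟨i, rfl⟩ := eq_single_of_sum_eq_one h
    exact he.2.2 ⟨i, Finset.mem_univ _, rfl⟩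

namespace TopHopf.Coords

variable {k H : Type*} [Field k] [Ring H] [Algebra k⟦X⟧ H] [TopologicalSpace H]
  {T : TopHopf k⟦X⟧ H} {hH : IsTopFree k H} {d : ℕ} (C : T.Coords hH d)

theorem coord_single (i : Fin d) : C.coord (Pi.single i 1) = C.t i := by
  rw [coord, sortedWord_single, wordCoord_singleton]

theorem dop_single (i : Fin d) : C.dop (Pi.single i 1) = C.dword [i] := by
  rw [dop, sortedWord_single]

theorem t_y (i : Fin d) (e : Fin d → ℕ) : C.t i (C.y e) = if Pi.single i 1 = e then 1 else 0 := by
  rw [← coord_single, coord_y]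

theorem alg_pow_smul_cancel {n : ℕ} {x y : C.alg}
    (h : (PowerSeries.X : k⟦X⟧) ^ n • x = (PowerSeries.X : k⟦X⟧) ^ n • y) : x = y :=
  Subtype.ext (hH.pow_smul_cancel (congrArg Subtype.val h))

theorem alg_pow_smul_mem {m n : ℕ} {x : C.alg}
    (h : (PowerSeries.X : k⟦X⟧) ^ m • x ∈ hSub k C.alg (m + n)) : x ∈ hSub k C.alg n := by
  obtain ⟨y, hy⟩ := mem_hSub.1 h
  rw [pow_add, mul_smul] at hy
  rw [C.alg_pow_smul_cancel hy]
  exact pow_smul_mem_hSub _ _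

/-- `h^N C.alg` is closed for the topology induced from `H`. Expansions known only modulo powers of
`h` in `H` can therefore be used for congruences modulo `h^N C.alg`. -/
theorem mem_hSub_alg_of_forall {N : ℕ} {z : C.alg}
    (h : ∀ n, ∃ w ∈ hSub k C.alg N, z - w ∈ C.algSub n) : z ∈ hSub k C.alg N := by
  obtain ⟨a, rfl⟩ := C.exists_smul_eq (n := N) (a := z) fun e => by
    obtain ⟨w, hw, hz⟩ := h (∑ i, e i + N)
    have h1 := X_pow_dvd_cancel (C.mem_algSub_iff.1 hz e)
    rw [map_sub] at h1
    exact (dvd_sub_left (mem_hSub_self.1 (map_mem_hSub (C.dcoord e) hw))).1 h1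
  exact pow_smul_mem_hSub _ _

theorem pow_smul_dword_singleton (i : Fin d) (a : C.alg) :
    (PowerSeries.X : k⟦X⟧) • (C.dword [i] a : H) = T.slice hH (C.t i) a := by
  rw [← wordOp_singleton, ← pow_smul_dword, List.length_singleton, pow_one]

/-- Expansion of the operators `C.dword [i]` on products to the second order. -/
theorem dword_mul (i : Fin d) (x y : C.alg) :
    (PowerSeries.X : k⟦X⟧) • C.dword [i] (x * y) -
      ((PowerSeries.X : k⟦X⟧) • (C.dword [i] x * y + x * C.dword [i] y) +
        (PowerSeries.X : k⟦X⟧) ^ 2 • ∑ l, ∑ j, C.t i (C.y (Pi.single l 1) * C.y (Pi.single j 1)) •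
          (C.dword [l] x * C.dword [j] y)) ∈ hSub k C.alg 3 := by
  refine C.mem_hSub_alg_of_forall fun n => ?_
  obtain ⟨m, hm, hm2⟩ := ((eventually_slice_mul (C := C) (C.t i) n (x : H) (y : H)).and
    (eventually_ge_atTop 2)).exists
  let G : (Fin d → ℕ) → (Fin d → ℕ) → C.alg := fun e f =>
    (C.t i (C.y e * C.y f) * PowerSeries.X ^ (∑ l, e l + ∑ l, f l)) • (C.dop e x * C.dop f y)
  have hG : (PowerSeries.X : k⟦X⟧) • C.dword [i] (x * y) -
      ∑ e ∈ lowDegree d m, ∑ f ∈ lowDegree d m, G e f ∈ C.algSub n := by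
    rw [mem_algSub]
    convert hm using 1
    rw [Subalgebra.coe_sub, Subalgebra.coe_smul, pow_smul_dword_singleton, Subalgebra.coe_mul,
      AddSubmonoidClass.coe_finsetSum]
    congr 1
    refine Finset.sum_congr rfl fun e _ => ?_
    rw [AddSubmonoidClass.coe_finsetSum]
    refine Finset.sum_congr rfl fun f _ => ?_
    rw [Subalgebra.coe_smul, Subalgebra.coe_mul, mul_smul, pow_add, ← smul_mul_smul_comm,
      pow_smul_dop, pow_smul_dop]
  have hW : ∀ e f, 3 ≤ ∑ l, e l + ∑ l, f l → G e f ∈ hSub k C.alg 3 := fun e f h =>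
    smul_mem_hSub (Dvd.dvd.mul_left (pow_dvd_pow _ h) _) _
  have hne : ∀ e : Fin d → ℕ, 2 ≤ ∑ l, e l → ¬ (Pi.single i 1 = e) := by
    rintro _ h rfl
    rw [sum_single] at h
    omega
  -- Terms with one index equal to `0` involve `t i (y_e)`, which is nonzero only for the `i`-th
  -- unit vector. Hence terms outside degrees `(0,1)`, `(1,0)` and `(1,1)` are zero or divisible by
  -- `h^3`.
  have hG0 : ∀ e, 2 ≤ ∑ l, e l → G e 0 = 0 := fun e he => by
    simp only [G]
    rw [y_zero, mul_one, t_y, if_neg (hne e he), zero_mul, zero_smul]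
  have h0G : ∀ f, 2 ≤ ∑ l, f l → G 0 f = 0 := fun f hf => by
    simp only [G]
    rw [y_zero, one_mul, t_y, if_neg (hne f hf), zero_mul, zero_smul]
  have e1 := sum_lowDegree_sub_mem hm2 (hSub k C.alg 3)
    (fun e => ∑ f ∈ lowDegree d m, G e f) fun e he => sum_mem fun f _ => by
      by_cases hf : f = 0
      · rw [hf, hG0 e he]; exact zero_mem _
      · have := sum_pos_of_ne_zero hf
        exact hW e f (by omega)
  have e2 := sum_lowDegree_sub_mem hm2 (hSub k C.alg 3) (fun f => G 0 f) fun f hf => by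
    rw [h0G f hf]; exact zero_mem _
  have e3 := fun l => sum_lowDegree_sub_mem hm2 (hSub k C.alg 3) (fun f => G (Pi.single l 1) f)
    fun f hf => hW _ f (by rw [sum_single]; omega)
  have e4 := add_mem e1 (add_mem e2 (sum_mem fun l (_ : l ∈ Finset.univ) => e3 l))
  have h00 : G 0 0 = 0 := by
    simp only [G]
    rw [y_zero, mul_one, C.t_one, zero_mul, zero_smul]
  have g1 : ∑ l, G 0 (Pi.single l 1) = (PowerSeries.X : k⟦X⟧) • (x * C.dword [i] y) := by
    rw [Finset.sum_eq_single i]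
    · simp only [G]
      rw [y_zero, one_mul, t_y, if_pos rfl, sum_single, dop_zero, dop_single, one_mul]
      simp
    · intro l _ hl
      simp only [G]
      rw [y_zero, one_mul, t_y, if_neg, zero_mul, zero_smul]
      intro h
      have := congrArg sortedWord h
      rw [sortedWord_single, sortedWord_single, List.singleton_inj] at this
      exact hl this.symm
    · simp
  have g2 : ∑ l, G (Pi.single l 1) 0 = (PowerSeries.X : k⟦X⟧) • (C.dword [i] x * y) := by
    rw [Finset.sum_eq_single i]
    · simp only [G]
      rw [y_zero, mul_one, t_y, if_pos rfl, sum_single, dop_zero, dop_single, one_mul]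
      simp
    · intro l _ hl
      simp only [G]
      rw [y_zero, mul_one, t_y, if_neg, zero_mul, zero_smul]
      intro h
      have := congrArg sortedWord h
      rw [sortedWord_single, sortedWord_single, List.singleton_inj] at this
      exact hl this.symm
    · simp
  have g3 : ∑ l, ∑ j, G (Pi.single l 1) (Pi.single j 1) = (PowerSeries.X : k⟦X⟧) ^ 2 •
      ∑ l, ∑ j, C.t i (C.y (Pi.single l 1) * C.y (Pi.single j 1)) •
          (C.dword [l] x * C.dword [j] y) := by
    rw [Finset.smul_sum]
    refine Finset.sum_congr rfl fun l _ => ?_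
    rw [Finset.smul_sum]
    refine Finset.sum_congr rfl fun j _ => ?_
    simp only [G]
    rw [sum_single, sum_single, dop_single, dop_single, mul_comm, mul_smul]
  simp only [Finset.sum_sub_distrib, Finset.sum_add_distrib] at e4
  rw [g1, g2, g3, h00] at e4
  refine ⟨_, e4, ?_⟩
  convert hG using 1
  rw [smul_add]
  abel

theorem dword_mul_sub_mem (i : Fin d) (x y : C.alg) :
    C.dword [i] (x * y) - (C.dword [i] x * y + x * C.dword [i] y) ∈ hSub k C.alg 1 := by
  refine C.alg_pow_smul_mem (m := 1) ?_
  have h := add_mem (hSub_anti (by norm_num : 2 ≤ 3) (C.dword_mul i x y))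
    (pow_smul_mem_hSub (k := k) 2 (∑ l, ∑ j, C.t i (C.y (Pi.single l 1) * C.y (Pi.single j 1)) •
          (C.dword [l] x * C.dword [j] y)))
  convert h using 1
  rw [pow_one, smul_sub]
  abel

/-- Antisymmetrise `dword_mul` in `x` and `y` and divide by `h^2`. Commutativity modulo `h` allows
the factors of the quadratic terms to be reordered, so their coefficients combine into `t i` of a
commutator. -/
theorem dword_poisson_sub_mem (i : Fin d) {x y z x' y' : C.alg}
    (hz : (PowerSeries.X : k⟦X⟧) • z = x * y - y * x)
    (hx' : (PowerSeries.X : k⟦X⟧) • x' = C.dword [i] x * y - y * C.dword [i] x)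
    (hy' : (PowerSeries.X : k⟦X⟧) • y' = x * C.dword [i] y - C.dword [i] y * x)
    (hc : ∀ a b : C.alg, a * b - b * a ∈ hSub k C.alg 1) :
    C.dword [i] z - (x' + y' + ∑ l, ∑ j, C.t i (C.y (Pi.single l 1) * C.y (Pi.single j 1) -
      C.y (Pi.single j 1) * C.y (Pi.single l 1)) • (C.dword [l] x * C.dword [j] y)) ∈
        hSub k C.alg 1 := by
  refine C.alg_pow_smul_mem (m := 2) ?_
  have h1 := sub_mem (C.dword_mul i x y) (C.dword_mul i y x)
  have h2 : (PowerSeries.X : k⟦X⟧) ^ 2 • ∑ l, ∑ j,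
      C.t i (C.y (Pi.single j 1) * C.y (Pi.single l 1)) •
        (C.dword [l] x * C.dword [j] y - C.dword [j] y * C.dword [l] x) ∈ hSub k C.alg 3 :=
    smul_mem_hSub_add (m := 2) (n := 1) dvd_rfl
      (sum_mem fun l _ => sum_mem fun j _ => Submodule.smul_mem _ _ (hc _ _))
  have h3 : (PowerSeries.X : k⟦X⟧) • C.dword [i] (x * y) - (PowerSeries.X : k⟦X⟧) •
      C.dword [i] (y * x) = (PowerSeries.X : k⟦X⟧) ^ 2 • C.dword [i] z := by
    rw [← smul_sub, ← map_sub, ← hz, map_smul, smul_smul, pow_two]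
  have h4 : (PowerSeries.X : k⟦X⟧) ^ 2 • (x' + y') = (PowerSeries.X : k⟦X⟧) •
      (C.dword [i] x * y + x * C.dword [i] y) - (PowerSeries.X : k⟦X⟧) •
        (C.dword [i] y * x + y * C.dword [i] x) := by
    rw [pow_two, mul_smul, smul_add, hx', hy', ← smul_sub]
    congr 1
    abel
  have h5 : ∑ l, ∑ j, C.t i (C.y (Pi.single l 1) * C.y (Pi.single j 1) -
      C.y (Pi.single j 1) * C.y (Pi.single l 1)) • (C.dword [l] x * C.dword [j] y) =
      ∑ l, ∑ j, C.t i (C.y (Pi.single l 1) * C.y (Pi.single j 1)) •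
        (C.dword [l] x * C.dword [j] y) -
      ∑ l, ∑ j, C.t i (C.y (Pi.single l 1) * C.y (Pi.single j 1)) •
        (C.dword [l] y * C.dword [j] x) -
      ∑ l, ∑ j, C.t i (C.y (Pi.single j 1) * C.y (Pi.single l 1)) •
        (C.dword [l] x * C.dword [j] y - C.dword [j] y * C.dword [l] x) := by
    rw [Finset.sum_comm (f := fun l j => C.t i (C.y (Pi.single l 1) * C.y (Pi.single j 1)) •
        (C.dword [l] y * C.dword [j] x)), ← Finset.sum_sub_distrib, ← Finset.sum_sub_distrib]
    refine Finset.sum_congr rfl fun l _ => ?_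
    rw [← Finset.sum_sub_distrib, ← Finset.sum_sub_distrib]
    refine Finset.sum_congr rfl fun j _ => ?_
    rw [map_sub, sub_smul, smul_sub]
    abel
  have h6 := add_mem h1 h2
  convert h6 using 1
  rw [h5, smul_sub, smul_add, h4, ← h3, smul_sub, smul_sub]
  abel

/-- By `hc`, `h` times the commutator of the divided operators is `slice c = ∑ c(y_e) h^|e| dop e`.
The constant term vanishes by `hc1`, and after division by `h` the terms with `|e| ≥ 2` vanish
modulo `h`. -/
theorem dword_lie_sub_mem (i j : Fin d) (c : H →ₗ[k⟦X⟧] k⟦X⟧) (hc1 : c 1 = 0)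
    (hc : ∀ x, T.slice hH (C.t i) (T.slice hH (C.t j) x) =
      T.slice hH (C.t j) (T.slice hH (C.t i) x) + (PowerSeries.X : k⟦X⟧) • T.slice hH c x)
    (a : C.alg) : C.dword [i] (C.dword [j] a) - C.dword [j] (C.dword [i] a) -
      ∑ l, c (C.y (Pi.single l 1)) • C.dword [l] a ∈ hSub k C.alg 1 := by
  refine C.alg_pow_smul_mem (m := 1) (C.mem_hSub_alg_of_forall fun n => ?_)
  obtain ⟨m, hm, hm2⟩ := ((C.eventually_slice_sub c n (a : H)).and
    (eventually_ge_atTop 2)).exists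
  have h1 : (PowerSeries.X : k⟦X⟧) •
      ((C.dword [i] (C.dword [j] a) - C.dword [j] (C.dword [i] a) : C.alg) : H) =
        T.slice hH c a := by
    refine hH.pow_smul_cancel (n := 1) ?_
    rw [pow_one, Subalgebra.coe_sub, smul_sub, pow_smul_dword_singleton,
      pow_smul_dword_singleton, smul_sub, ← map_smul, ← map_smul, pow_smul_dword_singleton,
      pow_smul_dword_singleton, hc, add_sub_cancel_left]
  let F : (Fin d → ℕ) → C.alg := fun e =>
    (c (C.y e) * PowerSeries.X ^ (∑ l, e l)) • C.dop e a
  have hF : (PowerSeries.X : k⟦X⟧) • (C.dword [i] (C.dword [j] a) - C.dword [j] (C.dword [i] a)) -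
      ∑ e ∈ lowDegree d m, F e ∈ C.algSub n := by
    rw [mem_algSub]
    convert hm using 1
    rw [Subalgebra.coe_sub, Subalgebra.coe_smul, h1, AddSubmonoidClass.coe_finsetSum]
    congr 1
    refine Finset.sum_congr rfl fun e _ => ?_
    rw [Subalgebra.coe_smul, mul_smul, pow_smul_dop]
  have e1 := sum_lowDegree_sub_mem hm2 (hSub k C.alg (1 + 1)) F fun e he =>
    smul_mem_hSub (Dvd.dvd.mul_left (pow_dvd_pow _ he) _) _
  have h0 : F 0 = 0 := by
    simp only [F]
    rw [y_zero, hc1, zero_mul, zero_smul]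
  have hs : ∑ l, F (Pi.single l 1) = (PowerSeries.X : k⟦X⟧) •
      ∑ l, c (C.y (Pi.single l 1)) • C.dword [l] a := by
    rw [Finset.smul_sum]
    refine Finset.sum_congr rfl fun l _ => ?_
    simp only [F]
    rw [sum_single, dop_single, pow_one, mul_comm, mul_smul]
  rw [h0, hs, zero_add] at e1
  refine ⟨_, e1, ?_⟩
  convert hF using 1
  rw [pow_one, smul_sub]
  abel

/-- The divided coordinates of the coproduct. -/
theorem eventually_dcoord₂ (x : C.alg) (e f : Fin d → ℕ) :
    ∀ᶠ t in CTensor.approx (C.algComul x),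
      (PowerSeries.X : k⟦X⟧) ∣ C.dcoord₂ e f t - C.dcoord e (C.dop f x) := by
  have key : ∀ᶠ m in atTop, C.dcoord₂ e f (C.algExpansion m x) = C.dcoord e (C.dop f x) := by
    filter_upwards [eventually_gt_atTop (∑ i, f i)] with m hm
    rw [algExpansion_apply, map_sum, Finset.sum_eq_single f]
    · rw [dcoord₂_tmul, dcoord_dy, if_pos rfl, mul_one]
    · intro e' _ he'
      rw [dcoord₂_tmul, dcoord_dy, if_neg he'.symm, mul_zero]
    · intro h
      exact absurd (mem_lowDegree.2 hm) h
  -- `N` exceeds both degrees, so divided coordinates of elements of `h^N H` are still divisible by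
  -- `h`.
  set N := ∑ i, e i + ∑ i, f i + 1
  have hN : ∀ (e : Fin d → ℕ), ∑ i, e i + 1 ≤ N → ∀ u ∈ (C.algOpen N).1,
      (PowerSeries.X : k⟦X⟧) ∣ C.dcoord e u := by
    intro e he u hu
    rw [← pow_one (PowerSeries.X : k⟦X⟧)]
    exact X_pow_dvd_cancel (m := ∑ i, e i) ((pow_dvd_pow _ he).trans (C.mem_algSub_iff.1 hu e))
  obtain ⟨m, hm, hm'⟩ := (key.and (eventually_ge_atTop (C.level (C.algOpen N)))).exists
  refine CTensor.eventually_approx.2 ⟨C.algOpen N, fun t ht => ?_⟩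
  rw [C.proj_algComul _ hm'] at ht
  rw [← hm, ← pow_one (PowerSeries.X : k⟦X⟧), ← mem_hSub_self]
  refine tensorMk_sub_mem ht (hSub k k⟦X⟧ 1) (C.dcoord₂ e f) (fun u hu a => ?_) (fun u hu a => ?_)
  · rw [mem_hSub_self, dcoord₂_tmul, pow_one]
    exact Dvd.dvd.mul_right (hN e (by omega) u hu) _
  · rw [mem_hSub_self, dcoord₂_tmul, pow_one]
    exact Dvd.dvd.mul_left (hN f (by omega) u hu) _

end TopHopf.Coords

end

noncomputable section

/-! ## The reduction of `C.alg` modulo `h` -/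

namespace TopHopf.Coords

attribute [local instance] LieRing.ofAssociativeRing

variable {k H : Type*} [Field k] [Ring H] [Algebra k⟦X⟧ H] [TopologicalSpace H]
  {T : TopHopf k⟦X⟧ H} {hH : IsTopFree k H} {d : ℕ} (C : T.Coords hH d)
  {L : Type*} [LieRing L] [LieAlgebra k L] (β : Module.Basis (Fin d) k L)

/-- The operators `C.dword [i]` satisfy modulo `h` the relations of the Lie algebra with basis
`β`. -/
def LieRel : Prop := ∀ i j a, C.dword [i] (C.dword [j] a) - C.dword [j] (C.dword [i] a) -
  ∑ l, PowerSeries.C (β.repr ⁅β i, β j⁆ l) • C.dword [l] a ∈ hSub k C.alg 1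

/-- The algebra of endomorphisms, acting from the right, of the semilinear functionals. -/
abbrev FunctionalEnd : Type _ :=
  (Module.End k (C.alg →ₛₗ[PowerSeries.constantCoeff (R := k)] k))ᵐᵒᵖ

/-- Composition of semilinear functionals with an endomorphism. -/
def functionalComp (D : Module.End k⟦X⟧ C.alg) :
    Module.End k (C.alg →ₛₗ[PowerSeries.constantCoeff (R := k)] k) where
  toFun f := f.comp D
  map_add' _ _ := rfl
  map_smul' _ _ := rfl

variable {C} in
theorem functional_eq_zero (f : C.alg →ₛₗ[PowerSeries.constantCoeff (R := k)] k) {a : C.alg}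
    (ha : a ∈ hSub k C.alg 1) : f a = 0 := by
  obtain ⟨z, rfl⟩ := mem_hSub.1 ha
  rw [map_smulₛₗ, pow_one, PowerSeries.constantCoeff_X, zero_smul]

variable {C β} in
/-- The right action of the enveloping algebra on the semilinear functionals of `C.alg`. -/
def rightAction (h : C.LieRel β) : UniversalEnvelopingAlgebra k L →ₐ[k]
    C.FunctionalEnd :=
  UniversalEnvelopingAlgebra.lift k
    { β.constr k fun i => MulOpposite.op (C.functionalComp (C.dword [i])) with
      map_lie' := fun {x y} => by
        let r : L →ₗ[k] C.FunctionalEnd :=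
          β.constr k fun i => MulOpposite.op (C.functionalComp (C.dword [i]))
        change r ⁅x, y⁆ = ⁅r x, r y⁆
        -- The bracket relation is written as an identity of bilinear maps, to be tested on the
        -- basis. `LieRel` holds only modulo `h`, which is enough because semilinear functionals
        -- kill `h C.alg`.
        have h1 : (LieModule.toEnd k L L : L →ₗ[k] Module.End k L).compr₂ r +
            LinearMap.compl₁₂ (LinearMap.mul k C.FunctionalEnd).flip r r =
              LinearMap.compl₁₂ (LinearMap.mul k C.FunctionalEnd) r r := by
          refine β.ext fun i => β.ext fun j => ?_
          apply MulOpposite.unop_injective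
          refine LinearMap.ext fun f => LinearMap.ext fun a => ?_
          have hi : ∀ i, r (β i) = MulOpposite.op (C.functionalComp (C.dword [i])) :=
            fun i => β.constr_basis k _ i
          have e1 : r ⁅β i, β j⁆ = ∑ l, β.repr ⁅β i, β j⁆ l •
              MulOpposite.op (C.functionalComp (C.dword [l])) := β.constr_apply_fintype k _ _
          have e2 := functional_eq_zero f (h i j a)
          rw [map_sub, map_sub, map_sum, sub_eq_zero] at e2
          simp only [map_smulₛₗ, PowerSeries.constantCoeff_C] at e2
          change (r ⁅β i, β j⁆ + r (β j) * r (β i)).unop f a = (r (β i) * r (β j)).unop f a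
          rw [e1, hi, hi, MulOpposite.unop_add, Finset.unop_sum, LinearMap.add_apply,
            LinearMap.add_apply, LinearMap.sum_apply, LinearMap.sum_apply]
          exact eq_sub_iff_add_eq.1 e2.symm
        exact eq_sub_of_add_eq (LinearMap.congr_fun (LinearMap.congr_fun h1 x) y) }

theorem rightAction_ι (h : C.LieRel β) (i : Fin d) :
    rightAction h (UniversalEnvelopingAlgebra.ι k (β i)) =
      MulOpposite.op (C.functionalComp (C.dword [i])) :=
  (UniversalEnvelopingAlgebra.lift_ι_apply k _ _).trans (β.constr_basis k _ i)

/-- The counit of `C.alg` modulo `h`. -/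
def algCounit₀ : C.alg →ₛₗ[PowerSeries.constantCoeff (R := k)] k where
  toFun a := PowerSeries.constantCoeff (T.counit (a : H))
  map_add' a b := by rw [Subalgebra.coe_add, map_add, map_add]
  map_smul' r a := by rw [Subalgebra.coe_smul, map_smul, smul_eq_mul, RingHom.map_mul, smul_eq_mul]

variable {C β} in
/-- The reduction map from `C.alg` to the dual of the enveloping algebra. -/
def phi (h : C.LieRel β) : C.alg →ₛₗ[PowerSeries.constantCoeff (R := k)] FormalSeries k L where
  toFun a :=
    -- On a word this is the constant term of `ε` applied to the composite of the operators `C.dword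
    -- [i]` along it.
    { toFun := fun u => (rightAction h u).unop C.algCounit₀ a
      map_add' := fun u v => by rw [map_add]; rfl
      map_smul' := fun c u => by rw [map_smul]; rfl }
  map_add' a b := LinearMap.ext fun u => map_add ((rightAction h u).unop C.algCounit₀) a b
  map_smul' r a := LinearMap.ext fun u => map_smulₛₗ ((rightAction h u).unop C.algCounit₀) r a

variable {C β} (h : C.LieRel β)

theorem phi_apply_one (a : C.alg) : phi h a 1 = PowerSeries.constantCoeff (T.counit (a : H)) := by
  change (rightAction h 1).unop C.algCounit₀ a = _
  rw [map_one]
  rfl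

theorem phi_mul_ι (a : C.alg) (u : UniversalEnvelopingAlgebra k L) (i : Fin d) :
    phi h a (u * UniversalEnvelopingAlgebra.ι k (β i)) = phi h (C.dword [i] a) u := by
  change (rightAction h (u * UniversalEnvelopingAlgebra.ι k (β i))).unop C.algCounit₀ a =
    (rightAction h u).unop C.algCounit₀ (C.dword [i] a)
  rw [map_mul, rightAction_ι]
  rfl

theorem phi_mul_word (l : List (Fin d)) (a : C.alg) (u : UniversalEnvelopingAlgebra k L) :
    phi h a (u * Env.word β l) = phi h (C.dword l a) u := by
  induction l using List.reverseRecOn generalizing a with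
  | nil => rw [Env.word_nil, mul_one, dword_nil]
  | append_singleton l i ih =>
    rw [Env.word_append, ← mul_assoc, Env.word_cons, Env.word_nil, mul_one, phi_mul_ι, ih,
      ← dword_append]

theorem phi_word (l : List (Fin d)) (a : C.alg) :
    phi h a (Env.word β l) = PowerSeries.constantCoeff (T.counit (C.dword l a : H)) := by
  rw [← one_mul (Env.word β l), phi_mul_word, phi_apply_one]

theorem phi_sortedWord (e : Fin d → ℕ) (a : C.alg) :
    phi h a (Env.word β (sortedWord e)) = PowerSeries.constantCoeff (C.dcoord e a) :=
  phi_word h _ a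

theorem exists_eq_sum_word (u : UniversalEnvelopingAlgebra k L) : ∃ (n : ℕ) (c : (Fin d → ℕ) → k),
    u = ∑ e ∈ lowDegree d n, c e • Env.word β (sortedWord e) := by
  obtain ⟨n, hn⟩ := Env.exists_mem_fil β u
  exact ⟨n, Env.exists_eq_sum β hn⟩

theorem formalSeries_ext {F G : FormalSeries k L}
    (hFG : ∀ e, F (Env.word β (sortedWord e)) = G (Env.word β (sortedWord e))) : F = G := by
  refine LinearMap.ext fun u => ?_
  obtain ⟨n, c, rfl⟩ := exists_eq_sum_word (β := β) u
  simp only [map_sum, map_smul, hFG]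

theorem phi_eq_zero_of_mem {a : C.alg} (ha : a ∈ hSub k C.alg 1) : phi h a = 0 := by
  obtain ⟨z, rfl⟩ := mem_hSub.1 ha
  rw [map_smulₛₗ, pow_one, PowerSeries.constantCoeff_X, zero_smul]

theorem phi_eq_of_sub_mem {a b : C.alg} (hab : a - b ∈ hSub k C.alg 1) : phi h a = phi h b := by
  rw [← sub_eq_zero, ← map_sub]
  exact phi_eq_zero_of_mem h hab

/-- The values on ordered words are the divided coordinates modulo `h`; if all of them vanish, `a`
is divisible by `h` within `C.alg`. -/
theorem phi_eq_zero_iff (a : C.alg) :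
    phi h a = 0 ↔ ∃ z : C.alg, a = (PowerSeries.X : k⟦X⟧) • z := by
  constructor
  · intro ha
    obtain ⟨z, hz⟩ := C.exists_smul_eq (n := 1) (a := a) fun e => by
      rw [pow_one, PowerSeries.X_dvd_iff, ← phi_sortedWord h, ha, LinearMap.zero_apply]
    exact ⟨z, by rw [hz, pow_one]⟩
  · rintro ⟨z, rfl⟩
    exact phi_eq_zero_of_mem h (mem_hSub.2 ⟨z, by rw [pow_one]⟩)

theorem constantCoeff_dcoord_eq {n : ℕ} {a b : C.alg} (hab : a - b ∈ C.algSub n)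
    {e : Fin d → ℕ} (he : ∑ i, e i < n) : PowerSeries.constantCoeff (C.dcoord e a) =
      PowerSeries.constantCoeff (C.dcoord e b) := by
  rw [← sub_eq_zero, ← map_sub, ← map_sub, ← PowerSeries.X_dvd_iff, ← pow_one PowerSeries.X]
  exact X_pow_dvd_cancel (m := ∑ i, e i) ((pow_dvd_pow _ he).trans (C.mem_algSub_iff.1 hab e))

theorem isOpenQuotientMap_phi : @IsOpenQuotientMap C.alg (FormalSeries k L) _
    (FormalSeries.weakTopology k L) (phi h) := by
  let _ : TopologicalSpace (FormalSeries k L) := FormalSeries.weakTopology k L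
  let _ : TopologicalSpace k := ⊥
  have : DiscreteTopology k := ⟨rfl⟩
  -- The lift of `F` copies the divided coordinates of `a` in low degree and takes the values of `F`
  -- as constants elsewhere. This gives surjectivity and openness together.
  have surj : ∀ (a : C.alg) (n : ℕ) (F : FormalSeries k L),
      (∀ e ∈ lowDegree d n, F (Env.word β (sortedWord e)) =
        phi h a (Env.word β (sortedWord e))) → ∃ b : C.alg, b - a ∈ C.algSub n ∧ phi h b = F := by
    intro a n F hF
    obtain ⟨b, hb⟩ := C.exists_dcoord_eq fun e => if e ∈ lowDegree d n then C.dcoord e a else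
      PowerSeries.C (F (Env.word β (sortedWord e)))
    refine ⟨b, C.mem_algSub_iff.2 fun e => ?_, formalSeries_ext (β := β) fun e => ?_⟩
    · rw [map_sub, hb]
      split_ifs with he
      · rw [sub_self, mul_zero]; exact dvd_zero _
      · rw [mem_lowDegree, not_lt] at he
        exact Dvd.dvd.mul_right (pow_dvd_pow _ he) _
    · rw [phi_sortedWord, hb]
      split_ifs with he
      · rw [hF e he, phi_sortedWord]
      · rw [PowerSeries.constantCoeff_C]
  refine ⟨fun F => ?_, ?_, ?_⟩
  · obtain ⟨b, -, hb⟩ := surj 0 0 F fun e he => absurd (mem_lowDegree.1 he) (Nat.not_lt_zero _)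
    exact ⟨b, hb⟩
  · refine continuous_induced_rng.2 (continuous_pi fun u => ?_)
    obtain ⟨n, c, hu⟩ := exists_eq_sum_word (β := β) u
    rw [continuous_def]
    intro s _
    refine C.isOpen_alg_iff.2 fun a ha => ⟨n, fun b hb => ?_⟩
    have : phi h b u = phi h a u := by
      rw [hu, map_sum, map_sum]
      refine Finset.sum_congr rfl fun e he => ?_
      rw [map_smul, map_smul, phi_sortedWord, phi_sortedWord,
        constantCoeff_dcoord_eq hb (mem_lowDegree.1 he)]
    change phi h b u ∈ s
    rw [this]
    exact ha
  · intro s hs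
    rw [isOpen_iff_mem_nhds]
    rintro _ ⟨a, ha, rfl⟩
    obtain ⟨n, hn⟩ := C.isOpen_alg_iff.1 hs a ha
    have hopen : {F : FormalSeries k L | ∀ e ∈ lowDegree d n, F (Env.word β (sortedWord e)) =
        phi h a (Env.word β (sortedWord e))} ∈ 𝓝 (phi h a) := by
      refine (Filter.eventually_all_finset _).2 fun e _ => ?_
      have hc : Continuous fun F : FormalSeries k L => F (Env.word β (sortedWord e)) :=
        (continuous_apply _).comp continuous_induced_dom
      exact hc.continuousAt.eventually (IsOpen.mem_nhds (isOpen_discrete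
        {phi h a (Env.word β (sortedWord e))}) rfl)
    refine Filter.mem_of_superset hopen fun F hF => ?_
    obtain ⟨b, hb, hb'⟩ := surj a n F hF
    exact ⟨b, hn b hb, hb'⟩

/-- On a pair of ordered words both sides are the constant term of `C.dcoord e (C.dop f x)`. A given
`u` involves finitely many such pairs. -/
theorem phi_comul (x : C.alg)
    (u : UniversalEnvelopingAlgebra k L ⊗[k] UniversalEnvelopingAlgebra k L) :
    ∀ᶠ t in CTensor.approx (C.algComul x), FormalSeries.pair
      (TensorProduct.map (phi h) (phi h) t) u = FormalSeries.comul (phi h x) u := by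
  have key : ∀ e f t, FormalSeries.pair (TensorProduct.map (phi h) (phi h) t)
      (Env.word β (sortedWord e) ⊗ₜ Env.word β (sortedWord f)) =
        PowerSeries.constantCoeff (C.dcoord₂ e f t) := by
    intro e f t
    induction t with
    | zero => simp
    | tmul a b =>
      rw [TensorProduct.map_tmul, FormalSeries.pair, TensorProduct.dualDistrib_apply,
        phi_sortedWord, phi_sortedWord, dcoord₂_tmul, RingHom.map_mul]
    | add s t hs ht => simp only [map_add, LinearMap.add_apply, hs, ht]
  have key' : ∀ e f, ∀ᶠ t in CTensor.approx (C.algComul x), FormalSeries.pair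
      (TensorProduct.map (phi h) (phi h) t)
        (Env.word β (sortedWord e) ⊗ₜ Env.word β (sortedWord f)) = FormalSeries.comul (phi h x)
          (Env.word β (sortedWord e) ⊗ₜ Env.word β (sortedWord f)) := by
    intro e f
    filter_upwards [C.eventually_dcoord₂ x e f] with t ht
    rw [key, FormalSeries.comul, LinearMap.comp_apply, LinearMap.mul'_apply, phi_mul_word,
      phi_sortedWord, ← sub_eq_zero, ← map_sub, ← PowerSeries.X_dvd_iff]
    exact ht
  induction u with
  | zero => simp
  | tmul v w =>
    obtain ⟨n, c, rfl⟩ := exists_eq_sum_word (β := β) v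
    obtain ⟨n', c', rfl⟩ := exists_eq_sum_word (β := β) w
    have := (Filter.eventually_all_finset (lowDegree d n)).2 fun e _ =>
      (Filter.eventually_all_finset (lowDegree d n')).2 fun f _ => key' e f
    filter_upwards [this] with t ht
    rw [TensorProduct.sum_tmul, map_sum, map_sum]
    refine Finset.sum_congr rfl fun e he => ?_
    rw [TensorProduct.tmul_sum, map_sum, map_sum]
    refine Finset.sum_congr rfl fun f hf => ?_
    rw [TensorProduct.smul_tmul_smul, map_smul, map_smul, ht e he f hf]
  | add v w hv hw =>
    filter_upwards [hv, hw] with t hv hw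
    rw [map_add, map_add, hv, hw]

/-! ### Products -/

/-- Induction on words built by right multiplication. -/
theorem word_induction {P : UniversalEnvelopingAlgebra k L → Prop} (h1 : P 1)
    (hι : ∀ u i, P u → P (u * UniversalEnvelopingAlgebra.ι k (β i))) (l : List (Fin d)) :
    P (Env.word β l) := by
  induction l using List.reverseRecOn with
  | nil => exact h1
  | append_singleton l i ih =>
    rw [Env.word_append, Env.word_cons, Env.word_nil, mul_one]
    exact hι _ _ ih

theorem pair_mul_ι_left (x y : C.alg) (i : Fin d)
    (w : UniversalEnvelopingAlgebra k L ⊗[k] UniversalEnvelopingAlgebra k L) :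
    FormalSeries.pair (phi h x ⊗ₜ phi h y) (w * UniversalEnvelopingAlgebra.ι k (β i) ⊗ₜ 1) =
      FormalSeries.pair (phi h (C.dword [i] x) ⊗ₜ phi h y) w := by
  induction w with
  | zero => simp
  | tmul u v =>
    rw [Algebra.TensorProduct.tmul_mul_tmul, mul_one]
    simp only [FormalSeries.pair, TensorProduct.dualDistrib_apply, phi_mul_ι]
  | add s t hs ht => rw [add_mul, map_add, map_add, hs, ht]

theorem pair_mul_ι_right (x y : C.alg) (i : Fin d)
    (w : UniversalEnvelopingAlgebra k L ⊗[k] UniversalEnvelopingAlgebra k L) :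
    FormalSeries.pair (phi h x ⊗ₜ phi h y) (w * 1 ⊗ₜ UniversalEnvelopingAlgebra.ι k (β i)) =
      FormalSeries.pair (phi h x ⊗ₜ phi h (C.dword [i] y)) w := by
  induction w with
  | zero => simp
  | tmul u v =>
    rw [Algebra.TensorProduct.tmul_mul_tmul, mul_one]
    simp only [FormalSeries.pair, TensorProduct.dualDistrib_apply, phi_mul_ι]
  | add s t hs ht => rw [add_mul, map_add, map_add, hs, ht]

theorem pair_mul_envComul_ι (x y : C.alg) (i : Fin d)
    (w : UniversalEnvelopingAlgebra k L ⊗[k] UniversalEnvelopingAlgebra k L) :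
    FormalSeries.pair (phi h x ⊗ₜ phi h y)
      (w * envComul k L (UniversalEnvelopingAlgebra.ι k (β i))) =
        FormalSeries.pair (phi h (C.dword [i] x) ⊗ₜ phi h y) w +
          FormalSeries.pair (phi h x ⊗ₜ phi h (C.dword [i] y)) w := by
  rw [envComul_ι, mul_add, map_add, pair_mul_ι_left, pair_mul_ι_right]

/-- Modulo `h` the operator `C.dword [i]` is a derivation, and `β i` is primitive. Both sides obey
the same recursion under right multiplication by `β i`. -/
theorem phi_mul (x y : C.alg) : phi h (x * y) = FormalSeries.mul (phi h x) (phi h y) := by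
  refine formalSeries_ext (β := β) fun e => ?_
  refine word_induction (β := β) (P := fun u => ∀ x y,
    phi h (x * y) u = FormalSeries.mul (phi h x) (phi h y) u) ?_ ?_ _ x y
  · intro x y
    rw [FormalSeries.mul, LinearMap.comp_apply, AlgHom.toLinearMap_apply,
      map_one (envComul k L), Algebra.TensorProduct.one_def, FormalSeries.pair, TensorProduct.dualDistrib_apply,
      phi_apply_one, phi_apply_one, phi_apply_one, Subalgebra.coe_mul, map_mul T.counit, RingHom.map_mul]
  · intro u i hu x y
    rw [phi_mul_ι, phi_eq_of_sub_mem h (C.dword_mul_sub_mem i x y), map_add, LinearMap.add_apply,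
      hu, hu]
    simp only [FormalSeries.mul, LinearMap.comp_apply, AlgHom.toLinearMap_apply]
    rw [map_mul, pair_mul_envComul_ι]

theorem phi_one : phi h 1 = FormalSeries.one := by
  refine formalSeries_ext (β := β) fun e => ?_
  have h1 : FormalSeries.one (Env.word β (sortedWord e)) =
      if sortedWord e = [] then (1 : k) else 0 := by
    rw [FormalSeries.one, AlgHom.toLinearMap_apply]
    rcases sortedWord e with _ | ⟨i, l⟩
    · rw [Env.word_nil, map_one, if_pos rfl]
    · rw [Env.word_cons, map_mul, if_neg (List.cons_ne_nil _ _)]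
      have : envCounit k L (UniversalEnvelopingAlgebra.ι k (β i)) = 0 :=
        UniversalEnvelopingAlgebra.lift_ι_apply k _ _
      rw [this, zero_mul]
  have h2 : phi h 1 (Env.word β (sortedWord e)) = PowerSeries.constantCoeff
      (T.counit ((C.dop e 1 : C.alg) : H)) := phi_sortedWord h e 1
  rw [h1, h2]
  split_ifs with he
  · rw [sortedWord_eq_nil.1 he, dop_zero, Subalgebra.coe_one, map_one, map_one]
  · have : PowerSeries.X ^ (∑ i, e i) * C.dcoord e 1 = 0 := by
      rw [pow_mul_dcoord, Subalgebra.coe_one, coord_one, if_neg (mt sortedWord_eq_nil.2 he)]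
    have h3 := (mul_eq_zero.1 this).resolve_left (pow_ne_zero _ PowerSeries.X_ne_zero)
    change PowerSeries.constantCoeff (C.dcoord e 1) = 0
    rw [h3, map_zero]

end TopHopf.Coords

end

noncomputable section

/-! ## The antipode -/

namespace Env

attribute [local instance] LieRing.ofAssociativeRing

variable {k L : Type*} [Field k] [LieRing L] [LieAlgebra k L]

local notation "U" => UniversalEnvelopingAlgebra k L

theorem antipode_one : envAntipode k L 1 = 1 := by
  simp [envAntipode]

theorem antipode_mul_ι (u : UniversalEnvelopingAlgebra k L) (x : L) :
    envAntipode k L (u * UniversalEnvelopingAlgebra.ι k x) =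
      -(UniversalEnvelopingAlgebra.ι k x * envAntipode k L u) := by
  rw [envAntipode, LinearMap.comp_apply, LinearMap.comp_apply, AlgHom.toLinearMap_apply, map_mul,
    UniversalEnvelopingAlgebra.lift_ι_apply, ← neg_mul]
  rfl

variable {d : ℕ} (β : Module.Basis (Fin d) k L)

/-- A new last letter `x` turns the value `v` into `- x v + v x`, which is zero because `v` is a
scalar. -/
theorem antipode_comul_word (l : List (Fin d)) :
    LinearMap.mul' k U (TensorProduct.map (envAntipode k L) LinearMap.id
      (envComul k L (word β l))) = algebraMap k U (envCounit k L (word β l)) := by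
  induction l using List.reverseRecOn with
  | nil =>
    rw [word_nil, map_one (envComul k L), map_one (envCounit k L), Algebra.TensorProduct.one_def,
      TensorProduct.map_tmul, antipode_one]
    simp
  | append_singleton l i ih =>
    set x := UniversalEnvelopingAlgebra.ι k (β i)
    have e1 : ∀ w : U ⊗[k] U, LinearMap.mul' k U (TensorProduct.map (envAntipode k L)
        LinearMap.id (w * envComul k L x)) =
          -(x * LinearMap.mul' k U (TensorProduct.map (envAntipode k L) LinearMap.id w)) +
          LinearMap.mul' k U (TensorProduct.map (envAntipode k L) LinearMap.id w) * x := by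
      intro w
      rw [envComul_ι]
      induction w with
      | zero => simp
      | tmul a b =>
        rw [mul_add, Algebra.TensorProduct.tmul_mul_tmul, Algebra.TensorProduct.tmul_mul_tmul,
          map_add, map_add, mul_one, mul_one, TensorProduct.map_tmul, TensorProduct.map_tmul,
          TensorProduct.map_tmul, antipode_mul_ι]
        simp only [LinearMap.mul'_apply, LinearMap.id_apply]
        noncomm_ring
      | add s t hs ht =>
        rw [add_mul, map_add, map_add, hs, ht]
        simp only [map_add, mul_add, add_mul]
        abel
    have h0 : envCounit k L x = 0 := UniversalEnvelopingAlgebra.lift_ι_apply k _ _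
    rw [word_append, word_cons, word_nil, mul_one, map_mul (envComul k L), map_mul (envCounit k L), e1, ih, h0, mul_zero,
      map_zero, Algebra.commutes]
    exact neg_add_cancel _

/-- The span of the tensors `v ⊗ w` with `v ∈ fil β n`. -/
def tensorFil (n : ℕ) : Submodule k (U ⊗[k] U) :=
  Submodule.span k {t | ∃ v ∈ fil β n, ∃ w, t = v ⊗ₜ w}

theorem comul_word_sub_mem (l : List (Fin d)) :
    envComul k L (word β l) - word β l ⊗ₜ 1 ∈ tensorFil β l.length := by
  induction l with
  | nil =>
    rw [word_nil, map_one, Algebra.TensorProduct.one_def, sub_self]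
    exact zero_mem _
  | cons i l ih =>
    set x := UniversalEnvelopingAlgebra.ι k (β i)
    have h1 : ∀ t ∈ tensorFil β l.length, envComul k L x * t ∈ tensorFil β (l.length + 1) := by
      intro t ht
      induction ht using Submodule.span_induction with
      | mem t ht =>
        obtain ⟨v, hv, w, rfl⟩ := ht
        rw [envComul_ι, add_mul, Algebra.TensorProduct.tmul_mul_tmul,
          Algebra.TensorProduct.tmul_mul_tmul, one_mul, one_mul]
        exact add_mem (Submodule.subset_span ⟨_, ι_mul_mem_fil β _ hv, _, rfl⟩)
          (Submodule.subset_span ⟨_, fil_mono β (Nat.le_succ _) hv, _, rfl⟩)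
      | zero => rw [mul_zero]; exact zero_mem _
      | add s t _ _ hs ht => rw [mul_add]; exact add_mem hs ht
      | smul c t _ ht => rw [mul_smul_comm]; exact Submodule.smul_mem _ _ ht
    have h2 : (word β l ⊗ₜ x : U ⊗[k] U) ∈ tensorFil β (l.length + 1) :=
      Submodule.subset_span ⟨_, word_mem_fil β (Nat.lt_succ_self _), _, rfl⟩
    have h3 := add_mem (h1 _ ih) h2
    rw [List.length_cons]
    convert h3 using 1
    rw [word_cons, map_mul, mul_sub, envComul_ι, add_mul _ _ (word β l ⊗ₜ[k] (1 : U)),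
      Algebra.TensorProduct.tmul_mul_tmul, Algebra.TensorProduct.tmul_mul_tmul, one_mul, one_mul,
      mul_one]
    abel

end Env

namespace TopHopf.Coords

variable {k H : Type*} [Field k] [Ring H] [Algebra k⟦X⟧ H] [TopologicalSpace H]
  {T : TopHopf k⟦X⟧ H} {hH : IsTopFree k H} {d : ℕ} {C : T.Coords hH d}
  {L : Type*} [LieRing L] [LieAlgebra k L] {β : Module.Basis (Fin d) k L} (h : C.LieRel β)

theorem exists_phi_eq_zero (u : UniversalEnvelopingAlgebra k L) :
    ∃ n, ∀ a ∈ C.algSub n, phi h a u = 0 := by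
  obtain ⟨n, c, rfl⟩ := exists_eq_sum_word (β := β) u
  refine ⟨n, fun a ha => ?_⟩
  rw [map_sum]
  refine Finset.sum_eq_zero fun e he => ?_
  rw [map_smul, phi_sortedWord, constantCoeff_dcoord_eq (b := 0) (by rwa [sub_zero])
    (mem_lowDegree.1 he), map_zero, map_zero, smul_zero]

theorem pair_map_antipode (F G : FormalSeries k L)
    (w : UniversalEnvelopingAlgebra k L ⊗[k] UniversalEnvelopingAlgebra k L) :
    FormalSeries.pair (F ⊗ₜ G) (TensorProduct.map (envAntipode k L) LinearMap.id w) =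
      FormalSeries.pair (F.antipode ⊗ₜ G) w := by
  induction w with
  | zero => simp
  | tmul a b => simp [FormalSeries.pair, TensorProduct.dualDistrib_apply, FormalSeries.antipode]
  | add s t hs ht => simp only [map_add, hs, ht]

theorem phi_dy_one (e : Fin d → ℕ) : phi h (C.dy e) 1 = if 0 = e then 1 else 0 := by
  rw [← Env.word_nil β, ← sortedWord_zero, phi_sortedWord, dcoord_dy]
  split_ifs
  · exact map_one _
  · exact map_zero _

theorem sum_pair_tmul_one {m : ℕ} (hm : 0 < m) (F : (Fin d → ℕ) → FormalSeries k L)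
    (u : UniversalEnvelopingAlgebra k L) : ∑ e ∈ lowDegree d m,
      FormalSeries.pair (F e ⊗ₜ phi h (C.dy e)) (u ⊗ₜ 1) = F 0 u := by
  have h0 : (0 : Fin d → ℕ) ∈ lowDegree d m := mem_lowDegree.2 (by simpa using hm)
  rw [Finset.sum_eq_single_of_mem _ h0]
  · rw [FormalSeries.pair, TensorProduct.dualDistrib_apply, phi_dy_one, if_pos rfl, mul_one]
  · intro e _ he
    rw [FormalSeries.pair, TensorProduct.dualDistrib_apply, phi_dy_one, if_neg he.symm, mul_zero]

/-- The antipode axiom of `C.alg`, seen through `phi` at `u`. Continuity of evaluation at `u` turns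
convergence into an eventual equality. -/
theorem eventually_sum_antipode (x : C.alg) (u : UniversalEnvelopingAlgebra k L) :
    ∀ᶠ m in atTop, ∑ e ∈ lowDegree d m, FormalSeries.pair
      (phi h (C.algAntipode (C.dop e x)) ⊗ₜ phi h (C.dy e)) (envComul k L u) =
        PowerSeries.constantCoeff (T.counit (x : H)) * envCounit k L u := by
  obtain ⟨n, hn⟩ := exists_phi_eq_zero h u
  have h1 := (C.tendsto_algExpansion x).eventually ((C.algHopf.antipode_comul x).eventually
    ((C.isOpen_alg_iff.2 fun a ha => ⟨n, fun b hb => by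
      have := add_mem hb ha
      rwa [sub_add_sub_cancel] at this⟩ :
        IsOpen {a | a - algebraMap k⟦X⟧ C.alg (C.algHopf.counit x) ∈ C.algSub n}).mem_nhds (by
          change _ - _ ∈ C.algSub n
          rw [sub_self]
          exact zero_mem _)))
  refine h1.mono fun m hm => ?_
  have h2 := hn _ hm
  rw [map_sub, LinearMap.sub_apply, sub_eq_zero, algExpansion_apply] at h2
  simp only [map_sum, TensorProduct.map_tmul, LinearMap.mul'_apply, LinearMap.id_apply,
    LinearMap.sum_apply, Algebra.algebraMap_eq_smul_one, map_smulₛₗ, phi_mul, phi_one,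
    LinearMap.smul_apply] at h2
  exact h2

/-- Both sides solve the same left convolution inverse equation. In it the term `u ⊗ 1` of `Δ u`
isolates the value at `u`, and the other terms have first factors of lower filtration degree, where
induction applies. -/
theorem phi_antipode (x : C.alg) : phi h (C.algAntipode x) = (phi h x).antipode := by
  suffices key : ∀ n, ∀ v ∈ Env.fil β n, ∀ x : C.alg,
      phi h (C.algAntipode x) v = (phi h x).antipode v by
    refine LinearMap.ext fun v => ?_
    obtain ⟨n, hn⟩ := Env.exists_mem_fil β v
    exact key n v hn x
  intro n
  induction n with
  | zero =>
    intro v hv x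
    rw [Env.fil_zero, Submodule.mem_bot] at hv
    rw [hv, map_zero, map_zero]
  | succ n ih =>
    intro v hv x
    induction hv using Submodule.span_induction with
    | mem v hv =>
      obtain ⟨l, hl, rfl⟩ := hv
      set u := Env.word β l
      obtain ⟨m, h1, h2, hm⟩ := ((eventually_sum_antipode h x u).and
        (((C.tendsto_algExpansion x).eventually (phi_comul h x (TensorProduct.map (envAntipode k L)
          LinearMap.id (envComul k L u)))).and (eventually_gt_atTop 0))).exists
      rw [algExpansion_apply, map_sum, map_sum, LinearMap.sum_apply, FormalSeries.comul,
        LinearMap.comp_apply, Env.antipode_comul_word, Algebra.algebraMap_eq_smul_one, map_smul,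
        phi_apply_one, smul_eq_mul, mul_comm, ← h1] at h2
      simp only [TensorProduct.map_tmul, pair_map_antipode] at h2
      have hs : envComul k L u = u ⊗ₜ 1 + (envComul k L u - u ⊗ₜ 1) := by abel
      rw [hs] at h2
      simp only [map_add, Finset.sum_add_distrib] at h2
      -- Against `u ⊗ 1` only the index `e = 0` contributes, since `phi h (C.dy e)` vanishes at `1`
      -- for `e ≠ 0`.
      rw [sum_pair_tmul_one h hm fun e => (phi h (C.dop e x)).antipode,
        sum_pair_tmul_one h hm fun e => phi h (C.algAntipode (C.dop e x)), dop_zero] at h2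
      have h3 : ∀ t ∈ Env.tensorFil β n, ∀ (y : C.alg) (G : FormalSeries k L),
          FormalSeries.pair ((phi h y).antipode ⊗ₜ G) t =
            FormalSeries.pair (phi h (C.algAntipode y) ⊗ₜ G) t := by
        intro t ht y G
        induction ht using Submodule.span_induction with
        | mem t ht =>
          obtain ⟨v, hv, w, rfl⟩ := ht
          simp only [FormalSeries.pair, TensorProduct.dualDistrib_apply, ih v hv y]
        | zero => simp
        | add s t _ _ hs ht => rw [map_add, map_add, hs, ht]
        | smul c t _ ht => rw [map_smul, map_smul, ht]
      have h4 : Env.tensorFil β l.length ≤ Env.tensorFil β n :=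
        Submodule.span_mono fun t ⟨v, hv, w, ht⟩ =>
          ⟨v, Env.fil_mono β (Nat.lt_succ_iff.1 hl) hv, w, ht⟩
      have h5 : envComul k L u - u ⊗ₜ 1 ∈ Env.tensorFil β n := h4 (Env.comul_word_sub_mem β l)
      simp only [h3 _ h5] at h2
      exact (add_right_cancel h2).symm
    | zero => rw [map_zero, map_zero]
    | add v w _ _ hv hw => rw [map_add, map_add, hv, hw]
    | smul c v _ hv => rw [map_smul, map_smul, hv]

/-! ### Commutators -/

-- `x * y` and `y * x` have the same image under `phi`, by the symmetric derivation rule and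
-- commutativity of `k[[h]]`.
include h in
theorem mul_sub_mul_mem (x y : C.alg) : x * y - y * x ∈ hSub k C.alg 1 := by
  have : phi h (x * y - y * x) = 0 := by
    rw [map_sub, sub_eq_zero]
    refine formalSeries_ext (β := β) fun e => ?_
    refine word_induction (β := β) (P := fun u => ∀ x y,
      phi h (x * y) u = phi h (y * x) u) ?_ ?_ _ x y
    · intro x y
      rw [phi_apply_one, phi_apply_one, Subalgebra.coe_mul, Subalgebra.coe_mul, map_mul T.counit,
        map_mul T.counit, mul_comm]
    · intro u i hu x y
      rw [phi_mul_ι, phi_mul_ι, phi_eq_of_sub_mem h (C.dword_mul_sub_mem i x y),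
        phi_eq_of_sub_mem h (C.dword_mul_sub_mem i y x), map_add, map_add, LinearMap.add_apply,
        LinearMap.add_apply, hu (C.dword [i] x) y, hu x (C.dword [i] y), add_comm]
  obtain ⟨z, hz⟩ := (phi_eq_zero_iff h _).1 this
  exact mem_hSub.2 ⟨z, by rw [hz, pow_one]⟩

include h in
theorem exists_smul_eq_commutator (x y : C.alg) :
    ∃ z : C.alg, (PowerSeries.X : k⟦X⟧) • z = x * y - y * x := by
  obtain ⟨z, hz⟩ := mem_hSub.1 (mul_sub_mul_mem h x y)
  exact ⟨z, by rw [hz, pow_one]⟩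

theorem pair_comul_mul_ι_ι (x y : C.alg) (l j : Fin d) (u : UniversalEnvelopingAlgebra k L) :
    FormalSeries.pair (phi h x ⊗ₜ phi h y) (envComul k L u *
      (UniversalEnvelopingAlgebra.ι k (β l) ⊗ₜ UniversalEnvelopingAlgebra.ι k (β j))) =
        phi h (C.dword [l] x * C.dword [j] y) u := by
  have : (UniversalEnvelopingAlgebra.ι k (β l) ⊗ₜ[k] UniversalEnvelopingAlgebra.ι k (β j)) =
      (1 ⊗ₜ[k] UniversalEnvelopingAlgebra.ι k (β j)) *
        (UniversalEnvelopingAlgebra.ι k (β l) ⊗ₜ[k] 1) := by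
    rw [Algebra.TensorProduct.tmul_mul_tmul, one_mul, mul_one]
  rw [this, ← mul_assoc, pair_mul_ι_left, pair_mul_ι_right, phi_mul]
  rfl

end TopHopf.Coords

end

noncomputable section

/-! ## The quantised formal series Hopf algebra of a quantised enveloping algebra -/

section DualBasis

attribute [local instance] LieRing.ofAssociativeRing

variable {k g : Type*} [Field k] [LieRing g] [LieAlgebra k g] [LieBialgebra k g] {d : ℕ}
  (b : Module.Basis (Fin d) k g)

/-- The basis of the dual Lie bialgebra dual to `b`. -/
def lieDualBasis : Module.Basis (Fin d) k (LieDual k g) :=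
  show Module.Basis (Fin d) k (Module.Dual k g) from b.dualBasis

theorem eval_lieDualBasis (i j : Fin d) :
    LieDual.eval k g (lieDualBasis b i) (b j) = if j = i then 1 else 0 :=
  b.dualBasis_apply_self i j

theorem lieDualBasis_repr (α : LieDual k g) (i : Fin d) :
    (lieDualBasis b).repr α i = LieDual.eval k g α (b i) :=
  b.dualBasis_repr α i

theorem eq_sum_dualPairing (s : LieDual k g ⊗[k] LieDual k g) : s = ∑ l, ∑ j,
    dualPairing k g s (b l ⊗ₜ b j) • (lieDualBasis b l ⊗ₜ[k] lieDualBasis b j) := by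
  induction s with
  | zero => simp
  | tmul α γ =>
    conv_lhs => rw [← (lieDualBasis b).sum_repr α, ← (lieDualBasis b).sum_repr γ]
    rw [TensorProduct.sum_tmul]
    refine Finset.sum_congr rfl fun l _ => ?_
    rw [TensorProduct.tmul_sum]
    refine Finset.sum_congr rfl fun j _ => ?_
    rw [TensorProduct.smul_tmul_smul, dualPairing_tmul, lieDualBasis_repr, lieDualBasis_repr]
  | add s t hs ht =>
    simp only [map_add, LinearMap.add_apply, add_smul, Finset.sum_add_distrib]
    rw [← hs, ← ht]

theorem functional_ι {τ : Fin d → Module.Dual k (UniversalEnvelopingAlgebra k g)}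
    (h2 : ∀ i j, τ i (UniversalEnvelopingAlgebra.ι k (b j)) = if j = i then 1 else 0)
    (i : Fin d) (x : g) : τ i (UniversalEnvelopingAlgebra.ι k x) =
      LieDual.eval k g (lieDualBasis b i) x := by
  have : τ i ∘ₗ ((UniversalEnvelopingAlgebra.ι k : g →ₗ⁅k⁆ _) : g →ₗ[k] _) =
      LieDual.eval k g (lieDualBasis b i) :=
    b.ext fun j => (h2 i j).trans (eval_lieDualBasis b i j).symm
  exact LinearMap.congr_fun this x

theorem pair_envTensorι {τ : Fin d → Module.Dual k (UniversalEnvelopingAlgebra k g)}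
    (h2 : ∀ i j, τ i (UniversalEnvelopingAlgebra.ι k (b j)) = if j = i then 1 else 0)
    (i j : Fin d) (s : g ⊗[k] g) : FormalSeries.pair (τ i ⊗ₜ τ j) (envTensorι k g s) =
      dualPairing k g (lieDualBasis b i ⊗ₜ lieDualBasis b j) s := by
  induction s with
  | zero => simp
  | tmul x y =>
    rw [dualPairing_tmul, ← functional_ι b h2, ← functional_ι b h2]
    rfl
  | add s t hs ht => rw [map_add, map_add, map_add, hs, ht]

end DualBasis

section Quantum

attribute [local instance] LieRing.ofAssociativeRing

variable {k g H : Type*} [Field k] [CharZero k] [LieRing g] [LieAlgebra k g] [LieBialgebra k g]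
  [Ring H] [Algebra k⟦X⟧ H] [TopologicalSpace H] {T : TopHopf k⟦X⟧ H}
  {p : H →ₛₗ[PowerSeries.constantCoeff (R := k)] UniversalEnvelopingAlgebra k g}
  (hp : IsQUEA T p) {d : ℕ} (b : Module.Basis (Fin d) k g)
  {τ : Fin d → Module.Dual k (UniversalEnvelopingAlgebra k g)} {C : T.Coords hp.topFree d}
  (h1 : ∀ i, τ i 1 = 0)
  (h2 : ∀ i j, τ i (UniversalEnvelopingAlgebra.ι k (b j)) = if j = i then 1 else 0)
  (ht : ∀ i, Lifts p (C.t i) (τ i))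

namespace IsQUEA

include h1 h2 ht

/-- In characteristic zero the functionals `coef` separate points of `U(g)`, and they agree on the
two elements. -/
theorem p_y_single (i : Fin d) :
    p (C.y (Pi.single i 1)) = UniversalEnvelopingAlgebra.ι k (b i) := by
  rw [← sub_eq_zero]
  refine Env.eq_zero_of_coef b τ h1 h2 fun e => ?_
  rw [map_sub, Env.coef_ι b τ h1 h2, ← hp.lifts_wordCoord ht]
  change PowerSeries.constantCoeff (C.coord e _) - _ = 0
  rw [C.coord_y]
  split_ifs <;> simp

/-- The structure constants `c (y_l)` reduce modulo `h` to `τ i ⊗ τ j` evaluated on the cobracket of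
`b l`, that is, to the bracket of the dual basis elements evaluated at `b l`. -/
theorem lieRel : C.LieRel (lieDualBasis b) := by
  intro i j a
  obtain ⟨c, hc1, hc⟩ := C.comm i j
  have hcc : ∀ l, (PowerSeries.X : k⟦X⟧) ∣ c (C.y (Pi.single l 1)) -
      PowerSeries.C ((lieDualBasis b).repr ⁅lieDualBasis b i, lieDualBasis b j⁆ l) := by
    intro l
    obtain ⟨r, hr, hr'⟩ := hp.commutator (ht i) (ht j) (C.y (Pi.single l 1))
    have h3 := congrArg T.counit (hc (C.y (Pi.single l 1)))
    rw [T.counit_slice, map_add, T.counit_slice, map_smul, T.counit_slice, ← sub_eq_iff_eq_add',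
      hr, smul_eq_mul] at h3
    rw [← mul_left_cancel₀ PowerSeries.X_ne_zero h3, PowerSeries.X_dvd_iff, map_sub, hr',
      PowerSeries.constantCoeff_C, hp.p_y_single b h1 h2 ht, envCobracket_ι,
      pair_envTensorι b h2, lieDualBasis_repr, LieDual.eval_lie, dualPairing_tmul_lid, sub_self]
  have h4 := C.dword_lie_sub_mem i j c hc1 hc a
  have h5 : ∑ l, (c (C.y (Pi.single l 1)) - PowerSeries.C ((lieDualBasis b).repr
      ⁅lieDualBasis b i, lieDualBasis b j⁆ l)) • C.dword [l] a ∈ hSub k C.alg 1 :=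
    sum_mem fun l _ => smul_mem_hSub (by rw [pow_one]; exact hcc l) _
  have h6 := add_mem h4 h5
  simp only [sub_smul, Finset.sum_sub_distrib] at h6
  convert h6 using 1
  abel

variable [FiniteDimensional k g]

/-- Recursion on the last letter: `dword_poisson_sub_mem` mirrors the co-Leibniz rule
`envCobracket_mul`. The coefficients `t i [y_l, y_j]` reduce to the dual basis element evaluated at
`[b l, b j]`, which are the coefficients of its cobracket in `g*`. -/
theorem phi_poisson (h : C.LieRel (lieDualBasis b)) {x y z : C.alg}
    (hz : (PowerSeries.X : k⟦X⟧) • z = x * y - y * x) :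
    TopHopf.Coords.phi h z =
      FormalSeries.poisson (TopHopf.Coords.phi h x) (TopHopf.Coords.phi h y) := by
  open TopHopf.Coords in
  refine formalSeries_ext (β := lieDualBasis b) fun e => ?_
  refine word_induction (β := lieDualBasis b) (P := fun u => ∀ x y z : C.alg,
    (PowerSeries.X : k⟦X⟧) • z = x * y - y * x →
      phi h z u = FormalSeries.poisson (phi h x) (phi h y) u) ?_ ?_ _ x y z hz
  · intro x y z hz
    have e1 : envCobracket k (LieDual k g) 1 = 0 := by
      change (envDual k (LieDual k g) 1).snd = 0
      rw [_root_.map_one (envDual k (LieDual k g)), TrivSqZeroExt.snd_one]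
    have e2 : (PowerSeries.X : k⟦X⟧) * T.counit (z : H) = 0 := by
      rw [← smul_eq_mul, ← map_smul, ← Subalgebra.coe_smul, hz, Subalgebra.coe_sub,
        Subalgebra.coe_mul, Subalgebra.coe_mul, map_sub, _root_.map_mul T.counit, _root_.map_mul T.counit, mul_comm, sub_self]
    rw [FormalSeries.poisson, LinearMap.comp_apply, e1, map_zero, phi_apply_one,
      (mul_eq_zero.1 e2).resolve_left PowerSeries.X_ne_zero, map_zero]
  · intro u i hu x y z hz
    obtain ⟨x', hx'⟩ := exists_smul_eq_commutator h (C.dword [i] x) y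
    obtain ⟨y', hy'⟩ := exists_smul_eq_commutator h x (C.dword [i] y)
    have e1 : ∀ l j, PowerSeries.constantCoeff (C.t i (C.y (Pi.single l 1) * C.y (Pi.single j 1) -
        C.y (Pi.single j 1) * C.y (Pi.single l 1))) =
          dualPairing k g (dualCobracket k g (lieDualBasis b i)) (b l ⊗ₜ b j) := by
      intro l j
      rw [ht i, map_sub, hp.map_mul, hp.map_mul, hp.p_y_single b h1 h2 ht,
        hp.p_y_single b h1 h2 ht, dualPairing_dualCobracket, ← functional_ι b h2, LieHom.map_lie]
      rfl
    rw [phi_mul_ι, phi_eq_of_sub_mem h (C.dword_poisson_sub_mem i hz hx' hy' (mul_sub_mul_mem h)),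
      map_add, map_add, LinearMap.add_apply, LinearMap.add_apply, hu _ _ _ hx', hu _ _ _ hy']
    simp only [FormalSeries.poisson, LinearMap.comp_apply]
    rw [envCobracket_mul, map_add, pair_mul_envComul_ι, envCobracket_ι]
    congr 1
    change _ = FormalSeries.pair _ (envComul k (LieDual k g) u *
      envTensorι k (LieDual k g) (dualCobracket k g (lieDualBasis b i)))
    conv_rhs => rw [eq_sum_dualPairing b (dualCobracket k g (lieDualBasis b i))]
    simp only [map_sum, map_smul, Finset.mul_sum, mul_smul_comm, LinearMap.sum_apply]
    refine Finset.sum_congr rfl fun l _ => Finset.sum_congr rfl fun j _ => ?_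
    rw [map_smulₛₗ, e1, LinearMap.smul_apply, ← pair_comul_mul_ι_ι]
    rfl

end IsQUEA

end Quantum

theorem IsQUEA.isQFSHA {k : Type*} {g : Type*} {H : Type u} [Field k] [CharZero k] [LieRing g]
    [LieAlgebra k g] [LieBialgebra k g] [FiniteDimensional k g]
    [Ring H] [Algebra k⟦X⟧ H] [TopologicalSpace H] {T : TopHopf k⟦X⟧ H}
    {p : H →ₛₗ[PowerSeries.constantCoeff (R := k)] UniversalEnvelopingAlgebra k g}
    (hp : IsQUEA T p) {d : ℕ} (b : Module.Basis (Fin d) k g)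
    {τ : Fin d → Module.Dual k (UniversalEnvelopingAlgebra k g)} {C : T.Coords hp.topFree d}
    (h1 : ∀ i, τ i 1 = 0)
    (h2 : ∀ i j, τ i (UniversalEnvelopingAlgebra.ι k (b j)) = if j = i then 1 else 0)
    (ht : ∀ i, Lifts p (C.t i) (τ i)) :
    IsQFSHA C.algHopf (TopHopf.Coords.phi (hp.lieRel b h1 h2 ht)) where
  topProduct := C.isTopProduct_alg
  ker := TopHopf.Coords.phi_eq_zero_iff _
  isOpenQuotientMap := TopHopf.Coords.isOpenQuotientMap_phi _
  map_one := TopHopf.Coords.phi_one _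
  map_mul := TopHopf.Coords.phi_mul _
  comul := TopHopf.Coords.phi_comul _
  counit x := (TopHopf.Coords.phi_apply_one _ x).symm
  antipode := TopHopf.Coords.phi_antipode _
  poisson x y := by
    obtain ⟨z, hz⟩ := TopHopf.Coords.exists_smul_eq_commutator (hp.lieRel b h1 h2 ht) x y
    exact ⟨z, hz, hp.phi_poisson b h1 h2 ht _ hz⟩

end

noncomputable section

/-! ## Series of ordered monomials -/

namespace IsTopFree

variable {k M : Type*} [Field k] [AddCommGroup M] [Module k⟦X⟧ M] [TopologicalSpace M]
  (hM : IsTopFree k M)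

include hM

theorem mem_closure_iff {s : Set M} {x : M} :
    x ∈ closure s ↔ ∀ n, ∃ y ∈ s, y - x ∈ hSub k M n := by
  rw [mem_closure_iff_nhds]
  refine ⟨fun h n => ?_, fun h t ht => ?_⟩
  · obtain ⟨y, hy, hs⟩ := h _ (hM.mem_nhds.2 ⟨n, fun y hy => hy⟩ :
      {y | y - x ∈ hSub k M n} ∈ 𝓝 x)
    exact ⟨y, hs, hy⟩
  · obtain ⟨n, hn⟩ := hM.mem_nhds.1 ht
    obtain ⟨y, hs, hy⟩ := h n
    exact ⟨y, hn y hy, hs⟩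

theorem exists_sum_sub_mem {ι : Type*} {f : ι → M} {x : M} (h : HasSum f x) (n : ℕ) :
    ∃ s : Finset ι, ∑ e ∈ s, f e - x ∈ hSub k M n :=
  (h.eventually (hM.mem_nhds.2 ⟨n, fun _ hy => hy⟩ : {y | y - x ∈ hSub k M n} ∈ 𝓝 x)).exists

variable {d : ℕ} {f : (Fin d → ℕ) → M} (hf : ∀ e, f e ∈ hSub k M (∑ i, e i))

include hf

theorem hasSum_of_forall {x : M} (h : ∀ n, x - ∑ e ∈ lowDegree d n, f e ∈ hSub k M n) :
    HasSum f x := by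
  intro t ht
  obtain ⟨n, hn⟩ := hM.mem_nhds.1 ht
  refine mem_map.2 ((eventually_ge_atTop (lowDegree d n)).mono fun s hs => hn _ ?_)
  change ∑ e ∈ s, f e - x ∈ _
  have h1 : ∑ e ∈ s \ lowDegree d n, f e ∈ hSub k M n := by
    refine sum_mem fun e he => hSub_anti ?_ (hf e)
    rw [Finset.mem_sdiff, mem_lowDegree, not_lt] at he
    exact he.2
  have h2 := sub_mem h1 (h n)
  rw [← Finset.sum_sdiff hs]
  convert h2 using 1
  abel

theorem summable_of_forall : Summable f := by
  obtain ⟨x, hx⟩ := hM.exists_limit (fun n => ∑ e ∈ lowDegree d n, f e) fun n => by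
    rw [lowDegree_succ, Finset.sum_union (lowDegree_disjoint n), add_sub_cancel_left]
    refine sum_mem fun e he => hSub_anti ?_ (hf e)
    exact (show ∑ i, e i = n by simpa using he).ge
  exact ⟨x, hM.hasSum_of_forall hf hx⟩

end IsTopFree

theorem List.prod_map_smul_const {R A ι : Type*} [CommSemiring R] [Semiring A] [Algebra R A]
    (r : R) (x : ι → A) (l : List ι) :
    (l.map fun i => r • x i).prod = r ^ l.length • (l.map x).prod := by
  induction l with
  | nil => simp
  | cons i l ih =>
    rw [List.map_cons, List.prod_cons, ih, smul_mul_smul_comm, List.map_cons, List.prod_cons,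
      List.length_cons, pow_succ']

theorem PowerSeries.X_pow_dvd_mk_sub_sum {k : Type*} [Field k] (γ : ℕ → k) (n : ℕ) :
    (PowerSeries.X : k⟦X⟧) ^ n ∣
      PowerSeries.mk γ - ∑ m ∈ Finset.range n, PowerSeries.C (γ m) * PowerSeries.X ^ m := by
  refine PowerSeries.X_pow_dvd_iff.2 fun m hm => ?_
  rw [map_sub, PowerSeries.coeff_mk, map_sum, Finset.sum_eq_single_of_mem m (by simpa using hm)]
  · simp [PowerSeries.coeff_X_pow]
  · intro j _ hj
    simp [PowerSeries.coeff_X_pow, hj.symm]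

namespace TopHopf.Coords

variable {k H : Type*} [Field k] [Ring H] [Algebra k⟦X⟧ H] [TopologicalSpace H]
  {T : TopHopf k⟦X⟧ H} {hH : IsTopFree k H} {d : ℕ} (C : T.Coords hH d)

/-- The ordered monomial of exponent `e` in the elements of the topological basis of degree one. -/
def mono (e : Fin d → ℕ) : H := (List.ofFn fun i => C.y (Pi.single i 1) ^ e i).prod

theorem pow_smul_mono (e : Fin d → ℕ) : (PowerSeries.X : k⟦X⟧) ^ (∑ i, e i) • C.mono e =
    ((sortedWord e).map fun i => (PowerSeries.X : k⟦X⟧) • C.y (Pi.single i 1)).prod := by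
  rw [List.prod_map_smul_const, sortedWord_length, sortedWord_prod, mono]

theorem smul_y_single_mem (i : Fin d) :
    (PowerSeries.X : k⟦X⟧) • C.y (Pi.single i 1) ∈ C.alg := by
  have := C.pow_smul_y_mem (Pi.single i 1)
  rwa [Finset.sum_pi_single' i, if_pos (Finset.mem_univ i), pow_one] at this

theorem adjoin_le_alg : Algebra.adjoin k⟦X⟧
    (Set.range fun i => (PowerSeries.X : k⟦X⟧) • C.y (Pi.single i 1)) ≤ C.alg :=
  Algebra.adjoin_le (Set.range_subset_iff.2 C.smul_y_single_mem)

theorem mono_mem_adjoin (a : k⟦X⟧) (e : Fin d → ℕ) :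
    (a * PowerSeries.X ^ (∑ i, e i)) • C.mono e ∈ Algebra.adjoin k⟦X⟧
      (Set.range fun i => (PowerSeries.X : k⟦X⟧) • C.y (Pi.single i 1)) := by
  rw [mul_smul, pow_smul_mono]
  refine Subalgebra.smul_mem _ (Subalgebra.list_prod_mem _ fun z hz => ?_) a
  obtain ⟨i, -, rfl⟩ := List.mem_map.1 hz
  exact Algebra.subset_adjoin ⟨i, rfl⟩

theorem mono_mem_hSub (a : k⟦X⟧) (e : Fin d → ℕ) :
    (a * PowerSeries.X ^ (∑ i, e i)) • C.mono e ∈ hSub k H (∑ i, e i) :=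
  smul_mem_hSub (dvd_mul_left _ _) _

end TopHopf.Coords

section Monomials

variable {k g H : Type*} [Field k] [CharZero k] [LieRing g] [LieAlgebra k g] [LieBialgebra k g]
  [Ring H] [Algebra k⟦X⟧ H] [TopologicalSpace H] {T : TopHopf k⟦X⟧ H}
  {p : H →ₛₗ[PowerSeries.constantCoeff (R := k)] UniversalEnvelopingAlgebra k g}
  (hp : IsQUEA T p) {d : ℕ} (b : Module.Basis (Fin d) k g)
  {τ : Fin d → Module.Dual k (UniversalEnvelopingAlgebra k g)}

namespace IsQUEA

variable {C : T.Coords hp.topFree d} (h1 : ∀ i, τ i 1 = 0)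
  (h2 : ∀ i j, τ i (UniversalEnvelopingAlgebra.ι k (b j)) = if j = i then 1 else 0)
  (ht : ∀ i, Lifts p (C.t i) (τ i))

include h1 h2 ht

theorem p_mono (e : Fin d → ℕ) : p (C.mono e) = Env.word b (sortedWord e) := by
  rw [TopHopf.Coords.mono, ← sortedWord_prod]
  generalize sortedWord e = l
  induction l with
  | nil => exact hp.map_one
  | cons i l ih =>
    rw [List.map_cons, List.prod_cons, hp.map_mul, ih, hp.p_y_single b h1 h2 ht, Env.word_cons]

/-- For `a = h^n a'`, divisibility of the coordinates forces `coef` of index `e` to vanish on `p a'`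
when `|e| > n`. So `p a'` is a combination of ordered monomials of degree at most `n`, and
subtracting their lifts gains a power of `h`. -/
theorem exists_sub_sum_mono_mem {n : ℕ} {a : H} (ha : a ∈ C.divided) (han : a ∈ hSub k H n) :
    ∃ c : (Fin d → ℕ) → k, (∀ e, n < ∑ i, e i → c e = 0) ∧
      a - ∑ e ∈ lowDegree d (n + 1), (PowerSeries.C (c e) * PowerSeries.X ^ n) • C.mono e ∈
        C.divided ⊓ hSub k H (n + 1) := by
  obtain ⟨a', rfl⟩ := mem_hSub.1 han
  have h3 : p a' ∈ Env.fil b (n + 1) := by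
    refine Env.mem_fil_of_coef b τ h1 h2 fun e he => ?_
    rw [← hp.lifts_wordCoord ht, ← PowerSeries.X_dvd_iff]
    have h4 := ha e
    rw [map_smul, smul_eq_mul] at h4
    have h5 := X_pow_dvd_cancel (m := n) (n := 1) ((pow_dvd_pow _ he).trans h4)
    rwa [pow_one] at h5
  obtain ⟨c, hc⟩ := Env.exists_eq_sum b h3
  refine ⟨fun e => if ∑ i, e i ≤ n then c e else 0, fun e he => if_neg (not_le.2 he),
    sub_mem ha (sum_mem fun e he => ?_), ?_⟩
  -- As `|e| ≤ n`, the element `h^n x^e` is a multiple of `h^|e| x^e`, so the remainder stays in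
  -- `divided`.
  · obtain ⟨m, hm⟩ := Nat.exists_eq_add_of_le' (Nat.lt_succ_iff.1 (mem_lowDegree.1 he))
    have h4 := C.adjoin_le_alg (C.mono_mem_adjoin (PowerSeries.C
      (if ∑ i, e i ≤ n then c e else 0) * PowerSeries.X ^ m) e)
    rwa [mul_assoc, ← pow_add, ← hm] at h4
  · simp only [mul_comm (PowerSeries.C _), mul_smul]
    rw [← Finset.smul_sum, ← smul_sub]
    refine smul_mem_hSub_add dvd_rfl (mem_hSub.2 ?_)
    obtain ⟨z, hz⟩ := (hp.ker (a' - ∑ e ∈ lowDegree d (n + 1),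
      PowerSeries.C (if ∑ i, e i ≤ n then c e else 0) • C.mono e)).1 (by
        rw [map_sub, map_sum, hc, sub_eq_zero]
        refine Finset.sum_congr rfl fun e he => ?_
        rw [map_smulₛₗ, PowerSeries.constantCoeff_C, hp.p_mono b h1 h2 ht,
          if_pos (Nat.lt_succ_iff.1 (mem_lowDegree.1 he))])
    exact ⟨z, by rw [hz, pow_one]⟩

/-- The approximation is iterated. The total coefficient of `x^e` is `∑ c_n(e) h^n`, and `c_n(e) =
0` for `n < |e|` makes it divisible by `h^|e|`. -/
theorem exists_hasSum_mono {a : H} (ha : a ∈ C.divided) : ∃ s : (Fin d → ℕ) → k⟦X⟧,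
    HasSum (fun e => (s e * PowerSeries.X ^ (∑ i, e i)) • C.mono e) a := by
  choose! c hc hc' using fun (n : ℕ) (x : H) (hx : x ∈ C.divided ⊓ hSub k H n) =>
    hp.exists_sub_sum_mono_mem b h1 h2 ht hx.1 hx.2
  let r : ℕ → H := fun n => Nat.rec a (fun n x => x - ∑ e ∈ lowDegree d (n + 1),
    (PowerSeries.C (c n x e) * PowerSeries.X ^ n) • C.mono e) n
  have hr : ∀ n, r n ∈ C.divided ⊓ hSub k H n := fun n => by
    induction n with
    | zero => exact ⟨ha, hSub_zero a⟩
    | succ n ih => exact hc' n _ ih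
  have hsum : ∀ K n, n ≤ K → a - r n = ∑ e ∈ lowDegree d K,
      (∑ m ∈ Finset.range n, PowerSeries.C (c m (r m) e) * PowerSeries.X ^ m) • C.mono e := by
    intro K n hn
    induction n with
    | zero => simp [r]
    | succ n ih =>
      have e1 : r (n + 1) = r n - ∑ e ∈ lowDegree d K,
          (PowerSeries.C (c n (r n) e) * PowerSeries.X ^ n) • C.mono e := by
        change r n - ∑ e ∈ lowDegree d (n + 1), _ = _
        congr 1
        refine Finset.sum_subset (fun e he => ?_) fun e _ he => ?_
        · rw [mem_lowDegree] at *
          exact he.trans_le hn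
        · rw [mem_lowDegree, not_lt] at he
          rw [hc n (r n) (hr n) e he, map_zero, zero_mul, zero_smul]
      simp only [Finset.sum_range_succ, add_smul, Finset.sum_add_distrib]
      rw [← ih (by omega), e1]
      abel
  have hdvd : ∀ e, (PowerSeries.X : k⟦X⟧) ^ (∑ i, e i) ∣ PowerSeries.mk fun n => c n (r n) e :=
    fun e => PowerSeries.X_pow_dvd_iff.2 fun n hn => by
      rw [PowerSeries.coeff_mk, hc n (r n) (hr n) e hn]
  choose s hs using hdvd
  refine ⟨s, hp.topFree.hasSum_of_forall (fun e => C.mono_mem_hSub _ e) fun n => ?_⟩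
  have h3 := hsum n n le_rfl
  rw [← sub_add_cancel a (r n), h3, add_sub_right_comm, ← Finset.sum_sub_distrib]
  refine add_mem (sum_mem fun e _ => ?_) (hr n).2
  rw [← sub_smul, mul_comm (s e), ← hs]
  refine smul_mem_hSub ?_ _
  rw [dvd_sub_comm]
  exact PowerSeries.X_pow_dvd_mk_sub_sum _ n

theorem divided_eq_setOf_hasSum : (C.divided : Set H) = {x | ∃ s : (Fin d → ℕ) → k⟦X⟧,
    HasSum (fun e => (s e * PowerSeries.X ^ (∑ i, e i)) • C.mono e) x} := by
  refine Set.Subset.antisymm (fun a ha => hp.exists_hasSum_mono b h1 h2 ht ha) ?_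
  rintro x ⟨s, hs⟩
  -- Partial sums lie in the algebra generated by the `h x_i`, hence in `divided`, which is closed.
  refine TopHopf.Coords.mem_divided_of_forall fun n => ?_
  obtain ⟨F, hF⟩ := hp.topFree.exists_sum_sub_mem hs n
  exact ⟨_, sum_mem fun e _ => C.adjoin_le_alg (C.mono_mem_adjoin _ e), sub_mem_comm_iff.1 hF⟩

theorem divided_eq_closure : (C.divided : Set H) = closure (Algebra.adjoin k⟦X⟧
    (Set.range fun i => (PowerSeries.X : k⟦X⟧) • C.y (Pi.single i 1)) : Set H) := by
  ext x
  rw [hp.topFree.mem_closure_iff]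
  constructor
  · intro hx n
    obtain ⟨s, hs⟩ := hp.exists_hasSum_mono b h1 h2 ht hx
    obtain ⟨F, hF⟩ := hp.topFree.exists_sum_sub_mem hs n
    exact ⟨_, sum_mem fun e _ => C.mono_mem_adjoin _ e, hF⟩
  · intro hx
    refine TopHopf.Coords.mem_divided_of_forall fun n => ?_
    obtain ⟨y, hy, hn⟩ := hx n
    exact ⟨y, C.adjoin_le_alg hy, sub_mem_comm_iff.1 hn⟩

end IsQUEA

end Monomials

end

theorem proposition3p6 {k g H : Type*} [Field k] [CharZero k]
    [LieRing g] [LieAlgebra k g] [FiniteDimensional k g] [LieBialgebra k g]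
    [Ring H] [Algebra k⟦X⟧ H] [TopologicalSpace H] [IsTopologicalAddGroup H]
    [ContinuousSMul k⟦X⟧ H] (T : TopHopf k⟦X⟧ H)
    (p : H →ₛₗ[PowerSeries.constantCoeff (R := k)] UniversalEnvelopingAlgebra k g)
    (hp : IsQUEA T p) :
    (∃ A : Subalgebra k⟦X⟧ H,
      Subalgebra.toSubmodule A = T.prime (PowerSeries.X : k⟦X⟧) ∧
      ∃ T' : TopHopf k⟦X⟧ A, TopHopf.IsHom T' T A.val ∧
        ∃ φ : A →ₛₗ[PowerSeries.constantCoeff (R := k)] FormalSeries k (LieDual k g),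
          IsQFSHA T' φ) ∧
    ∀ (d : ℕ) (b : Module.Basis (Fin d) k g), ∃ x : Fin d → H,
      (∀ i, p (x i) = UniversalEnvelopingAlgebra.ι k (b i)) ∧
      (∀ i, T.counit (x i) = 0) ∧
      (∀ a : (Fin d → ℕ) → k⟦X⟧, Summable fun e : Fin d → ℕ =>
        (a e * PowerSeries.X ^ (∑ i, e i)) • (List.ofFn fun i => x i ^ e i).prod) ∧
      (T.prime (PowerSeries.X : k⟦X⟧) : Set H) =
        {y | ∃ a : (Fin d → ℕ) → k⟦X⟧, HasSum (fun e : Fin d → ℕ =>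
          (a e * PowerSeries.X ^ (∑ i, e i)) • (List.ofFn fun i => x i ^ e i).prod) y} ∧
      (T.prime (PowerSeries.X : k⟦X⟧) : Set H) =
        closure (Algebra.adjoin k⟦X⟧
          (Set.range fun i => (PowerSeries.X : k⟦X⟧) • x i) : Set H) := by
  constructor
  · obtain ⟨τ, C, h1, h2, ht⟩ := hp.exists_coords (Module.finBasis k g)
    exact ⟨C.alg, C.prime_eq.symm, C.algHopf, C.isHom_val, _, hp.isQFSHA _ h1 h2 ht⟩
  · intro d b
    obtain ⟨τ, C, h1, h2, ht⟩ := hp.exists_coords b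
    rw [C.prime_eq]
    refine ⟨fun i => C.y (Pi.single i 1), hp.p_y_single b h1 h2 ht, fun i => ?_,
      fun a => hp.topFree.summable_of_forall fun e => C.mono_mem_hSub (a e) e,
      hp.divided_eq_setOf_hasSum b h1 h2 ht,
      hp.divided_eq_closure b h1 h2 ht⟩
    -- The counit is the coordinate of index `0`, on which a basis element of degree one vanishes.
    rw [← C.coord_zero, C.coord_y, if_neg]
    intro h
    simpa using congrFun h i
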